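/- Let $d\ge 1$ and let $A,B\in\mathbb R[t]^d$ be linearly independent over $\mathbb R[t]$. Let $M=\langle A,B\rangle=\{aA+bB : a,b\in\mathbb R(t)\}\cap\mathbb R[t]^d$, so that $A,B$ are quasi-generators of $M$. Let $A\wedge B=(A_iB_j-A_jB_i)_{i<j}$ be the vector of $2$-minors of the matrix with rows $A,B$, let $\deg(A\wedge B)$ be the maximal degree of its entries, and let $q_{A,B}$ be the greatest common divisor of its entries. Parameters $t$ are understood as points of $\mathbb P^1$, polynomial vectors being homogenized in their degree (the maximal degree of their entries). Put $$L(M,t)=\{x\in\mathbb R^d : C(t)\cdot x=0\text{ for all }C\in M\},\qquad \mathcal S_M=\bigcup_{t}\mathbb P(L(M,t))\subset\mathbb P^{d-1},$$ and let $\mathcal P\subset\mathbb P^{d(d-1)/2-1}$ be the Plücker curve, the image of the rational map $\varphi_{\mathcal P}:t\mapsto (A\wedge B)(t)$. Assume that $\varphi_{\mathcal P}$ is not constant, so that $\mathcal P$ is a curve. Let $k=\deg\varphi_{\mathcal P}$ be the number of complex parameters that are mapped to a generic complex point of the image. Degrees of $\mathcal P$ and $\mathcal S_M$ are the degrees of their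 Zariski closures, that is, the numbers of complex points in which these meet a generic hyperplane and a generic line, respectively. Then $$k\cdot\deg\mathcal P=\deg(A\wedge B)-\deg q_{A,B}.$$ If moreover $d=3$ or $\mathcal S_M$ is not contained in a hyperplane, then $\mathcal S_M$ is a hypersurface (its Zariski closure has dimension $d-2$), $$k\cdot\deg\mathcal S_M=\deg(A\wedge B)-\deg q_{A,B},\qquad\text{and}\qquad \deg\mathcal P=\deg\mathcal S_M .$$ -/

import Mathlib

open scoped Polynomial LinearAlgebra.Projectivization

/-- `M = ⟨A, B⟩`: all polynomial vectors of the form `a A + b B`, where `a`, `b` are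
rational functions. -/
noncomputable def quasiSpan {d : ℕ} (A B : Fin d → ℝ[X]) : Submodule ℝ[X] (Fin d → ℝ[X]) where
  carrier := {C | ∃ a b : RatFunc ℝ, ∀ i,
    algebraMap ℝ[X] (RatFunc ℝ) (C i) =
      a * algebraMap ℝ[X] (RatFunc ℝ) (A i) + b * algebraMap ℝ[X] (RatFunc ℝ) (B i)}
  zero_mem' := ⟨0, 0, fun i => by simp⟩
  add_mem' := by
    rintro C C' ⟨a, b, h⟩ ⟨a', b', h'⟩
    refine ⟨a + a', b + b', fun i => ?_⟩
    rw [Pi.add_apply, map_add, h i, h' i]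
    ring
  smul_mem' := by
    rintro c C ⟨a, b, h⟩
    refine ⟨algebraMap ℝ[X] (RatFunc ℝ) c * a, algebraMap ℝ[X] (RatFunc ℝ) c * b, fun i => ?_⟩
    rw [Pi.smul_apply, smul_eq_mul, map_mul, h i]
    ring

/-- `A`, `B` are quasi-generators of `M`. -/
def IsQuasiGenerators {d : ℕ} (M : Submodule ℝ[X] (Fin d → ℝ[X])) (A B : Fin d → ℝ[X]) : Prop :=
  LinearIndependent ℝ[X] ![A, B] ∧ M = quasiSpan A B

/-- The pairs `i < j` that index the Plücker coordinates. -/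
abbrev PairIndex (d : ℕ) : Type := {p : Fin d × Fin d // p.1 < p.2}

/-- `A ∧ B`, the vector of the 2-minors `[i, j] = A_i B_j - A_j B_i`, `i < j`. -/
noncomputable def pluckerVec {d : ℕ} (A B : Fin d → ℝ[X]) : PairIndex d → ℝ[X] :=
  fun p => A p.1.1 * B p.1.2 - A p.1.2 * B p.1.1

/-- The degree of a polynomial vector: the maximal degree of its entries. -/
noncomputable def vecDegree {ι : Type} [Fintype ι] (C : ι → ℝ[X]) : ℕ :=
  Finset.univ.sup fun i => (C i).natDegree

/-- The value at `(t : s)`, with `t = v 0` and `s = v 1`, of the polynomial vector `C`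
homogenized in degree `vecDegree C`. -/
noncomputable def homEval (K : Type) [Field K] [Algebra ℝ K] {ι : Type} [Fintype ι]
    (C : ι → ℝ[X]) (v : Fin 2 → K) : ι → K :=
  fun i => ∑ j ∈ Finset.range (vecDegree C + 1),
    algebraMap ℝ K ((C i).coeff j) * v 0 ^ j * v 1 ^ (vecDegree C - j)

/-- The subspace `L(M, τ)` of `ℝ^d`, for a parameter `τ = (t : s)` in the real projective line. -/
noncomputable def moduleSpace {d : ℕ} (M : Submodule ℝ[X] (Fin d → ℝ[X]))
    (τ : ℙ ℝ (Fin 2 → ℝ)) : Submodule ℝ (Fin d → ℝ) where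
  carrier := {x | ∀ C ∈ M, homEval ℝ C τ.rep ⬝ᵥ x = 0}
  zero_mem' := fun C _ => by simp
  add_mem' := fun {x y} hx hy C hC => by rw [dotProduct_add, hx C hC, hy C hC, add_zero]
  smul_mem' := fun c x hx C hC => by rw [dotProduct_smul, hx C hC, smul_zero]

/-- `S_M`, the union of the projective subspaces `ℙ(L(M, τ))` of `ℙ(ℝ^d)`. -/
def moduleHypersurface {d : ℕ} (M : Submodule ℝ[X] (Fin d → ℝ[X])) : Set (ℙ ℝ (Fin d → ℝ)) :=
  {x | ∃ τ : ℙ ℝ (Fin 2 → ℝ), x.rep ∈ moduleSpace M τ}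

/-- The graph of the rational map `φ : ℙ¹ ⇢ ℙ^{d(d-1)/2-1}` given by `A ∧ B`, on points with
coordinates in `K`. -/
def PluckerMapsTo (K : Type) [Field K] [Algebra ℝ K] {d : ℕ} (A B : Fin d → ℝ[X])
    (τ : ℙ K (Fin 2 → K)) (y : ℙ K (PairIndex d → K)) : Prop :=
  ∃ h : homEval K (pluckerVec A B) τ.rep ≠ 0, y = Projectivization.mk K _ h

/-- The points with coordinates in `K` that `φ` parametrizes. -/
def pluckerImage (K : Type) [Field K] [Algebra ℝ K] {d : ℕ} (A B : Fin d → ℝ[X]) :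
    Set (ℙ K (PairIndex d → K)) :=
  {y | ∃ τ, PluckerMapsTo K A B τ y}

/-- The degree of the parametrization `φ` is `k`: the image is a curve, and all but finitely many
of its complex points have exactly `k` complex preimages. -/
def HasParamDegree {d : ℕ} (A B : Fin d → ℝ[X]) (k : ℕ) : Prop :=
  (pluckerImage ℂ A B).Infinite ∧
    {y ∈ pluckerImage ℂ A B | {τ | PluckerMapsTo ℂ A B τ y}.encard ≠ k}.Finite

/-- The complex points of the Zariski closure of a set `X` of real projective points: the common
complex zeros of all real forms that vanish on `X`. -/
def complexClosure {ι : Type} (X : Set (ℙ ℝ (ι → ℝ))) : Set (ℙ ℂ (ι → ℂ)) :=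
  {y | ∀ (f : MvPolynomial ι ℝ) (n : ℕ), f.IsHomogeneous n →
    (∀ x ∈ X, MvPolynomial.eval x.rep f = 0) → MvPolynomial.aeval y.rep f = 0}

/-- (The Zariski closure of) `X` has dimension `r` and degree `D`: a generic linear subspace of
codimension `r` meets it in exactly `D` complex points, and `D` is a positive integer. The subspace
is cut out by `r` linear forms, and generic means that their coefficients avoid the zeros of some
nonzero polynomial. Positivity and finiteness of `D` make `r` the dimension. -/
def HasDimDegree {ι : Type} [Fintype ι] (X : Set (ℙ ℝ (ι → ℝ))) (r D : ℕ) : Prop :=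
  0 < D ∧ ∃ G : MvPolynomial (Fin r × ι) ℂ, G ≠ 0 ∧
    ∀ c : Fin r → ι → ℂ, MvPolynomial.eval (fun p => c p.1 p.2) G ≠ 0 →
      {y ∈ complexClosure X | ∀ j, c j ⬝ᵥ y.rep = 0}.encard = D

/-- `X` lies in a hyperplane. -/
def InHyperplane {ι : Type} [Fintype ι] (X : Set (ℙ ℝ (ι → ℝ))) : Prop :=
  ∃ a : ι → ℝ, a ≠ 0 ∧ ∀ x ∈ X, a ⬝ᵥ x.rep = 0

/-! ### Resultants, common roots, and openness -/

/-! Among all pairs of independent elements of `M`, choose `u`, `v` whose degrees have the smallest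
sum `m + n`. Their minors have no common zero, real, complex or at infinity
(`IsMinimalPair.exists_bezout`, `IsMinimalPair.wedge_top_ne`), and `A ∧ B = g (u ∧ v)` with `g`
associated to the gcd `q` (`IsQuasiGenerators.exists_isReducedBasis`). So `deg (A ∧ B) - deg q = m +
n`, and both degrees have to be shown to equal `(m + n) / k`.

Over `ℂ`, the minors of `u`, `v` define a base point free map of degree `m + n` on the line. By
Bertini, a general hyperplane pulls back to a polynomial with `m + n` simple roots that avoid any
given finite set of parameters (`exists_isSimpleAway_dotPoly`). General fibres have `k` elements
(`IsRationalCurve.exists_card_fiber`), so these roots give `(m + n) / k` points of the curve. The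
closure adds no other points, because a resultant separates every point off the curve from it
(`IsRationalCurve.exists_form`).

For the hypersurface, the line through `x` and `y` meets the space `L(t)` orthogonal to `u(t)`,
`v(t)` when the determinant `meetPoly` vanishes. This is a hyperplane section of the Plücker curve,
so a general line again gives `m + n` simple roots. Sending a root to the intersection point is `k`
to one as soon as a general point of the hypersurface lies in only one space `L(t)`. For `d = 3`
this is automatic. Otherwise regard the spans of `u(t)`, `v(t)` as lines in the dual projective
space. If two of them are disjoint, a dimension count inside one `L(t)` gives a point that lies in
no other space. If any two meet, either all pass through a common point, which puts the hypersurface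
into a hyperplane, or all spaces contain a fixed codimension one subspace of `L(t)`, and any point
of `L(t)` outside it will do (`IsRuling.exists_point`).

One such point suffices: a bound on the number of common roots is an open condition
(`Polynomial.exists_open_card_common_roots_le`), the hypersurface is irreducible
(`IsRuling.isPrime_rulingIdeal`), and a general line misses the bad locus, which has codimension two
(`exists_line_through_avoiding`). -/

theorem Polynomial.eq_zero_of_forall_fin_coeff {K : Type*} [Semiring K] {p : K[X]} {n : ℕ}
    (hp : p.natDegree < n) (h : ∀ i : Fin n, p.coeff i = 0) : p = 0 := by
  ext i
  by_cases hi : i < n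
  · simpa using h ⟨i, hi⟩
  · simpa using Polynomial.coeff_eq_zero_of_natDegree_lt (by omega)

theorem Polynomial.exists_common_root_of_not_isCoprime {K : Type*} [Field K] [IsAlgClosed K]
    {f g : K[X]} (h : ¬ IsCoprime f g) : ∃ t, f.eval t = 0 ∧ g.eval t = 0 := by
  rw [Polynomial.isCoprime_iff_aeval_ne_zero_of_isAlgClosed K K] at h
  push Not at h
  simpa using h

/-- The resultant in formal degrees `m`, `n` vanishes iff there is a common zero, possibly at
infinity. -/
theorem Polynomial.resultant_eq_zero_iff_common_root {K : Type*} [Field K] [IsAlgClosed K]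
    {f g : K[X]} {m n : ℕ} (hf : f.natDegree ≤ m) (hg : g.natDegree ≤ n) (h : m ≠ 0 ∨ n ≠ 0) :
    Polynomial.resultant f g m n = 0 ↔
      (f.coeff m = 0 ∧ g.coeff n = 0) ∨ ∃ t, f.eval t = 0 ∧ g.eval t = 0 := by
  have key : ∀ {f g : K[X]} {m n : ℕ}, f.natDegree ≤ m → g.natDegree ≤ n → f.coeff m ≠ 0 →
      Polynomial.resultant f g m n = 0 → ∃ t, f.eval t = 0 ∧ g.eval t = 0 := by
    intro f g m n hf hg hm h0
    have hm' : m = f.natDegree := le_antisymm (Polynomial.le_natDegree_of_ne_zero hm) hf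
    -- Lowering the formal degree of `g` to its true degree only removes a power of `f.coeff m` from
    -- the resultant, and this coefficient is nonzero.
    obtain ⟨k, rfl⟩ := Nat.exists_eq_add_of_le hg
    rw [Polynomial.resultant_add_right_deg _ _ _ _ _ le_rfl] at h0
    have h1 := (mul_eq_zero.1 h0).resolve_left (pow_ne_zero _ hm)
    rw [hm'] at h1
    exact Polynomial.exists_common_root_of_not_isCoprime (Polynomial.resultant_eq_zero_iff.1 h1).2
  constructor
  · intro h0
    by_cases hm : f.coeff m = 0
    · by_cases hn : g.coeff n = 0
      · exact Or.inl ⟨hm, hn⟩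
      · rw [Polynomial.resultant_comm] at h0
        have h1 := (mul_eq_zero.1 h0).resolve_left (pow_ne_zero _ (by simp))
        obtain ⟨t, h2, h3⟩ := key hg hf hn h1
        exact Or.inr ⟨t, h3, h2⟩
    · exact Or.inr (key hf hg hm h0)
  · rintro (⟨h1, h2⟩ | ⟨t, h1, h2⟩)
    · rcases Nat.eq_zero_or_pos m with rfl | hm
      · rw [Polynomial.resultant_zero_left_deg, h1, zero_pow (by simpa using h)]
      rcases Nat.eq_zero_or_pos n with rfl | hn
      · rw [Polynomial.resultant_zero_right_deg, h2, zero_pow (by simpa using h)]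
      -- The zero polynomial has `natDegree` `0`, so a vanishing top coefficient lowers the degree
      -- strictly only in positive formal degree; hence the separate cases above.
      have aux : ∀ {f : K[X]} {m : ℕ}, f.natDegree ≤ m → 0 < m → f.coeff m = 0 →
          f.natDegree < m := by
        intro f m hf hm h1
        refine lt_of_le_of_ne hf fun he => ?_
        rw [← he, Polynomial.coeff_natDegree, Polynomial.leadingCoeff_eq_zero] at h1
        simp [h1] at he
        omega
      exact Polynomial.resultant_eq_zero_of_lt_lt _ _ _ _ (aux hf hm h1) (aux hg hn h2)
    · obtain ⟨p, q, -, -, hpq⟩ := Polynomial.exists_mul_add_mul_eq_C_resultant f g hf hg h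
      have := congrArg (Polynomial.eval t) hpq
      simpa [h1, h2] using this.symm

theorem MvPolynomial.isHomogeneous_det {σ R n : Type*} [CommRing R] [Fintype n] [DecidableEq n]
    {M : Matrix n n (MvPolynomial σ R)} (h : ∀ i j, (M i j).IsHomogeneous 1) :
    M.det.IsHomogeneous (Fintype.card n) := by
  rw [Matrix.det_apply]
  refine MvPolynomial.IsHomogeneous.sum _ _ _ fun s _ => ?_
  have h1 : (∏ i, M (s i) i).IsHomogeneous (Fintype.card n) := by
    have := MvPolynomial.IsHomogeneous.prod Finset.univ (fun i => M (s i) i) (fun _ => 1)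
      fun i _ => h _ _
    simpa using this
  rcases Int.units_eq_one_or (Equiv.Perm.sign s) with h2 | h2 <;> rw [h2]
  · simpa using h1
  · simpa using h1.neg

theorem MvPolynomial.isHomogeneous_resultant {σ R : Type*} [CommRing R]
    {f g : (MvPolynomial σ R)[X]} (hf : ∀ i, (f.coeff i).IsHomogeneous 1)
    (hg : ∀ i, (g.coeff i).IsHomogeneous 1) (m n : ℕ) :
    (Polynomial.resultant f g m n).IsHomogeneous (m + n) := by
  have := MvPolynomial.isHomogeneous_det (M := Polynomial.sylvester f g m n) (fun i j => by
    induction j using Fin.addCases <;> simp only [Polynomial.sylvester, Matrix.of_apply,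
      Fin.addCases_left, Fin.addCases_right] <;> split_ifs <;>
      first | exact hf _ | exact hg _ | exact MvPolynomial.isHomogeneous_zero _ _ _)
  rwa [Fintype.card_fin] at this

/-- Injectivity of a matrix is an open condition on a family of complex points. -/
theorem Matrix.exists_open_mulVec_injective {R α β : Type*} [CommRing R] [Algebra ℂ R]
    [Fintype α] [Fintype β] [DecidableEq β] (N : Matrix α β R) (ρ₀ : R →ₐ[ℂ] ℂ)
    (h : Function.Injective (N.map ρ₀).mulVec) :
    ∃ δ : R, ρ₀ δ ≠ 0 ∧ ∀ ρ : R →ₐ[ℂ] ℂ, ρ δ ≠ 0 → Function.Injective (N.map ρ).mulVec := by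
  classical
  obtain ⟨l, hl⟩ := LinearMap.exists_leftInverse_of_injective (N.map ρ₀).mulVecLin
    (LinearMap.ker_eq_bot.2 h)
  let A : Matrix β α ℂ := LinearMap.toMatrix' l
  have hA : A * N.map ρ₀ = 1 := by
    have := congrArg LinearMap.toMatrix' hl
    rwa [LinearMap.toMatrix'_comp, ← Matrix.toLin'_apply', LinearMap.toMatrix'_toLin',
      LinearMap.toMatrix'_id] at this
  have hdet : ∀ ρ : R →ₐ[ℂ] ℂ,
      ρ (A.map (algebraMap ℂ R) * N).det = (A * N.map ρ).det := by
    intro ρ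
    have h1 : ρ (A.map (algebraMap ℂ R) * N).det = _ := RingHom.map_det ρ.toRingHom _
    rw [h1]
    congr 1
    ext i j
    simp [Matrix.mul_apply]
  -- `A` is a constant left inverse at `ρ₀`, so this determinant has the value `1` there.
  refine ⟨(A.map (algebraMap ℂ R) * N).det, ?_, fun ρ hρ => ?_⟩
  · rw [hdet, hA]; simp
  · rw [hdet] at hρ
    have h2 : Function.Injective (A * N.map ρ).mulVec :=
      Matrix.mulVec_injective_of_isUnit ((Matrix.isUnit_iff_isUnit_det _).2 hρ.isUnit)
    intro v w hvw
    apply h2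
    rw [← Matrix.mulVec_mulVec, ← Matrix.mulVec_mulVec, hvw]

/-- A polynomial with only simple roots has as many roots as its degree. -/
theorem Polynomial.card_roots_toFinset_of_simple {p : ℂ[X]} (hp : p ≠ 0)
    (h : ∀ t, p.eval t = 0 → p.derivative.eval t ≠ 0) : p.roots.toFinset.card = p.natDegree := by
  rw [Multiset.toFinset_card_of_nodup, IsAlgClosed.card_roots_eq_natDegree]
  rw [Multiset.nodup_iff_count_le_one]
  intro t
  rw [Polynomial.count_roots]
  by_contra! h1
  obtain ⟨h2, h3⟩ := (Polynomial.one_lt_rootMultiplicity_iff_isRoot hp).1 h1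
  exact h t h2 h3

/-- Having at most `k` common roots, all simple, is an open condition. -/
theorem Polynomial.exists_open_card_common_roots_le {R : Type*} [CommRing R] [Algebra ℂ R]
    (f g : R[X]) (m n : ℕ) (hf : f.natDegree ≤ m) (hg : g.natDegree ≤ n) (ρ₀ : R →ₐ[ℂ] ℂ)
    (hn : ρ₀ (g.coeff n) ≠ 0) (S : Finset ℂ)
    (hS : ∀ t, (f.map ρ₀.toRingHom).eval t = 0 → (g.map ρ₀.toRingHom).eval t = 0 → t ∈ S ∧
      ((f.map ρ₀.toRingHom).derivative.eval t ≠ 0 ∨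
        (g.map ρ₀.toRingHom).derivative.eval t ≠ 0)) :
    ∃ δ : R, ρ₀ δ ≠ 0 ∧ ∀ ρ : R →ₐ[ℂ] ℂ, ρ δ ≠ 0 → ∀ T : Finset ℂ,
      (∀ t ∈ T, (f.map ρ.toRingHom).eval t = 0 ∧ (g.map ρ.toRingHom).eval t = 0) →
      T.card ≤ S.card := by
  set k := S.card with hk
  -- A truncated Sylvester matrix. Its kernel consists of the pairs `(a, b)` with `deg a < n - k`,
  -- `deg b < m - k` and `a f + b g = 0`; for `g` of exact degree `n` it is trivial when the gcd has
  -- degree at most `k`.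
  let N : Matrix (Fin (m + n + 1)) (Fin (n - k) ⊕ Fin (m - k)) R := fun i j =>
    j.elim (fun j => (Polynomial.X ^ (j : ℕ) * f).coeff i)
      (fun j => (Polynomial.X ^ (j : ℕ) * g).coeff i)
  let P : ∀ {r : ℕ}, (Fin r → ℂ) → ℂ[X] := fun a => ∑ j, Polynomial.C (a j) * Polynomial.X ^ (j : ℕ)
  have hP : ∀ {r : ℕ} (a : Fin r → ℂ) (j : Fin r), (P a).coeff j = a j := by
    intro r a j
    simp only [P, Polynomial.finsetSum_coeff, Polynomial.coeff_C_mul_X_pow]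
    rw [Finset.sum_eq_single j] <;> simp +contextual [Fin.ext_iff, eq_comm]
  have hPdeg : ∀ {r : ℕ} (a : Fin r → ℂ), (P a).degree < r := by
    intro r a
    refine Polynomial.mem_degreeLT.1 (Submodule.sum_mem _ fun j _ => Polynomial.mem_degreeLT.2 ?_)
    refine (Polynomial.degree_C_mul_X_pow_le _ _).trans_lt ?_
    exact_mod_cast j.2
  have hP0 : ∀ {r : ℕ} (a : Fin r → ℂ), P a = 0 → a = 0 := by
    intro r a h
    ext j
    rw [← hP a j, h]; simp
  have hPsurj : ∀ {r : ℕ} (p : ℂ[X]), p.degree < r → P (fun j : Fin r => p.coeff j) = p := by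
    intro r p hp
    ext i
    by_cases hi : i < r
    · exact hP _ ⟨i, hi⟩
    · have h1 : (r : WithBot ℕ) ≤ i := by exact_mod_cast not_lt.1 hi
      rw [Polynomial.coeff_eq_zero_of_degree_lt ((hPdeg _).trans_le h1),
        Polynomial.coeff_eq_zero_of_degree_lt (hp.trans_le h1)]
  have hN : ∀ (ρ : R →ₐ[ℂ] ℂ) (v : Fin (n - k) ⊕ Fin (m - k) → ℂ) (i : Fin (m + n + 1)),
      (N.map ρ).mulVec v i = (P (v ∘ Sum.inl) * f.map ρ.toRingHom
        + P (v ∘ Sum.inr) * g.map ρ.toRingHom).coeff i := by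
    intro ρ v i
    have h1 : ∀ (h : R[X]) (j : ℕ), ρ ((Polynomial.X ^ j * h).coeff i) =
        (Polynomial.X ^ j * h.map ρ.toRingHom).coeff i := by
      intro h j
      have : (Polynomial.X ^ j * h.map ρ.toRingHom) = (Polynomial.X ^ j * h).map ρ.toRingHom := by
        simp
      rw [this, Polynomial.coeff_map]; rfl
    have h2 : ∀ j, N.map ρ i (Sum.inl j) = (Polynomial.X ^ (j : ℕ) * f.map ρ.toRingHom).coeff i :=
      fun j => h1 f j
    have h3 : ∀ j, N.map ρ i (Sum.inr j) = (Polynomial.X ^ (j : ℕ) * g.map ρ.toRingHom).coeff i :=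
      fun j => h1 g j
    simp only [Matrix.mulVec, dotProduct, Fintype.sum_sum_type, h2, h3, P, Finset.sum_mul, Polynomial.coeff_add, Polynomial.finsetSum_coeff,
      mul_assoc, Polynomial.coeff_C_mul, Function.comp]
    congr 1 <;> exact Finset.sum_congr rfl fun j _ => mul_comm _ _
  have hker : ∀ (ρ : R →ₐ[ℂ] ℂ) (v : Fin (n - k) ⊕ Fin (m - k) → ℂ),
      (N.map ρ).mulVec v = 0 ↔ P (v ∘ Sum.inl) * f.map ρ.toRingHom
        + P (v ∘ Sum.inr) * g.map ρ.toRingHom = 0 := by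
    intro ρ v
    constructor
    · intro h
      refine Polynomial.eq_zero_of_forall_fin_coeff (n := m + n + 1) ?_ fun i => ?_
      · have hfρ : (f.map ρ.toRingHom).natDegree ≤ m := Polynomial.natDegree_map_le.trans hf
        have hgρ : (g.map ρ.toRingHom).natDegree ≤ n := Polynomial.natDegree_map_le.trans hg
        have hb : ∀ {r s : ℕ} (a : Fin (r - k) → ℂ) (h : ℂ[X]), h.natDegree ≤ s →
            (P a * h).natDegree ≤ r + s := by
          intro r s a h hh
          refine Polynomial.natDegree_mul_le.trans (Nat.add_le_add ?_ hh)
          refine Polynomial.natDegree_le_of_degree_le ((hPdeg a).le.trans ?_)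
          exact_mod_cast Nat.sub_le _ _
        have h1 := hb (v ∘ Sum.inl) _ hfρ
        have h2 := hb (v ∘ Sum.inr) _ hgρ
        have := Polynomial.natDegree_add_le_of_degree_le (n := m + n)
          (h1.trans (by omega)) h2
        omega
      · rw [← hN, h]; rfl
    · intro h
      ext i
      rw [hN, h]; simp
  have hinj : Function.Injective (N.map ρ₀).mulVec := by
    rw [← Matrix.coe_mulVecLin, ← LinearMap.ker_eq_bot, LinearMap.ker_eq_bot']
    intro v hv
    rw [Matrix.mulVecLin_apply, hker] at hv
    set f₀ := f.map ρ₀.toRingHom with hf₀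
    set g₀ := g.map ρ₀.toRingHom with hg₀
    have hgn : g₀.coeff n ≠ 0 := by rw [hg₀, Polynomial.coeff_map]; exact hn
    have hg0 : g₀ ≠ 0 := by rintro h; simp [h] at hgn
    have hdeg : g₀.natDegree = n := le_antisymm (Polynomial.natDegree_map_le.trans hg)
      (Polynomial.le_natDegree_of_ne_zero hgn)
    obtain ⟨f₁, hf₁⟩ := EuclideanDomain.gcd_dvd_left f₀ g₀
    obtain ⟨g₁, hg₁⟩ := EuclideanDomain.gcd_dvd_right f₀ g₀
    set h := EuclideanDomain.gcd f₀ g₀ with hh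
    have hh0 : h ≠ 0 := by
      rintro h0; rw [h0, zero_mul] at hg₁; exact hg0 hg₁
    have hg₁0 : g₁ ≠ 0 := by rintro h0; rw [h0, mul_zero] at hg₁; exact hg0 hg₁
    have hcop : IsCoprime f₁ g₁ := by
      obtain ⟨a, b, hab⟩ : ∃ a b, h = f₀ * a + g₀ * b :=
        ⟨_, _, EuclideanDomain.gcd_eq_gcd_ab f₀ g₀⟩
      refine ⟨a, b, mul_left_cancel₀ hh0 ?_⟩
      calc h * (a * f₁ + b * g₁) = (h * f₁) * a + (h * g₁) * b := by ring
        _ = h * 1 := by rw [← hf₁, ← hg₁, ← hab, mul_one]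
    have hroot : ∀ t, h.eval t = 0 → f₀.eval t = 0 ∧ g₀.eval t = 0 := by
      intro t ht
      exact ⟨by rw [hf₁]; simp [ht], by rw [hg₁]; simp [ht]⟩
    -- A double root of the gcd would be a double root of both polynomials. So the gcd has simple
    -- roots, and its degree counts points of `S`.
    have hhdeg : h.natDegree ≤ k := by
      rw [← Polynomial.card_roots_toFinset_of_simple hh0]
      · refine Finset.card_le_card fun t ht => ?_
        simp only [Multiset.mem_toFinset, Polynomial.mem_roots hh0] at ht
        obtain ⟨h1, h2⟩ := hroot t ht
        exact (hS t h1 h2).1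
      · intro t ht hd
        obtain ⟨h1, h2⟩ := hroot t ht
        rcases (hS t h1 h2).2 with h3 | h3
        · exact h3 (by rw [hf₁]; simp [Polynomial.derivative_mul, ht, hd])
        · exact h3 (by rw [hg₁]; simp [Polynomial.derivative_mul, ht, hd])
    have hrel : P (v ∘ Sum.inl) * f₁ + P (v ∘ Sum.inr) * g₁ = 0 := by
      apply mul_left_cancel₀ hh0
      rw [mul_zero, ← hv]
      conv_rhs => rw [hf₁, hg₁]
      ring
    -- The cofactors are coprime, so `g₁` divides a polynomial of degree less than `n - k`, while
    -- `deg g₁ = n - deg h ≥ n - k`.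
    have hdvd : g₁ ∣ P (v ∘ Sum.inl) := by
      refine hcop.symm.dvd_of_dvd_mul_right ⟨-P (v ∘ Sum.inr), ?_⟩
      linear_combination hrel
    have hd1 : g₁.natDegree + h.natDegree = n := by
      rw [← hdeg, hg₁, Polynomial.natDegree_mul hh0 hg₁0, add_comm]
    have ha : P (v ∘ Sum.inl) = 0 := by
      refine Polynomial.eq_zero_of_dvd_of_degree_lt hdvd ((hPdeg _).trans_le ?_)
      rw [Polynomial.degree_eq_natDegree hg₁0]
      exact_mod_cast (by omega)
    have hb : P (v ∘ Sum.inr) = 0 := by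
      rw [ha, zero_mul, zero_add] at hrel
      exact (mul_eq_zero.1 hrel).resolve_right hg₁0
    have h1 := hP0 _ ha
    have h2 := hP0 _ hb
    ext (j | j)
    · exact congrFun h1 j
    · exact congrFun h2 j
  obtain ⟨δ, hδ₀, hδ⟩ := Matrix.exists_open_mulVec_injective N ρ₀ hinj
  -- The second factor keeps `g` nonzero after specialization, which makes the kernel vector built
  -- below nonzero.
  refine ⟨δ * g.coeff n, ?_, fun ρ hρ T hT => ?_⟩
  · rw [map_mul]; exact mul_ne_zero hδ₀ hn
  rw [map_mul] at hρ
  by_contra! hcard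
  have hgn : (g.map ρ.toRingHom).coeff n ≠ 0 := by
    rw [Polynomial.coeff_map]; exact right_ne_zero_of_mul hρ
  set f₁ := f.map ρ.toRingHom with hf₁
  set g₁ := g.map ρ.toRingHom with hg₁
  have hg0 : g₁ ≠ 0 := by rintro h; simp [h] at hgn
  let h : ℂ[X] := ∏ t ∈ T, (Polynomial.X - Polynomial.C t)
  have hhdeg : h.natDegree = T.card := by
    rw [Polynomial.natDegree_prod_of_monic _ _ fun t _ => Polynomial.monic_X_sub_C t]
    simp
  have hmonic : h.Monic := Polynomial.monic_prod_of_monic _ _ fun t _ => Polynomial.monic_X_sub_C t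
  have hdvd : ∀ p : ℂ[X], (∀ t ∈ T, p.eval t = 0) → h ∣ p := by
    intro p hp
    refine Finset.prod_dvd_of_coprime ?_ fun t ht => Polynomial.dvd_iff_isRoot.2 (hp t ht)
    intro s _ t _ hst
    exact Polynomial.isCoprime_X_sub_C_of_isUnit_sub (sub_ne_zero.2 hst).isUnit
  obtain ⟨a, ha⟩ := hdvd f₁ fun t ht => (hT t ht).1
  obtain ⟨b, hb⟩ := hdvd g₁ fun t ht => (hT t ht).2
  have hdegq : ∀ {p q : ℂ[X]} {r : ℕ}, p = h * q → p.natDegree ≤ r → q.degree < (r - k : ℕ) := by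
    intro p q r hpq hp
    rcases eq_or_ne q 0 with rfl | hq
    · rw [Polynomial.degree_zero]; exact WithBot.bot_lt_coe _
    rw [Polynomial.degree_eq_natDegree hq]
    have : p.natDegree = T.card + q.natDegree := by
      rw [hpq, hmonic.natDegree_mul' hq, hhdeg]
    exact_mod_cast (by omega)
  have hadeg := hdegq ha (Polynomial.natDegree_map_le.trans hf)
  have hbdeg := hdegq hb (Polynomial.natDegree_map_le.trans hg)
  have hb0 : b ≠ 0 := by rintro rfl; rw [mul_zero] at hb; exact hg0 hb
  -- With more than `k` common roots, `f = h a` and `g = h b`, and `(b, -a)` is short enough to be a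
  -- kernel vector.
  have hz := hδ ρ (left_ne_zero_of_mul hρ)
    (a₁ := Sum.elim (fun j => b.coeff j) (fun j => (-a).coeff j)) (a₂ := 0) (by
      rw [Matrix.mulVec_zero, hker, Sum.elim_comp_inl, Sum.elim_comp_inr, hPsurj _ hbdeg,
        hPsurj _ (by rwa [Polynomial.degree_neg]), ← hf₁, ← hg₁]
      conv_lhs => rw [ha, hb]
      ring)
  apply hb0
  rw [← hPsurj _ hbdeg]
  have : (fun j : Fin (n - k) => b.coeff j) = 0 := by
    ext j
    exact congrFun hz (Sum.inl j)
  rw [this]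
  simp [P]

/-! ### Polynomials with simple roots, and linear systems on the line -/

/-- `p` has degree `e`, and its roots are simple and lie outside `T`. -/
structure IsSimpleAway (p : ℂ[X]) (e : ℕ) (T : Set ℂ) : Prop where
  natDegree_le : p.natDegree ≤ e
  coeff_ne : p.coeff e ≠ 0
  derivative_ne : ∀ t, p.eval t = 0 → p.derivative.eval t ≠ 0
  notMem : ∀ t, p.eval t = 0 → t ∉ T

theorem Polynomial.finite_setOf_eval_eq_zero {K : Type*} [Field K] {p : K[X]} (hp : p ≠ 0) :
    {t | p.eval t = 0}.Finite := by
  classical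
  refine p.roots.toFinset.finite_toSet.subset fun t ht => ?_
  simpa [hp] using ht

namespace IsSimpleAway

variable {p : ℂ[X]} {e : ℕ} {T : Set ℂ}

theorem ne_zero (h : IsSimpleAway p e T) : p ≠ 0 := by
  rintro rfl; exact h.coeff_ne (by simp)

theorem natDegree_eq (h : IsSimpleAway p e T) : p.natDegree = e :=
  le_antisymm h.natDegree_le (Polynomial.le_natDegree_of_ne_zero h.coeff_ne)

/-- If all fibres of `Ψ` on the roots have `k` elements, the roots have `e / k` images. -/
theorem mul_card_image {Y : Type*} (h : IsSimpleAway p e T) (Ψ : ℂ → Y) (k : ℕ)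
    (hk : ∀ t, p.eval t = 0 → {s | p.eval s = 0 ∧ Ψ s = Ψ t}.ncard = k) :
    ∃ D : ℕ, k * D = e ∧ (Ψ '' {t | p.eval t = 0}).encard = D := by
  classical
  refine ⟨(p.roots.toFinset.image Ψ).card, ?_, ?_⟩
  · have h1 := Finset.card_eq_sum_card_image Ψ p.roots.toFinset
    rw [Polynomial.card_roots_toFinset_of_simple h.ne_zero h.derivative_ne, h.natDegree_eq] at h1
    rw [h1, mul_comm]
    refine (Finset.sum_const_nat fun y hy => ?_).symm
    obtain ⟨t, ht, rfl⟩ := Finset.mem_image.1 hy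
    rw [← hk t (by simpa [h.ne_zero] using ht), ← Set.ncard_coe_finset]
    congr 1
    ext s
    simp [h.ne_zero]
  · rw [← Set.encard_coe_eq_coe_finsetCard]
    congr 1
    ext y
    simp [h.ne_zero]

/-- Having degree `e` and simple roots outside a finite set is an open condition. -/
theorem exists_open {R : Type*} [CommRing R] [Algebra ℂ R] (f : R[X]) (hf : f.natDegree ≤ e)
    (hT : T.Finite) (ρ₀ : R →ₐ[ℂ] ℂ) (h : IsSimpleAway (f.map ρ₀.toRingHom) e T) :
    ∃ δ : R, ρ₀ δ ≠ 0 ∧ ∀ ρ : R →ₐ[ℂ] ℂ, ρ δ ≠ 0 → IsSimpleAway (f.map ρ.toRingHom) e T := by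
  have hdeg : ∀ ρ : R →ₐ[ℂ] ℂ, (f.map ρ.toRingHom).natDegree ≤ e :=
    fun ρ => Polynomial.natDegree_map_le.trans hf
  -- The generous formal degree `e + 1` of the derivative keeps the formal degrees from both being
  -- zero when `e = 0`.
  have hdeg' : ∀ ρ : R →ₐ[ℂ] ℂ, (f.map ρ.toRingHom).derivative.natDegree ≤ e + 1 := fun ρ =>
    (Polynomial.natDegree_derivative_le _).trans (by have := hdeg ρ; omega)
  have hcoe : ∀ (ρ : R →ₐ[ℂ] ℂ) (i : ℕ), (f.map ρ.toRingHom).coeff i = ρ (f.coeff i) :=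
    fun ρ i => by rw [Polynomial.coeff_map]; rfl
  have hres : ∀ ρ : R →ₐ[ℂ] ℂ, ρ (Polynomial.resultant f f.derivative e (e + 1)) =
      Polynomial.resultant (f.map ρ.toRingHom) (f.map ρ.toRingHom).derivative e (e + 1) := by
    intro ρ
    rw [Polynomial.derivative_map, Polynomial.resultant_map_map]; rfl
  have hev : ∀ (ρ : R →ₐ[ℂ] ℂ) (t : ℂ), ρ (f.eval (algebraMap ℂ R t)) =
      (f.map ρ.toRingHom).eval t := by
    intro ρ t
    have : t = ρ.toRingHom (algebraMap ℂ R t) := by simp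
    conv_rhs => rw [this]
    rw [Polynomial.eval_map_apply]; rfl
  refine ⟨f.coeff e * Polynomial.resultant f f.derivative e (e + 1) *
    ∏ t ∈ hT.toFinset, f.eval (algebraMap ℂ R t), ?_, fun ρ hρ => ?_⟩
  · rw [map_mul, map_mul, map_prod, hres, ← hcoe]
    refine mul_ne_zero (mul_ne_zero h.coeff_ne ?_) (Finset.prod_ne_zero_iff.2 fun t ht => ?_)
    · rw [Ne, Polynomial.resultant_eq_zero_iff_common_root (hdeg _) (hdeg' _) (by simp)]
      rintro (h1 | ⟨t, h1, h2⟩)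
      · exact h.coeff_ne h1.1
      · exact h.derivative_ne t h1 h2
    · rw [hev]
      exact fun h1 => h.notMem t h1 (by simpa using ht)
  · rw [map_mul, map_mul, map_prod, hres, ← hcoe] at hρ
    have h1 := left_ne_zero_of_mul (left_ne_zero_of_mul hρ)
    have h2 := right_ne_zero_of_mul (left_ne_zero_of_mul hρ)
    have h3 := Finset.prod_ne_zero_iff.1 (right_ne_zero_of_mul hρ)
    rw [Ne, Polynomial.resultant_eq_zero_iff_common_root (hdeg _) (hdeg' _) (by simp)] at h2
    refine ⟨hdeg ρ, h1, fun t ht hd => h2 (Or.inr ⟨t, ht, hd⟩), fun t ht hT' => ?_⟩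
    exact h3 t (by simpa using hT') (by rw [hev, ht])

end IsSimpleAway

/-- The polynomial `c · v`. -/
noncomputable def dotPoly {K ι : Type*} [Field K] [Fintype ι] (v : ι → K[X]) (c : ι → K) : K[X] :=
  ∑ i, Polynomial.C (c i) * v i

/-- The value at `t` of a polynomial vector. -/
def evalVec {K ι : Type*} [Field K] (v : ι → K[X]) (t : K) : ι → K := fun i => (v i).eval t

/-- The vector of coefficients of degree `e` of a polynomial vector. -/
def coeffVec {K ι : Type*} [Field K] (v : ι → K[X]) (e : ℕ) : ι → K := fun i => (v i).coeff e

/-- The derivative of a polynomial vector. -/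
noncomputable def derivVec {K ι : Type*} [Field K] (v : ι → K[X]) : ι → K[X] :=
  fun i => (v i).derivative

section dotPoly

variable {K ι : Type*} [Field K] [Fintype ι] (v : ι → K[X]) (c c' : ι → K)

theorem eval_dotPoly (t : K) : (dotPoly v c).eval t = c ⬝ᵥ evalVec v t := by
  simp [dotPoly, Polynomial.eval_finsetSum, dotProduct, evalVec]

theorem coeff_dotPoly (e : ℕ) : (dotPoly v c).coeff e = c ⬝ᵥ coeffVec v e := by
  simp [dotPoly, dotProduct, coeffVec]

theorem derivative_dotPoly : (dotPoly v c).derivative = dotPoly (derivVec v) c := by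
  simp [dotPoly, derivVec]

theorem natDegree_dotPoly_le {e : ℕ} (hv : ∀ i, (v i).natDegree ≤ e) :
    (dotPoly v c).natDegree ≤ e :=
  Polynomial.natDegree_sum_le_of_forall_le _ _ fun i _ =>
    (Polynomial.natDegree_C_mul_le _ _).trans (hv i)

theorem dotPoly_add_smul (x : K) :
    dotPoly v (c + x • c') = dotPoly v c + Polynomial.C x * dotPoly v c' := by
  simp [dotPoly, Finset.mul_sum, ← Finset.sum_add_distrib, add_mul, mul_assoc]

/-- A vector space over an infinite field is not a finite union of proper subspaces. Many of the
general choices of vectors below rest on this. -/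
theorem exists_dotProduct_ne_zero [Infinite K] (p : Submodule K (ι → K)) {W : Set (ι → K)}
    (hW : W.Finite) (h : ∀ w ∈ W, ∃ c ∈ p, c ⬝ᵥ w ≠ 0) : ∃ c ∈ p, ∀ w ∈ W, c ⬝ᵥ w ≠ 0 := by
  have := hW.to_subtype
  obtain ⟨c, hc, h1⟩ := Module.Dual.exists_forall_mem_ne_zero_of_forall_exists p
    (fun w : W => dotProductBilin K K |>.flip w.1) fun w => h w.1 w.2
  exact ⟨c, hc, fun w hw => h1 ⟨w, hw⟩⟩

end dotPoly

theorem exists_single_dotProduct_ne_zero {K ι : Type*} [Field K] [Fintype ι] {w : ι → K}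
    (h : w ≠ 0) : ∃ c : ι → K, c ⬝ᵥ w ≠ 0 := by
  classical
  obtain ⟨i, hi⟩ := Function.ne_iff.1 h
  exact ⟨Pi.single i 1, by simpa using hi⟩

/-- Bertini's theorem for a base point free linear system on the projective line. -/
theorem exists_isSimpleAway_dotPoly {ι : Type*} [Fintype ι] (v : ι → ℂ[X]) (e : ℕ)
    (hv : ∀ i, (v i).natDegree ≤ e) (htop : coeffVec v e ≠ 0) (hne : ∀ t, evalVec v t ≠ 0)
    {T : Set ℂ} (hT : T.Finite) : ∃ c : ι → ℂ, IsSimpleAway (dotPoly v c) e T := by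
  obtain ⟨c₀, hc₀⟩ := exists_single_dotProduct_ne_zero htop
  rw [← coeff_dotPoly] at hc₀
  set u := dotPoly v c₀ with hu
  have hu0 : u ≠ 0 := by rintro h; rw [h] at hc₀; simp at hc₀
  have hudeg : u.natDegree = e :=
    le_antisymm (natDegree_dotPoly_le v c₀ hv) (Polynomial.le_natDegree_of_ne_zero hc₀)
  -- A nonzero constant has no roots. The Wronskian argument below needs a nonconstant `u`.
  rcases Nat.eq_zero_or_pos e with rfl | he
  · have h1 : ∀ t, u.eval t ≠ 0 := by
      intro t
      rw [Polynomial.eq_C_of_natDegree_eq_zero hudeg] at hc₀ ⊢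
      simpa using hc₀
    exact ⟨c₀, hudeg.le, hc₀, fun t ht => absurd ht (h1 t), fun t ht => absurd ht (h1 t)⟩
  obtain ⟨c₁, -, hc₁⟩ := exists_dotProduct_ne_zero ⊤
    (W := evalVec v '' ({t | u.eval t = 0} ∪ T))
    (((Polynomial.finite_setOf_eval_eq_zero hu0).union hT).image _) (by
      rintro _ ⟨t, -, rfl⟩
      obtain ⟨c, hc⟩ := exists_single_dotProduct_ne_zero (hne t)
      exact ⟨c, trivial, hc⟩)
  set w := dotPoly v c₁ with hw
  have hwne : ∀ t, u.eval t = 0 ∨ t ∈ T → w.eval t ≠ 0 := by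
    intro t ht
    rw [hw, eval_dotPoly]
    exact hc₁ _ ⟨t, ht, rfl⟩
  have hcop : IsCoprime u w := by
    by_contra h
    obtain ⟨t, h1, h2⟩ := Polynomial.exists_common_root_of_not_isCoprime h
    exact hwne t (Or.inl h1) h2
  -- In characteristic zero, a coprime pair with vanishing Wronskian consists of constants.
  have hW : Polynomial.wronskian u w ≠ 0 := by
    intro h
    have h1 := (hcop.wronskian_eq_zero_iff.1 h).1
    have := Polynomial.derivative_eq_zero.1 h1
    omega
  -- The bad members `u + x w` of the pencil: the degree drops, a root lies in `T`, or a root is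
  -- multiple. At a multiple root the Wronskian vanishes, and the root determines `x`.
  have hfin : ({x : ℂ | u.coeff e + x * w.coeff e = 0} ∪
      (fun t => -u.eval t / w.eval t) '' (T ∪ {t | (Polynomial.wronskian u w).eval t = 0})).Finite := by
    refine Set.Finite.union ?_ ((hT.union (Polynomial.finite_setOf_eval_eq_zero hW)).image _)
    refine Set.Finite.subset (Set.finite_singleton (-u.coeff e / w.coeff e)) fun x hx => ?_
    have hx : u.coeff e + x * w.coeff e = 0 := hx
    have h1 : w.coeff e ≠ 0 := by rintro h; rw [h, mul_zero, add_zero] at hx; exact hc₀ hx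
    rw [Set.mem_singleton_iff, eq_div_iff h1]
    linear_combination hx
  obtain ⟨x, hx⟩ := hfin.exists_notMem
  have hlin : dotPoly v (c₀ + x • c₁) = u + Polynomial.C x * w := dotPoly_add_smul _ _ _ _
  have hx1 : ∀ t, w.eval t ≠ 0 → u.eval t + x * w.eval t = 0 → x = -u.eval t / w.eval t := by
    intro t h1 h2
    rw [eq_div_iff h1]; linear_combination h2
  refine ⟨c₀ + x • c₁, natDegree_dotPoly_le _ _ hv, ?_, fun t ht hd => ?_, fun t ht hT' => ?_⟩
  · rw [hlin]
    intro h
    exact hx (Or.inl (by simpa using h))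
  · rw [hlin] at ht hd
    simp only [Polynomial.derivative_add, Polynomial.derivative_mul, Polynomial.derivative_C,
      zero_mul, zero_add, Polynomial.eval_add, Polynomial.eval_mul, Polynomial.eval_C] at ht hd
    have h1 : w.eval t ≠ 0 := by
      intro h
      rw [h, mul_zero, add_zero] at ht
      exact hwne t (Or.inl ht) h
    refine hx (Or.inr ⟨t, Or.inr ?_, (hx1 t h1 ht).symm⟩)
    simp only [Polynomial.wronskian, Set.mem_ofPred_eq, Polynomial.eval_sub, Polynomial.eval_mul]
    linear_combination (w.derivative.eval t) * ht - w.eval t * hd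
  · rw [hlin] at ht
    simp only [Polynomial.eval_add, Polynomial.eval_mul, Polynomial.eval_C] at ht
    exact hx (Or.inr ⟨t, Or.inl hT', (hx1 t (hwne t (Or.inr hT')) ht).symm⟩)

/-! ### Parallel vectors -/

/-- Two vectors are parallel. -/
def Par {K ι : Type*} [Mul K] (a b : ι → K) : Prop := ∀ i j, a i * b j = a j * b i

namespace Par

variable {K ι : Type*} [Field K] {a b c : ι → K}

theorem refl (a : ι → K) : Par a a := fun _ _ => mul_comm _ _

theorem symm (h : Par a b) : Par b a := fun i j => by
  rw [mul_comm, ← h, mul_comm]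

theorem exists_smul (h : Par a b) (hb : b ≠ 0) : ∃ x : K, a = x • b := by
  obtain ⟨i, hi⟩ := Function.ne_iff.1 hb
  refine ⟨a i / b i, funext fun j => ?_⟩
  have hi : b i ≠ 0 := hi
  simp only [Pi.smul_apply, smul_eq_mul]
  field_simp
  exact (h i j).symm

theorem of_smul {x : K} (h : a = x • b) : Par a b := fun i j => by
  simp only [h, Pi.smul_apply, smul_eq_mul]; ring

theorem trans (h : Par a b) (h' : Par b c) (hb : b ≠ 0) : Par a c := by
  obtain ⟨x, rfl⟩ := h.exists_smul hb
  intro i j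
  simp only [Pi.smul_apply, smul_eq_mul, mul_assoc, h' i j]

theorem dotProduct_eq_zero [Fintype ι] (h : Par a b) (hb : b ≠ 0) (hc : c ⬝ᵥ b = 0) :
    c ⬝ᵥ a = 0 := by
  obtain ⟨x, rfl⟩ := h.exists_smul hb
  rw [dotProduct_smul, hc, smul_zero]

theorem mk_eq_mk_iff (ha : a ≠ 0) (hb : b ≠ 0) :
    Projectivization.mk K a ha = Projectivization.mk K b hb ↔ Par a b := by
  rw [Projectivization.mk_eq_mk_iff']
  constructor
  · rintro ⟨x, hx⟩; exact Par.of_smul hx.symm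
  · intro h
    obtain ⟨x, hx⟩ := h.exists_smul hb
    exact ⟨x, hx.symm⟩

theorem _root_.exists_separating_of_not_par [Fintype ι] (h : ¬ Par a b) : ∃ c : ι → K, c ⬝ᵥ b = 0 ∧ c ⬝ᵥ a ≠ 0 := by
  classical
  simp only [Par, not_forall] at h
  obtain ⟨i, j, hij⟩ := h
  refine ⟨b j • Pi.single i 1 - b i • Pi.single j 1, ?_, ?_⟩
  · simp [sub_dotProduct, mul_comm]
  · simp only [sub_dotProduct, smul_dotProduct, single_one_dotProduct, smul_eq_mul]
    intro h1
    exact hij (by linear_combination h1)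

end Par

/-- The hyperplane of vectors orthogonal to `y`. -/
def orthogonalTo {K ι : Type*} [Field K] [Fintype ι] (y : ι → K) : Submodule K (ι → K) where
  carrier := {c | c ⬝ᵥ y = 0}
  zero_mem' := zero_dotProduct _
  add_mem' := fun {a b} ha hb => by
    have ha : a ⬝ᵥ y = 0 := ha
    have hb : b ⬝ᵥ y = 0 := hb
    change (a + b) ⬝ᵥ y = 0
    rw [add_dotProduct, ha, hb, add_zero]
  smul_mem' := fun x a ha => by
    have ha : a ⬝ᵥ y = 0 := ha
    change (x • a) ⬝ᵥ y = 0
    rw [smul_dotProduct, ha, smul_zero]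

/-! ### Rational curves -/

/-- `v` parametrizes a rational curve without base points, in formal degree `e`, and the
parametrization is not constant. -/
structure IsRationalCurve {ι : Type*} (v : ι → ℂ[X]) (e : ℕ) : Prop where
  natDegree_le : ∀ i, (v i).natDegree ≤ e
  coeffVec_ne : coeffVec v e ≠ 0
  evalVec_ne : ∀ t, evalVec v t ≠ 0
  nonconst : ∃ s t, ¬ Par (evalVec v s) (evalVec v t)

/-- Two members of the linear system of hyperplanes through `y` that have no common zero on the
curve outside the fibre of `y`. -/
theorem exists_two_hyperplanes {ι : Type*} [Fintype ι] {v : ι → ℂ[X]} {e : ℕ} {y : ι → ℂ}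
    (htop : ¬ Par (coeffVec v e) y) {W : Set (ι → ℂ)} (hW : W.Finite)
    (hWy : ∀ w ∈ W, ¬ Par w y) :
    ∃ a a' : ι → ℂ, a ⬝ᵥ y = 0 ∧ a' ⬝ᵥ y = 0 ∧ a ⬝ᵥ coeffVec v e ≠ 0 ∧
      (∀ w ∈ W, a ⬝ᵥ w ≠ 0) ∧
      ∀ s, a ⬝ᵥ evalVec v s = 0 → a' ⬝ᵥ evalVec v s = 0 → Par (evalVec v s) y := by
  obtain ⟨a, ha, h1⟩ := exists_dotProduct_ne_zero (orthogonalTo y)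
    (W := insert (coeffVec v e) W) (hW.insert _) (by
      rintro w hw
      have hwy : ¬ Par w y := by
        rcases hw with rfl | hw
        exacts [htop, hWy w hw]
      exact exists_separating_of_not_par hwy)
  have hae := h1 _ (Set.mem_insert _ _)
  have hpa : dotPoly v a ≠ 0 := by
    rintro h; rw [← coeff_dotPoly, h] at hae; simp at hae
  -- The first hyperplane meets the curve in finitely many parameters. The second is chosen to avoid
  -- those outside the fibre of `y`.
  obtain ⟨a', ha', h2⟩ := exists_dotProduct_ne_zero (orthogonalTo y)
    (W := evalVec v '' {s | (dotPoly v a).eval s = 0 ∧ ¬ Par (evalVec v s) y})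
    (((Polynomial.finite_setOf_eval_eq_zero hpa).subset fun s hs => hs.1).image _) (by
      rintro _ ⟨s, hs, rfl⟩
      exact exists_separating_of_not_par hs.2)
  refine ⟨a, a', ha, ha', hae, fun w hw => h1 w (Set.mem_insert_of_mem _ hw), fun s hs hs' => ?_⟩
  by_contra h
  exact h2 _ ⟨s, ⟨by rwa [eval_dotPoly], h⟩, rfl⟩ hs'

namespace IsRationalCurve

variable {ι : Type*} [Fintype ι] {v : ι → ℂ[X]} {e : ℕ}

omit [Fintype ι] in
theorem degree_ne_zero (hv : IsRationalCurve v e) : e ≠ 0 := by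
  rintro rfl
  obtain ⟨s, t, h⟩ := hv.nonconst
  apply h
  have h1 : ∀ i, v i = Polynomial.C ((v i).coeff 0) := fun i =>
    Polynomial.eq_C_of_natDegree_eq_zero (Nat.le_zero.1 (hv.natDegree_le i))
  intro i j
  simp only [evalVec]
  rw [h1 i, h1 j]
  simp [mul_comm]

/-- A linear form that vanishes at `b` but not on the whole curve restricts to a nonzero polynomial,
which has finitely many roots. -/
theorem finite_fiber (hv : IsRationalCurve v e) {b : ι → ℂ} (hb : b ≠ 0) :
    {s | Par (evalVec v s) b}.Finite := by
  obtain ⟨s, hs⟩ : ∃ s, ¬ Par (evalVec v s) b := by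
    by_contra! h
    obtain ⟨s, t, hst⟩ := hv.nonconst
    exact hst ((h s).trans (h t).symm hb)
  obtain ⟨c, hc, hcs⟩ := exists_separating_of_not_par hs
  rw [← eval_dotPoly] at hcs
  have h0 : dotPoly v c ≠ 0 := by rintro h; simp [h] at hcs
  refine (Polynomial.finite_setOf_eval_eq_zero h0).subset fun t ht => ?_
  change (dotPoly v c).eval t = 0
  rw [eval_dotPoly]
  exact ht.dotProduct_eq_zero hb hc

/-- This allows exceptional sets of parameters to be enlarged to unions of fibres while staying
finite. -/
theorem finite_saturation (hv : IsRationalCurve v e) {T : Set ℂ} (hT : T.Finite) :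
    {t | ∃ s ∈ T, Par (evalVec v t) (evalVec v s)}.Finite := by
  refine (hT.biUnion fun s _ => hv.finite_fiber (hv.evalVec_ne s)).subset fun t ht => ?_
  simpa using ht

/-- At a ramified parameter all Wronskians of two coordinates vanish. If they vanished identically,
dividing two coordinates by their gcd would leave constants, so all ratios of coordinates and hence
the curve would be constant. -/
theorem finite_ramification (hv : IsRationalCurve v e) :
    {t | Par (evalVec (derivVec v) t) (evalVec v t)}.Finite := by
  obtain ⟨i, j, hij⟩ : ∃ i j, Polynomial.wronskian (v i) (v j) ≠ 0 := by
    by_contra! h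
    obtain ⟨s, t, hst⟩ := hv.nonconst
    apply hst
    intro i j
    rcases eq_or_ne (v i) 0 with h0 | h0
    · simp [evalVec, h0]
    obtain ⟨a, ha⟩ := EuclideanDomain.gcd_dvd_left (v i) (v j)
    obtain ⟨b, hb⟩ := EuclideanDomain.gcd_dvd_right (v i) (v j)
    have hab : IsCoprime a b := by
      refine ⟨EuclideanDomain.gcdA (v i) (v j), EuclideanDomain.gcdB (v i) (v j), ?_⟩
      have hg0 : EuclideanDomain.gcd (v i) (v j) ≠ 0 := by
        intro h; rw [h, zero_mul] at ha; exact h0 ha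
      apply mul_left_cancel₀ hg0
      rw [mul_one]
      conv_rhs => rw [EuclideanDomain.gcd_eq_gcd_ab]
      conv_rhs => enter [1, 1]; rw [ha]
      conv_rhs => enter [2, 1]; rw [hb]
      ring
    set g := EuclideanDomain.gcd (v i) (v j)
    have hg0 : g ≠ 0 := by intro h; rw [h, zero_mul] at ha; exact h0 ha
    have hw : Polynomial.wronskian a b = 0 := by
      have h1 := h i j
      have h2 : Polynomial.wronskian (v i) (v j) = g ^ 2 * Polynomial.wronskian a b := by
        rw [ha, hb]
        simp only [Polynomial.wronskian, Polynomial.derivative_mul]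
        ring
      rw [h2] at h1
      exact (mul_eq_zero.1 h1).resolve_left (pow_ne_zero _ hg0)
    obtain ⟨h1, h2⟩ := hab.wronskian_eq_zero_iff.1 hw
    have h1 := Polynomial.eq_C_of_natDegree_eq_zero (Polynomial.derivative_eq_zero.1 h1)
    have h2 := Polynomial.eq_C_of_natDegree_eq_zero (Polynomial.derivative_eq_zero.1 h2)
    simp only [evalVec]
    rw [ha, hb, h1, h2]
    simp only [Polynomial.eval_mul, Polynomial.eval_C]
    ring
  refine (Polynomial.finite_setOf_eval_eq_zero hij).subset fun t ht => ?_
  have h1 := ht i j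
  simp only [evalVec, derivVec] at h1
  simp only [Polynomial.wronskian, Set.mem_ofPred_eq, Polynomial.eval_sub, Polynomial.eval_mul]
  linear_combination -h1

/-- The cardinality of the fibres is upper semicontinuous at unramified parameters. -/
theorem exists_finite_fiber_le (hv : IsRationalCurve v e) (t₀ : ℂ)
    (htop : ¬ Par (coeffVec v e) (evalVec v t₀))
    (hram : ∀ s, Par (evalVec v s) (evalVec v t₀) →
      ¬ Par (evalVec (derivVec v) s) (evalVec v s)) :
    ∃ Z : Set ℂ, Z.Finite ∧ ∀ t ∉ Z, {s | Par (evalVec v s) (evalVec v t)}.ncard ≤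
      {s | Par (evalVec v s) (evalVec v t₀)}.ncard := by
  classical
  have hy := hv.evalVec_ne t₀
  have hfin := hv.finite_fiber hy
  -- The two hyperplanes cut out exactly the fibre of `t₀`, and the first is transversal to the
  -- curve there because the fibre is unramified.
  obtain ⟨a, a', hay, hay', hae, haW, hcommon⟩ := exists_two_hyperplanes htop
    (W := evalVec (derivVec v) '' {s | Par (evalVec v s) (evalVec v t₀)}) (hfin.image _) (by
      rintro _ ⟨s, hs, rfl⟩ h
      exact hram s hs (h.trans hs.symm hy))
  obtain ⟨i, hi⟩ := Function.ne_iff.1 hy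
  have hi : (v i).eval t₀ ≠ 0 := hi
  -- At `(t, s)` this is `v_i(t) (b · v(s)) - v_i(s) (b · v(t))`. It vanishes when `s` is in the
  -- fibre of `t`, and at `t = t₀` it reduces to a multiple of `b · v(s)`.
  let f : (ι → ℂ) → ℂ[X][X] := fun b => Polynomial.C (v i) * (dotPoly v b).map Polynomial.C -
    (v i).map Polynomial.C * Polynomial.C (dotPoly v b)
  let ρ : ℂ → ℂ[X] →ₐ[ℂ] ℂ := fun t => Polynomial.aeval t
  have hρC : ∀ (t : ℂ) (p : ℂ[X]), (p.map Polynomial.C).map (ρ t).toRingHom = p := by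
    intro t p
    rw [Polynomial.map_map]
    convert Polynomial.map_id
    ext x
    simp [ρ]
  have hf : ∀ b t, (f b).map (ρ t).toRingHom = Polynomial.C ((v i).eval t) * dotPoly v b -
      v i * Polynomial.C ((dotPoly v b).eval t) := by
    intro b t
    simp only [f, Polynomial.map_sub, Polynomial.map_mul, hρC, Polynomial.map_C]
    simp [ρ]
  have hdeg : ∀ b, (f b).natDegree ≤ e := by
    intro b
    refine (Polynomial.natDegree_sub_le_of_le (m := e) (n := e) ?_ ?_).trans (max_self e).le
    · exact (Polynomial.natDegree_C_mul_le _ _).trans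
        (Polynomial.natDegree_map_le.trans (natDegree_dotPoly_le v b hv.natDegree_le))
    · exact (Polynomial.natDegree_mul_C_le _ _).trans
        (Polynomial.natDegree_map_le.trans (hv.natDegree_le i))
  have h0 : ∀ b, b ⬝ᵥ evalVec v t₀ = 0 → (f b).map (ρ t₀).toRingHom =
      Polynomial.C ((v i).eval t₀) * dotPoly v b := by
    intro b hb
    rw [hf, eval_dotPoly, hb]; simp
  obtain ⟨δ, hδ₀, hδ⟩ := Polynomial.exists_open_card_common_roots_le (f a') (f a) e e (hdeg _)
    (hdeg _) (ρ t₀) (by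
      have : ρ t₀ ((f a).coeff e) = ((f a).map (ρ t₀).toRingHom).coeff e := by
        rw [Polynomial.coeff_map]; rfl
      rw [this, h0 a hay, Polynomial.coeff_C_mul, coeff_dotPoly]
      exact mul_ne_zero hi hae) hfin.toFinset (by
      intro s hs' hs
      rw [h0 _ hay', Polynomial.eval_mul, Polynomial.eval_C] at hs'
      rw [h0 _ hay, Polynomial.eval_mul, Polynomial.eval_C] at hs
      have hs' := (mul_eq_zero.1 hs').resolve_left hi
      have hs := (mul_eq_zero.1 hs).resolve_left hi
      rw [eval_dotPoly] at hs hs'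
      have hpar := hcommon s hs hs'
      refine ⟨by simpa using hpar, Or.inr ?_⟩
      rw [h0 _ hay, Polynomial.derivative_C_mul, Polynomial.eval_mul, Polynomial.eval_C,
        derivative_dotPoly, eval_dotPoly]
      exact mul_ne_zero hi (haW _ ⟨s, hpar, rfl⟩))
  have hδ0 : δ ≠ 0 := by rintro rfl; simp at hδ₀
  refine ⟨{t | δ.eval t = 0}, Polynomial.finite_setOf_eval_eq_zero hδ0, fun t ht => ?_⟩
  have hfin' := hv.finite_fiber (hv.evalVec_ne t)
  have := hδ (ρ t) (by simpa [ρ, Polynomial.coe_aeval_eq_eval] using ht) hfin'.toFinset (by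
    intro s hs
    have hs : Par (evalVec v s) (evalVec v t) := by simpa using hs
    have key : ∀ b, ((f b).map (ρ t).toRingHom).eval s = 0 := by
      intro b
      rw [hf]
      obtain ⟨x, hx⟩ := hs.exists_smul (hv.evalVec_ne t)
      have hxi : (v i).eval s = x * (v i).eval t := congrFun hx i
      simp only [Polynomial.eval_sub, Polynomial.eval_mul, Polynomial.eval_C, eval_dotPoly, hx,
        hxi, dotProduct_smul, smul_eq_mul]
      ring
    exact ⟨key _, key _⟩)
  rwa [← Set.ncard_eq_toFinset_card _ hfin', ← Set.ncard_eq_toFinset_card _ hfin] at this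

/-- All but finitely many fibres of the parametrization have the same cardinality. -/
theorem exists_card_fiber (hv : IsRationalCurve v e) {T₁ : Set ℂ} (hT₁ : T₁.Finite) :
    ∃ (k : ℕ) (T : Set ℂ), T.Finite ∧ T₁ ⊆ T ∧ 0 < k ∧ ∀ t ∉ T,
      {s | Par (evalVec v s) (evalVec v t)}.ncard = k ∧
      (∀ s, Par (evalVec v s) (evalVec v t) → s ∉ T) ∧
      ¬ Par (coeffVec v e) (evalVec v t) ∧
      ¬ Par (evalVec (derivVec v) t) (evalVec v t) := by
  classical
  let sat : Set ℂ → Set ℂ := fun T => {t | ∃ s ∈ T, Par (evalVec v t) (evalVec v s)}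
  have hsub : ∀ T, T ⊆ sat T := fun T t ht => ⟨t, ht, Par.refl _⟩
  have hsat : ∀ T t, t ∉ sat T → ∀ s, Par (evalVec v s) (evalVec v t) → s ∉ sat T := by
    rintro T t ht s hs ⟨r, hr, hsr⟩
    exact ht ⟨r, hr, hs.symm.trans hsr (hv.evalVec_ne s)⟩
  have htopfin : {t | Par (coeffVec v e) (evalVec v t)}.Finite :=
    (hv.finite_fiber hv.coeffVec_ne).subset fun t ht => Par.symm ht
  let T₂ := sat ({t | Par (evalVec (derivVec v) t) (evalVec v t)} ∪
    {t | Par (coeffVec v e) (evalVec v t)})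
  have hT₂ : T₂.Finite := hv.finite_saturation (hv.finite_ramification.union htopfin)
  let card : ℂ → ℕ := fun t => {s | Par (evalVec v s) (evalVec v t)}.ncard
  -- `k` is the least fibre cardinality outside `T₂`. Semicontinuity at a parameter attaining it
  -- gives the opposite inequality off a finite set.
  have hex : ∃ n, ∃ t ∉ T₂, card t = n := by
    obtain ⟨t, ht⟩ := hT₂.exists_notMem
    exact ⟨_, t, ht, rfl⟩
  obtain ⟨t₀, ht₀, hk⟩ := Nat.find_spec hex
  have hmin : ∀ t ∉ T₂, Nat.find hex ≤ card t := fun t ht => Nat.find_min' hex ⟨t, ht, rfl⟩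
  have htop₂ : ∀ t ∉ T₂, ¬ Par (coeffVec v e) (evalVec v t) :=
    fun t ht h => ht (hsub _ (Or.inr h))
  have hram₂ : ∀ t ∉ T₂, ¬ Par (evalVec (derivVec v) t) (evalVec v t) :=
    fun t ht h => ht (hsub _ (Or.inl h))
  obtain ⟨Z, hZ, hle⟩ := hv.exists_finite_fiber_le t₀ (htop₂ t₀ ht₀)
    fun s hs => hram₂ s (hsat _ _ ht₀ s hs)
  refine ⟨Nat.find hex, sat (T₂ ∪ Z ∪ T₁), hv.finite_saturation ((hT₂.union hZ).union hT₁),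
    fun t ht => hsub _ (Or.inr ht), ?_, fun t ht => ?_⟩
  · rw [← hk, Set.ncard_pos (hv.finite_fiber (hv.evalVec_ne t₀))]
    exact ⟨t₀, Par.refl _⟩
  · have h1 : t ∉ T₂ := fun h => ht (hsub _ (Or.inl (Or.inl h)))
    have h2 : t ∉ Z := fun h => ht (hsub _ (Or.inl (Or.inr h)))
    exact ⟨le_antisymm ((hle t h2).trans hk.le) (hmin t h1), hsat _ t ht, htop₂ t h1, hram₂ t h1⟩

/-- A point off the curve is separated from it by a form. -/
theorem exists_form (hv : IsRationalCurve v e) {y : ι → ℂ} (hy : y ≠ 0)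
    (htop : ¬ Par (coeffVec v e) y) (hfin : ∀ t, ¬ Par (evalVec v t) y) :
    ∃ F : MvPolynomial ι ℂ, F.IsHomogeneous (e + e) ∧ (∀ t, MvPolynomial.eval (evalVec v t) F = 0) ∧
      MvPolynomial.eval (coeffVec v e) F = 0 ∧ MvPolynomial.eval y F ≠ 0 := by
  obtain ⟨a, a', hay, hay', hae, -, hcommon⟩ := exists_two_hyperplanes htop
    (W := ∅) Set.finite_empty (by simp)
  obtain ⟨i, hi⟩ := Function.ne_iff.1 hy
  have hi : y i ≠ 0 := hi
  let ℓ : (ι → ℂ) → MvPolynomial ι ℂ := fun b => ∑ j, MvPolynomial.C (b j) * MvPolynomial.X j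
  have hℓ : ∀ b x, MvPolynomial.eval x (ℓ b) = b ⬝ᵥ x := by
    intro b x; simp [ℓ, dotProduct]
  have hℓh : ∀ b, (ℓ b).IsHomogeneous 1 := fun b =>
    MvPolynomial.IsHomogeneous.sum _ _ _ fun j _ => MvPolynomial.isHomogeneous_C_mul_X _ _
  -- `(b · X) v_i(t) - X_i (b · v(t))`: at a point of the curve its parameter is a root for every
  -- `b`. At `y`, only `-y_i (b · v(t))` remains, and for `a`, `a'` a common root would put `y` on
  -- the curve.
  let f : (ι → ℂ) → (MvPolynomial ι ℂ)[X] := fun b =>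
    Polynomial.C (ℓ b) * (v i).map MvPolynomial.C -
      Polynomial.C (MvPolynomial.X i) * (dotPoly v b).map MvPolynomial.C
  have hf : ∀ b x, (f b).map (MvPolynomial.eval x) = Polynomial.C (b ⬝ᵥ x) * v i -
      Polynomial.C (x i) * dotPoly v b := by
    intro b x
    have : ∀ p : ℂ[X], (p.map MvPolynomial.C).map (MvPolynomial.eval x) = p := by
      intro p
      rw [Polynomial.map_map]
      convert Polynomial.map_id
      ext z
      simp
    simp only [f, Polynomial.map_sub, Polynomial.map_mul, Polynomial.map_C, this, hℓ,
      MvPolynomial.eval_X]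
  have hcoeff : ∀ b j, ((f b).coeff j).IsHomogeneous 1 := by
    intro b j
    simp only [f, Polynomial.coeff_sub, Polynomial.coeff_C_mul, Polynomial.coeff_map]
    refine MvPolynomial.IsHomogeneous.sub ?_ ?_
    · exact (hℓh b).mul (MvPolynomial.isHomogeneous_C _ _)
    · exact (MvPolynomial.isHomogeneous_X _ _).mul (MvPolynomial.isHomogeneous_C _ _)
  have hdeg : ∀ b x, ((f b).map (MvPolynomial.eval x)).natDegree ≤ e := by
    intro b x
    rw [hf]
    refine (Polynomial.natDegree_sub_le_of_le (m := e) (n := e) ?_ ?_).trans (max_self e).le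
    exacts [(Polynomial.natDegree_C_mul_le _ _).trans (hv.natDegree_le i),
      (Polynomial.natDegree_C_mul_le _ _).trans (natDegree_dotPoly_le v b hv.natDegree_le)]
  have hres : ∀ x, MvPolynomial.eval x (Polynomial.resultant (f a') (f a) e e) = 0 ↔
      (((f a').map (MvPolynomial.eval x)).coeff e = 0 ∧
        ((f a).map (MvPolynomial.eval x)).coeff e = 0) ∨
      ∃ t, ((f a').map (MvPolynomial.eval x)).eval t = 0 ∧
        ((f a).map (MvPolynomial.eval x)).eval t = 0 := by
    intro x
    rw [← Polynomial.resultant_map_map]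
    exact Polynomial.resultant_eq_zero_iff_common_root (hdeg a' x) (hdeg a x)
      (Or.inl hv.degree_ne_zero)
  refine ⟨Polynomial.resultant (f a') (f a) e e,
    MvPolynomial.isHomogeneous_resultant (hcoeff _) (hcoeff _) _ _, fun t => ?_, ?_, ?_⟩
  · rw [hres]
    have : ∀ b, ((f b).map (MvPolynomial.eval (evalVec v t))).eval t = 0 := by
      intro b
      rw [hf]
      simp [eval_dotPoly, evalVec, mul_comm]
    exact Or.inr ⟨t, this _, this _⟩
  · rw [hres]
    have : ∀ b, ((f b).map (MvPolynomial.eval (coeffVec v e))).coeff e = 0 := by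
      intro b
      rw [hf, Polynomial.coeff_sub, Polynomial.coeff_C_mul, Polynomial.coeff_C_mul, coeff_dotPoly]
      simp [coeffVec, mul_comm]
    exact Or.inl ⟨this _, this _⟩
  · rw [Ne, hres, hf, hf, hay, hay']
    simp only [map_zero, zero_mul, zero_sub, Polynomial.coeff_neg, Polynomial.coeff_C_mul,
      coeff_dotPoly, Polynomial.eval_neg, Polynomial.eval_mul, Polynomial.eval_C, eval_dotPoly,
      neg_eq_zero, mul_eq_zero, hi, false_or]
    rintro (h | ⟨t, h1, h2⟩)
    · exact hae h.2
    · exact hfin t (hcommon t h2 h1)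

end IsRationalCurve

/-! ### Complex points of the Zariski closure of a set of real points -/

theorem MvPolynomial.IsHomogeneous.degree_eq {ι K : Type*} [CommSemiring K]
    {F : MvPolynomial ι K} {n : ℕ} (hF : F.IsHomogeneous n) {m : ι →₀ ℕ} (hm : m ∈ F.support) :
    m.degree = n := by
  by_contra h
  exact MvPolynomial.mem_support_iff.1 hm (hF.coeff_eq_zero h)

theorem exists_real_imaginary_forms {ι : Type*} (F : MvPolynomial ι ℂ) {n : ℕ}
    (hF : F.IsHomogeneous n) : ∃ F₁ F₂ : MvPolynomial ι ℝ, F₁.IsHomogeneous n ∧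
      F₂.IsHomogeneous n ∧ ∀ x : ι → ℂ, MvPolynomial.eval x F =
        MvPolynomial.aeval x F₁ + Complex.I * MvPolynomial.aeval x F₂ := by
  classical
  refine ⟨∑ m ∈ F.support, MvPolynomial.monomial m (F.coeff m).re,
    ∑ m ∈ F.support, MvPolynomial.monomial m (F.coeff m).im, ?_, ?_, fun x => ?_⟩
  · exact MvPolynomial.IsHomogeneous.sum _ _ _ fun m hm => MvPolynomial.isHomogeneous_monomial _ (hF.degree_eq hm)
  · exact MvPolynomial.IsHomogeneous.sum _ _ _ fun m hm => MvPolynomial.isHomogeneous_monomial _ (hF.degree_eq hm)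
  · conv_lhs => rw [F.as_sum]
    simp only [map_sum, MvPolynomial.aeval_monomial, MvPolynomial.eval_monomial, Finset.mul_sum,
      ← Finset.sum_add_distrib]
    refine Finset.sum_congr rfl fun m _ => ?_
    conv_lhs => rw [← Complex.re_add_im (F.coeff m)]
    simp only [Complex.coe_algebraMap]
    ring

theorem aeval_ofReal {ι : Type*} (x : ι → ℝ) (F : MvPolynomial ι ℝ) :
    MvPolynomial.aeval (fun i => (x i : ℂ)) F = (MvPolynomial.eval x F : ℂ) :=
  (MvPolynomial.aeval_algebraMap_apply ℂ x F).trans (by simp [MvPolynomial.aeval_eq_eval])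

theorem MvPolynomial.IsHomogeneous.eval_smul {ι K : Type*} [CommSemiring K]
    {F : MvPolynomial ι K} {n : ℕ} (hF : F.IsHomogeneous n) (c : K) (x : ι → K) :
    MvPolynomial.eval (c • x) F = c ^ n * MvPolynomial.eval x F := by
  conv_lhs => rw [F.as_sum]
  conv_rhs => rw [F.as_sum]
  simp only [map_sum, MvPolynomial.eval_monomial, Finset.mul_sum]
  refine Finset.sum_congr rfl fun m hm => ?_
  have := hF.degree_eq hm
  rw [Finsupp.degree_apply] at this
  simp only [Pi.smul_apply, smul_eq_mul, mul_pow, Finsupp.prod, Finset.prod_mul_distrib]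
  rw [Finset.prod_pow_eq_pow_sum, this]
  ring

/-- Complex forms that vanish on a set of real points vanish on the complex points of its closure. -/
theorem eval_eq_zero_of_mem_complexClosure {ι : Type} {X : Set (ℙ ℝ (ι → ℝ))} {y : ℙ ℂ (ι → ℂ)}
    (hy : y ∈ complexClosure X) {F : MvPolynomial ι ℂ} {n : ℕ} (hF : F.IsHomogeneous n)
    (h : ∀ x ∈ X, MvPolynomial.eval (fun i => (x.rep i : ℂ)) F = 0) :
    MvPolynomial.eval y.rep F = 0 := by
  obtain ⟨F₁, F₂, h₁, h₂, hev⟩ := exists_real_imaginary_forms F hF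
  -- At a real point both parts have real values, so they vanish separately.
  have key : ∀ x ∈ X, MvPolynomial.eval x.rep F₁ = 0 ∧ MvPolynomial.eval x.rep F₂ = 0 := by
    intro x hx
    have := h x hx
    rw [hev, aeval_ofReal, aeval_ofReal] at this
    constructor
    · simpa using congrArg Complex.re this
    · simpa using congrArg Complex.im this
  rw [hev, hy F₁ n h₁ fun x hx => (key x hx).1, hy F₂ n h₂ fun x hx => (key x hx).2]
  simp

/-! ### Pairs of vectors and their minors -/

/-- The vector of 2-minors of a pair of vectors. -/
def wedge {R : Type*} [CommRing R] {d : ℕ} (p q : Fin d → R) : PairIndex d → R :=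
  fun a => p a.1.1 * q a.1.2 - p a.1.2 * q a.1.1

/-- The space of vectors orthogonal to `p` and `q`. -/
def perp {K ι : Type*} [Field K] [Fintype ι] (p q : ι → K) : Submodule K (ι → K) :=
  orthogonalTo p ⊓ orthogonalTo q

theorem mem_perp {K ι : Type*} [Field K] [Fintype ι] {p q x : ι → K} :
    x ∈ perp p q ↔ x ⬝ᵥ p = 0 ∧ x ⬝ᵥ q = 0 := Iff.rfl

section wedge

variable {K : Type*} [Field K] {d : ℕ} {p q p' q' u x : Fin d → K}

theorem minor_eq_smul_of_wedge {R : Type*} [CommRing R] {p q p' q' : Fin d → R} {c : R}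
    (h : wedge p q = c • wedge p' q') (i j : Fin d) :
    p i * q j - p j * q i = c * (p' i * q' j - p' j * q' i) := by
  rcases lt_trichotomy i j with hij | rfl | hij
  · exact congrFun h ⟨(i, j), hij⟩
  · ring
  · have := congrFun h ⟨(j, i), hij⟩
    simp only [wedge, Pi.smul_apply, smul_eq_mul] at this
    linear_combination -this

theorem exists_minor_ne_zero {R : Type*} [CommRing R] {p q : Fin d → R} (h : wedge p q ≠ 0) :
    ∃ i j, p i * q j - p j * q i ≠ 0 := by
  obtain ⟨a, ha⟩ := Function.ne_iff.1 h
  exact ⟨_, _, ha⟩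

theorem sum_minor_mul (j : Fin d) :
    ∑ i, (p i * q j - p j * q i) * x i = (x ⬝ᵥ p) * q j - (x ⬝ᵥ q) * p j := by
  simp only [dotProduct, Finset.sum_mul, ← Finset.sum_sub_distrib]
  exact Finset.sum_congr rfl fun i _ => by ring

theorem eq_zero_of_add_smul_eq_zero (h : wedge p q ≠ 0) {α β : K}
    (h0 : ∀ j, α * p j + β * q j = 0) : α = 0 ∧ β = 0 := by
  obtain ⟨i, j, hij⟩ := exists_minor_ne_zero h
  constructor
  · refine (mul_eq_zero.1 (?_ : α * (p i * q j - p j * q i) = 0)).resolve_right hij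
    linear_combination q j * h0 i - q i * h0 j
  · refine (mul_eq_zero.1 (?_ : β * (p i * q j - p j * q i) = 0)).resolve_right hij
    linear_combination p i * h0 j - p j * h0 i

/-- Contracting `x` with the minors of `p'`, `q'` gives `(x · p') q' - (x · q') p'`. This is a
multiple of the contraction with the minors of `p`, `q`, which is zero, and `p'`, `q'` are
independent. -/
theorem perp_le_of_par (h : Par (wedge p q) (wedge p' q')) (hpq : wedge p q ≠ 0)
    (hpq' : wedge p' q' ≠ 0) : perp p q ≤ perp p' q' := by
  intro x hx
  obtain ⟨c, hc⟩ := h.symm.exists_smul hpq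
  have h1 : ∀ j, (x ⬝ᵥ p') * q' j + -(x ⬝ᵥ q') * p' j = 0 := by
    intro j
    have h2 := sum_minor_mul (p := p') (q := q') (x := x) j
    simp only [minor_eq_smul_of_wedge hc, mul_assoc, ← Finset.mul_sum, sum_minor_mul] at h2
    rw [(mem_perp.1 hx).1, (mem_perp.1 hx).2] at h2
    linear_combination -h2
  have h2 := eq_zero_of_add_smul_eq_zero hpq' (α := -(x ⬝ᵥ q')) (β := x ⬝ᵥ p')
    fun j => by linear_combination h1 j
  exact ⟨h2.2, neg_eq_zero.1 h2.1⟩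

/-- The component of `[i, j] w` orthogonal to `p` and `q`, in the directions `i` and `j`. -/
def perpProj {R : Type*} [CommRing R] (p q : Fin d → R) (i j : Fin d) (w : Fin d → R) :
    Fin d → R :=
  (p i * q j - p j * q i) • w + Pi.single i (p j * (w ⬝ᵥ q) - q j * (w ⬝ᵥ p)) -
    Pi.single j (p i * (w ⬝ᵥ q) - q i * (w ⬝ᵥ p))

theorem perpProj_dotProduct (i j : Fin d) (w u : Fin d → K) :
    perpProj p q i j w ⬝ᵥ u = (p i * q j - p j * q i) * (w ⬝ᵥ u) +
      (p j * (w ⬝ᵥ q) - q j * (w ⬝ᵥ p)) * u i - (p i * (w ⬝ᵥ q) - q i * (w ⬝ᵥ p)) * u j := by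
  simp [perpProj, add_dotProduct, sub_dotProduct]

theorem perpProj_mem_perp (i j : Fin d) (w : Fin d → K) : perpProj p q i j w ∈ perp p q := by
  rw [mem_perp, perpProj_dotProduct, perpProj_dotProduct]
  constructor <;> ring

theorem perpProj_of_mem_perp (i j : Fin d) {w : Fin d → K} (hw : w ∈ perp p q) :
    perpProj p q i j w = (p i * q j - p j * q i) • w := by
  simp [perpProj, (mem_perp.1 hw).1, (mem_perp.1 hw).2]

/-- Double annihilator. -/
theorem exists_eq_add_smul_of_perp (h : wedge p q ≠ 0) (hu : ∀ x ∈ perp p q, x ⬝ᵥ u = 0) :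
    ∃ α β : K, u = α • p + β • q := by
  obtain ⟨i, j, hij⟩ := exists_minor_ne_zero h
  -- The projection of `w` into the orthogonal space is linear in `w`, so its product with `u` is
  -- `w` times a fixed vector. That vector must vanish, and this is Cramer's rule for `u`.
  have h1 : ∀ w : Fin d → K, w ⬝ᵥ ((p i * q j - p j * q i) • u + (u i * p j - u j * p i) • q -
      (u i * q j - u j * q i) • p) = 0 := by
    intro w
    rw [dotProduct_sub, dotProduct_add, dotProduct_smul, dotProduct_smul, dotProduct_smul,
      smul_eq_mul, smul_eq_mul, smul_eq_mul, ← hu _ (perpProj_mem_perp i j w), perpProj_dotProduct]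
    ring
  have h2 := dotProduct_eq_zero_iff.1 fun w => (dotProduct_comm _ _).trans (h1 w)
  refine ⟨(u i * q j - u j * q i) / (p i * q j - p j * q i),
    -(u i * p j - u j * p i) / (p i * q j - p j * q i), funext fun l => ?_⟩
  have h3 := congrFun h2 l
  simp only [Pi.add_apply, Pi.sub_apply, Pi.smul_apply, smul_eq_mul, Pi.zero_apply] at h3 ⊢
  rw [div_mul_eq_mul_div, div_mul_eq_mul_div, ← add_div, eq_div_iff hij]
  linear_combination h3

theorem exists_mem_perp_of_not_span (h : wedge p q ≠ 0)
    (hu : ¬ ∃ α β : K, u = α • p + β • q) : ∃ x ∈ perp p q, x ⬝ᵥ u ≠ 0 := by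
  by_contra! h1
  exact hu (exists_eq_add_smul_of_perp h h1)

/-- If one orthogonal space were contained in the other, the double annihilator would express `p'`,
`q'` through `p`, `q`, and the minors would differ by the determinant of this substitution. -/
theorem exists_mem_perp_notMem_perp (hpq : wedge p q ≠ 0)
    (h : ¬ Par (wedge p' q') (wedge p q)) : ∃ x ∈ perp p q, x ∉ perp p' q' := by
  by_contra! h1
  obtain ⟨α, β, h2⟩ := exists_eq_add_smul_of_perp hpq fun x hx => (mem_perp.1 (h1 x hx)).1
  obtain ⟨γ, δ, h3⟩ := exists_eq_add_smul_of_perp hpq fun x hx => (mem_perp.1 (h1 x hx)).2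
  refine h (Par.of_smul (x := α * δ - β * γ) ?_)
  ext a
  simp only [wedge, h2, h3, Pi.add_apply, Pi.smul_apply, smul_eq_mul]
  ring

/-- Two independent vectors of the span of `p`, `q` have the same orthogonal space. -/
theorem mem_perp_of_dotProduct {b c : Fin d → K} {α β γ δ : K} (hb : b = α • p + β • q)
    (hc : c = γ • p + δ • q) (hbc : ¬ Par b c) (h1 : x ⬝ᵥ b = 0) (h2 : x ⬝ᵥ c = 0) :
    x ∈ perp p q := by
  have hdet : α * δ - β * γ ≠ 0 := by
    intro h
    apply hbc
    intro i j
    simp only [hb, hc, Pi.add_apply, Pi.smul_apply, smul_eq_mul]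
    linear_combination (p i * q j - q i * p j) * h
  rw [hb, dotProduct_add, dotProduct_smul, dotProduct_smul, smul_eq_mul, smul_eq_mul] at h1
  rw [hc, dotProduct_add, dotProduct_smul, dotProduct_smul, smul_eq_mul, smul_eq_mul] at h2
  constructor
  · refine (mul_eq_zero.1 (?_ : (α * δ - β * γ) * (x ⬝ᵥ p) = 0)).resolve_left hdet
    linear_combination δ * h1 - β * h2
  · refine (mul_eq_zero.1 (?_ : (α * δ - β * γ) * (x ⬝ᵥ q) = 0)).resolve_left hdet
    linear_combination α * h2 - γ * h1

/-- The vanishing 3-minors say that `a` depends on `p` and `q`. Contracting them with `x` leaves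
only a nonzero minor times `x · a`. -/
theorem dotProduct_eq_zero_of_triple_minor {a : Fin d → K} (hpq : wedge p q ≠ 0)
    (h : ∀ i j l, a i * (p j * q l - p l * q j) - a j * (p i * q l - p l * q i) +
      a l * (p i * q j - p j * q i) = 0) (hx : x ∈ perp p q) : x ⬝ᵥ a = 0 := by
  obtain ⟨i, j, hij⟩ := exists_minor_ne_zero hpq
  have h1 : ∑ l, (a i * (p j * q l - p l * q j) - a j * (p i * q l - p l * q i) +
      a l * (p i * q j - p j * q i)) * x l = 0 :=
    Finset.sum_eq_zero fun l _ => by rw [h, zero_mul]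
  have h2 : ∑ l, (a i * (p j * q l - p l * q j) - a j * (p i * q l - p l * q i) +
      a l * (p i * q j - p j * q i)) * x l = a i * (p j * (x ⬝ᵥ q) - q j * (x ⬝ᵥ p)) -
        a j * (p i * (x ⬝ᵥ q) - q i * (x ⬝ᵥ p)) + (p i * q j - p j * q i) * (x ⬝ᵥ a) := by
    simp only [dotProduct, Finset.mul_sum, ← Finset.sum_sub_distrib, ← Finset.sum_add_distrib]
    exact Finset.sum_congr rfl fun l _ => by ring
  rw [h2, (mem_perp.1 hx).1, (mem_perp.1 hx).2] at h1
  refine (mul_eq_zero.1 (?_ : (p i * q j - p j * q i) * (x ⬝ᵥ a) = 0)).resolve_left hij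
  linear_combination h1

/-- In dimension three, the minors determine the orthogonal line. -/
theorem par_wedge_of_mem_perp {p q p' q' x : Fin 3 → K} (hx : x ≠ 0) (h : x ∈ perp p q)
    (h' : x ∈ perp p' q') : Par (wedge p q) (wedge p' q') := by
  -- The cross product of `p` and `q` is a multiple of the vector orthogonal to both.
  have key : ∀ {p q : Fin 3 → K}, x ∈ perp p q → ∃ c : K,
      p 0 * q 1 - p 1 * q 0 = c * x 2 ∧ p 0 * q 2 - p 2 * q 0 = -(c * x 1) ∧
      p 1 * q 2 - p 2 * q 1 = c * x 0 := by
    intro p q h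
    obtain ⟨h1, h2⟩ := mem_perp.1 h
    simp only [dotProduct, Fin.sum_univ_three] at h1 h2
    by_cases h0 : x 0 = 0
    · by_cases h3 : x 1 = 0
      · have h4 : x 2 ≠ 0 := by
          intro h4; apply hx; ext i; fin_cases i <;> assumption
        refine ⟨(p 0 * q 1 - p 1 * q 0) / x 2, by field_simp, ?_, ?_⟩ <;> field_simp
        · linear_combination -q 0 * h1 + p 0 * h2
        · linear_combination -q 1 * h1 + p 1 * h2
      · refine ⟨-(p 0 * q 2 - p 2 * q 0) / x 1, ?_, by field_simp, ?_⟩ <;> field_simp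
        · linear_combination -q 0 * h1 + p 0 * h2
        · linear_combination q 2 * h1 - p 2 * h2
    · refine ⟨(p 1 * q 2 - p 2 * q 1) / x 0, ?_, ?_, by field_simp⟩ <;> field_simp
      · linear_combination q 1 * h1 - p 1 * h2
      · linear_combination q 2 * h1 - p 2 * h2
  obtain ⟨c, h1, h2, h3⟩ := key h
  obtain ⟨c', h1', h2', h3'⟩ := key h'
  rintro ⟨⟨i, j⟩, hij⟩ ⟨⟨k, l⟩, hkl⟩
  simp only [wedge]
  fin_cases i <;> fin_cases j <;> first | exact absurd hij (by decide) | skip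
  all_goals fin_cases k <;> fin_cases l <;> first | exact absurd hkl (by decide) | skip
  all_goals
    simp only [Fin.zero_eta, Fin.mk_one, Fin.reduceFinMk, h1, h2, h3, h1', h2', h3'] <;> ring

end wedge

/-! ### Pairs of polynomial vectors -/

/-- Two complex polynomial vectors whose vector of minors is a rational curve without base points
of the expected degree. -/
structure IsRuling {d : ℕ} (p q : Fin d → ℂ[X]) (m n : ℕ) : Prop where
  natDegree_left : ∀ i, (p i).natDegree ≤ m
  natDegree_right : ∀ i, (q i).natDegree ≤ n
  curve : IsRationalCurve (wedge p q) (m + n)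

theorem evalVec_wedge {K : Type*} [Field K] {d : ℕ} (p q : Fin d → K[X]) (t : K) :
    evalVec (wedge p q) t = wedge (evalVec p t) (evalVec q t) := by
  ext a; simp [evalVec, wedge]

theorem coeffVec_wedge {K : Type*} [Field K] {d : ℕ} {p q : Fin d → K[X]} {m n : ℕ}
    (hp : ∀ i, (p i).natDegree ≤ m) (hq : ∀ i, (q i).natDegree ≤ n) :
    coeffVec (wedge p q) (m + n) = wedge (coeffVec p m) (coeffVec q n) := by
  ext a
  simp only [coeffVec, wedge, Polynomial.coeff_sub]
  rw [Polynomial.coeff_mul_add_eq_of_natDegree_le (hp _) (hq _),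
    Polynomial.coeff_mul_add_eq_of_natDegree_le (hp _) (hq _)]

theorem evalVec_derivVec_wedge {K : Type*} [Field K] {d : ℕ} (p q : Fin d → K[X]) (t : K) :
    evalVec (derivVec (wedge p q)) t = wedge (evalVec (derivVec p) t) (evalVec q t) +
      wedge (evalVec p t) (evalVec (derivVec q) t) := by
  ext a
  simp [evalVec, derivVec, wedge, Polynomial.derivative_mul]
  ring

theorem finite_setOf_add_mul_eq_zero {K : Type*} [Field K] {a b : K} (h : a ≠ 0 ∨ b ≠ 0) :
    {x : K | a + x * b = 0}.Finite := by
  refine Set.Subsingleton.finite fun x hx y hy => ?_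
  have hx : a + x * b = 0 := hx
  have hy : a + y * b = 0 := hy
  have h1 : (x - y) * b = 0 := by linear_combination hx - hy
  rcases mul_eq_zero.1 h1 with h2 | h2
  · exact sub_eq_zero.1 h2
  · rcases h with h | h
    · exact absurd (by simpa [h2] using hx) h
    · exact absurd h2 h

theorem finite_setOf_dotProduct_evalVec {ι : Type*} [Fintype ι] {p : ι → ℂ[X]} {x : ι → ℂ} {s : ℂ}
    (h : x ⬝ᵥ evalVec p s ≠ 0) : {t | x ⬝ᵥ evalVec p t = 0}.Finite := by
  rw [← eval_dotPoly] at h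
  have h0 : dotPoly p x ≠ 0 := by rintro h1; simp [h1] at h
  simpa only [← eval_dotPoly] using Polynomial.finite_setOf_eval_eq_zero h0

/-- A general member of a linear space of vectors lies in none of a family of codimension two
subspaces, if the family is parametrized by a curve and does not degenerate on the space. -/
theorem exists_mem_forall_notMem_perp {ι : Type*} [Fintype ι] (p q : ι → ℂ[X])
    (L : Submodule ℂ (ι → ℂ)) (Z : Set ℂ) (s : ℂ)
    (hs : ∀ α β : ℂ, α ≠ 0 ∨ β ≠ 0 → ∃ x ∈ L, x ⬝ᵥ (α • evalVec p s + β • evalVec q s) ≠ 0)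
    (hZ : ∀ t ∈ Z, ∃ x ∈ L, x ∉ perp (evalVec p t) (evalVec q t)) {Ω : Set (ι → ℂ)}
    (hΩ : Ω.Finite) (hΩL : ∀ w ∈ Ω, ∃ x ∈ L, x ⬝ᵥ w ≠ 0) :
    ∃ x ∈ L, (∀ w ∈ Ω, x ⬝ᵥ w ≠ 0) ∧ ∀ t ∈ Z, x ∉ perp (evalVec p t) (evalVec q t) := by
  obtain ⟨a, haL, ha⟩ := exists_dotProduct_ne_zero L (hΩ.insert (evalVec p s)) (by
    rintro w (rfl | hw)
    · simpa using hs 1 0 (by simp)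
    · exact hΩL w hw)
  have has := ha _ (Set.mem_insert _ _)
  have haΩ := fun w hw => ha w (Set.mem_insert_of_mem _ hw)
  let Z₁ : Set ℂ := {t | t ∈ Z ∧ a ∈ perp (evalVec p t) (evalVec q t)}
  have hZ₁ : Z₁.Finite := (finite_setOf_dotProduct_evalVec has).subset fun t ht => ht.2.1
  -- The combination of `p(s)` and `q(s)` that kills `a`. Requiring `b · ψ ≠ 0` makes the
  -- determinant `h` below nonzero at `s`.
  let ψ : ι → ℂ := (-(a ⬝ᵥ evalVec q s)) • evalVec p s + (a ⬝ᵥ evalVec p s) • evalVec q s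
  obtain ⟨b, hbL, hb⟩ := exists_dotProduct_ne_zero L
    (W := insert ψ {w | w ∈ evalVec p '' Z₁ ∪ evalVec q '' Z₁ ∧ ∃ x ∈ L, x ⬝ᵥ w ≠ 0})
    ((((hZ₁.image _).union (hZ₁.image _)).subset fun w hw => hw.1).insert _) (by
      rintro w (rfl | hw)
      · exact hs _ _ (Or.inr has)
      · exact hw.2)
  have hbψ := hb _ (Set.mem_insert _ _)
  have hbZ : ∀ t ∈ Z₁, b ∉ perp (evalVec p t) (evalVec q t) := by
    intro t ht hbt
    obtain ⟨x, hxL, hx⟩ := hZ t ht.1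
    by_cases h1 : x ⬝ᵥ evalVec p t = 0
    · have h2 : x ⬝ᵥ evalVec q t ≠ 0 := fun h2 => hx ⟨h1, h2⟩
      exact hb _ (Set.mem_insert_of_mem _ ⟨Or.inr ⟨t, ht, rfl⟩, x, hxL, h2⟩) hbt.2
    · exact hb _ (Set.mem_insert_of_mem _ ⟨Or.inl ⟨t, ht, rfl⟩, x, hxL, h1⟩) hbt.1
  -- If some `a + x b` is orthogonal to `p(t)` and `q(t)`, this determinant vanishes at `t`. Hence
  -- only finitely many `t` matter.
  let h : ℂ[X] := dotPoly p a * dotPoly q b - dotPoly q a * dotPoly p b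
  have hh : ∀ t, h.eval t = (a ⬝ᵥ evalVec p t) * (b ⬝ᵥ evalVec q t) -
      (a ⬝ᵥ evalVec q t) * (b ⬝ᵥ evalVec p t) := by
    intro t; simp [h, eval_dotPoly]
  have hh0 : h ≠ 0 := by
    intro h0
    apply hbψ
    have := hh s
    rw [h0, Polynomial.eval_zero] at this
    simp only [ψ, dotProduct_add, dotProduct_smul, smul_eq_mul]
    linear_combination -this
  have hfin : ((⋃ w ∈ Ω, {x : ℂ | a ⬝ᵥ w + x * (b ⬝ᵥ w) = 0}) ∪ ⋃ t ∈ {t | h.eval t = 0},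
      {x : ℂ | t ∈ Z ∧ a + x • b ∈ perp (evalVec p t) (evalVec q t)}).Finite := by
    refine Set.Finite.union (hΩ.biUnion fun w hw => finite_setOf_add_mul_eq_zero
      (Or.inl (haΩ w hw))) ((Polynomial.finite_setOf_eval_eq_zero hh0).biUnion fun t _ => ?_)
    -- Two values of `x` would put both `a` and `b` into the space of `t`, but `b` avoids the spaces
    -- of `Z₁`.
    refine Set.Subsingleton.finite ?_
    rintro x ⟨ht, hx⟩ y ⟨-, hy⟩
    by_contra hxy
    have h1 : (x - y) • b ∈ perp (evalVec p t) (evalVec q t) := by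
      have := sub_mem hx hy
      rwa [add_sub_add_left_eq_sub, ← sub_smul] at this
    have h2 : b ∈ perp (evalVec p t) (evalVec q t) :=
      (Submodule.smul_mem_iff _ (sub_ne_zero.2 hxy)).1 h1
    refine hbZ t ⟨ht, ?_⟩ h2
    have := sub_mem hx (Submodule.smul_mem _ x h2)
    rwa [add_sub_cancel_right] at this
  obtain ⟨x, hx⟩ := hfin.exists_notMem
  simp only [Set.mem_union, Set.mem_iUnion, not_or, not_exists] at hx
  refine ⟨a + x • b, add_mem haL (Submodule.smul_mem _ _ hbL), fun w hw h0 => ?_,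
    fun t ht h0 => ?_⟩
  · refine hx.1 w hw ?_
    rw [add_dotProduct, smul_dotProduct, smul_eq_mul] at h0
    exact h0
  · refine hx.2 t ?_ ⟨ht, h0⟩
    obtain ⟨h1, h2⟩ := mem_perp.1 h0
    rw [add_dotProduct, smul_dotProduct, smul_eq_mul] at h1 h2
    change h.eval t = 0
    rw [hh]
    linear_combination (b ⬝ᵥ evalVec q t) * h1 - (b ⬝ᵥ evalVec p t) * h2

namespace IsRuling

variable {d : ℕ} {p q : Fin d → ℂ[X]} {m n : ℕ}

theorem wedge_ne (h : IsRuling p q m n) (t : ℂ) : wedge (evalVec p t) (evalVec q t) ≠ 0 := by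
  rw [← evalVec_wedge]; exact h.curve.evalVec_ne t

theorem coeffVec_wedge (h : IsRuling p q m n) :
    coeffVec (wedge p q) (m + n) = wedge (coeffVec p m) (coeffVec q n) :=
  _root_.coeffVec_wedge h.natDegree_left h.natDegree_right

theorem wedge_top_ne (h : IsRuling p q m n) : wedge (coeffVec p m) (coeffVec q n) ≠ 0 := by
  rw [← h.coeffVec_wedge]; exact h.curve.coeffVec_ne

theorem perp_le (h : IsRuling p q m n) {s t : ℂ}
    (hst : Par (evalVec (wedge p q) s) (evalVec (wedge p q) t)) :
    perp (evalVec p s) (evalVec q s) ≤ perp (evalVec p t) (evalVec q t) := by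
  rw [evalVec_wedge, evalVec_wedge] at hst
  exact perp_le_of_par hst (h.wedge_ne s) (h.wedge_ne t)

theorem exists_notMem_perp (h : IsRuling p q m n) {s t : ℂ}
    (hst : ¬ Par (evalVec (wedge p q) s) (evalVec (wedge p q) t)) :
    ∃ x ∈ perp (evalVec p t) (evalVec q t), x ∉ perp (evalVec p s) (evalVec q s) := by
  rw [evalVec_wedge, evalVec_wedge] at hst
  exact exists_mem_perp_notMem_perp (h.wedge_ne t) hst

/-- If a vector lies in the span of `p(t)` and `q(t)` for almost all `t`, it is orthogonal to all
the spaces of the family. -/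
theorem dotProduct_eq_zero_of_mem_span (h : IsRuling p q m n) {T : Set ℂ} (hT : T.Finite)
    {a : Fin d → ℂ} (ha : ∀ t ∉ T, ∃ α β : ℂ, a = α • evalVec p t + β • evalVec q t) :
    (∀ t, ∀ x ∈ perp (evalVec p t) (evalVec q t), x ⬝ᵥ a = 0) ∧
      ∀ x ∈ perp (coeffVec p m) (coeffVec q n), x ⬝ᵥ a = 0 := by
  -- As polynomials in `t` the 3-minors of `a`, `p`, `q` have infinitely many roots, so they also
  -- vanish at the excluded parameters and at infinity.
  have hpoly : ∀ i j l, Polynomial.C (a i) * (p j * q l - p l * q j) -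
      Polynomial.C (a j) * (p i * q l - p l * q i) +
      Polynomial.C (a l) * (p i * q j - p j * q i) = 0 := by
    intro i j l
    refine Polynomial.eq_zero_of_infinite_isRoot _ (hT.infinite_compl.mono fun t ht => ?_)
    obtain ⟨α, β, hab⟩ := ha t ht
    simp only [Set.mem_ofPred_eq, Polynomial.IsRoot, Polynomial.eval_add, Polynomial.eval_sub,
      Polynomial.eval_mul, Polynomial.eval_C, hab, Pi.add_apply, Pi.smul_apply, smul_eq_mul,
      evalVec]
    ring
  constructor
  · intro t x hx
    refine dotProduct_eq_zero_of_triple_minor (h.wedge_ne t) (fun i j l => ?_) hx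
    simpa [evalVec] using congrArg (Polynomial.eval t) (hpoly i j l)
  · intro x hx
    refine dotProduct_eq_zero_of_triple_minor h.wedge_top_ne (fun i j l => ?_) hx
    have h1 := congrArg (fun r => Polynomial.coeff r (m + n)) (hpoly i j l)
    have h2 : ∀ i j, (p i * q j).coeff (m + n) = (p i).coeff m * (q j).coeff n := fun i j =>
      Polynomial.coeff_mul_add_eq_of_natDegree_le (h.natDegree_left i) (h.natDegree_right j)
    simpa only [Polynomial.coeff_add, Polynomial.coeff_sub, Polynomial.coeff_C_mul, h2,
      Polynomial.coeff_zero, coeffVec] using h1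

/-- If the spans of `(p(t), q(t))` meet pairwise but have no common point, then the intersection
of two orthogonal spaces lies in all of them. -/
theorem perp_inf_perp_le (h : IsRuling p q m n) {T : Set ℂ} (hT : T.Finite) {t r : ℂ}
    (ht : t ∉ T) (htr : ¬ Par (evalVec (wedge p q) r) (evalVec (wedge p q) t))
    (hmeet : ∀ t ∉ T, ∀ s, ∃ u ≠ 0, (∃ α β : ℂ, u = α • evalVec p s + β • evalVec q s) ∧
      ∃ α β : ℂ, u = α • evalVec p t + β • evalVec q t)
    (hnot : ∀ a ≠ 0, ∀ T : Set ℂ, T.Finite →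
      ∃ t ∉ T, ¬ ∃ α β : ℂ, a = α • evalVec p t + β • evalVec q t) :
    ∀ s, perp (evalVec p t) (evalVec q t) ⊓ perp (evalVec p r) (evalVec q r) ≤
      perp (evalVec p s) (evalVec q s) := by
  -- In the dual projective space, `a` is the only common point of the lines of `r` and `t`.
  obtain ⟨a, ha0, ⟨α₁, β₁, har⟩, ⟨α₂, β₂, hat⟩⟩ := hmeet t ht r
  have honly : ∀ b, (∃ α β : ℂ, b = α • evalVec p r + β • evalVec q r) →
      (∃ α β : ℂ, b = α • evalVec p t + β • evalVec q t) → Par b a := by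
    rintro b ⟨α, β, hbr⟩ ⟨γ, δ, hbt⟩
    by_contra hab
    obtain ⟨x, hxt, hxr⟩ := h.exists_notMem_perp htr
    refine hxr (mem_perp_of_dotProduct hbr har hab ?_ ?_)
    · rw [hbt, dotProduct_add, dotProduct_smul, dotProduct_smul, hxt.1, hxt.2]; simp
    · rw [hat, dotProduct_add, dotProduct_smul, dotProduct_smul, hxt.1, hxt.2]; simp
  obtain ⟨r₂, hr₂T, hr₂⟩ := hnot a ha0 T hT
  rintro s x ⟨hxt, hxr⟩
  -- A line that avoids `a` meets the lines of `t` and `r` in two different points, so it lies in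
  -- the plane they span; `x` is orthogonal to that plane.
  have hcof : ∀ s ∉ T, (¬ ∃ α β : ℂ, a = α • evalVec p s + β • evalVec q s) →
      x ∈ perp (evalVec p s) (evalVec q s) := by
    intro s hs has
    obtain ⟨b, hb0, ⟨α, β, hbt⟩, ⟨γ, δ, hbs⟩⟩ := hmeet s hs t
    obtain ⟨c, hc0, ⟨α', β', hcr⟩, ⟨γ', δ', hcs⟩⟩ := hmeet s hs r
    refine mem_perp_of_dotProduct hbs hcs (fun hbc => has ?_) ?_ ?_
    · obtain ⟨z, hz⟩ := hbc.exists_smul hc0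
      have hba : Par b a := honly b ⟨z * α', z * β', by rw [hz, hcr]; module⟩ ⟨α, β, hbt⟩
      obtain ⟨y, hy⟩ := hba.symm.exists_smul hb0
      exact ⟨y * γ, y * δ, by rw [hy, hbs]; module⟩
    · rw [hbt, dotProduct_add, dotProduct_smul, dotProduct_smul, hxt.1, hxt.2]; simp
    · rw [hcr, dotProduct_add, dotProduct_smul, dotProduct_smul, hxr.1, hxr.2]; simp
  -- The relation holds for infinitely many `s`, hence identically.
  have hinf : {s | s ∉ T ∧ ¬ ∃ α β : ℂ, a = α • evalVec p s + β • evalVec q s}.Infinite := by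
    intro hfin
    obtain ⟨s, hs, h1⟩ := hnot a ha0 _ (hT.union hfin)
    exact hs (Or.inr ⟨fun h2 => hs (Or.inl h2), h1⟩)
  have hp0 : dotPoly p x = 0 := Polynomial.eq_zero_of_infinite_isRoot _ (hinf.mono fun s hs => by
    change (dotPoly p x).eval s = 0
    rw [eval_dotPoly]; exact (hcof s hs.1 hs.2).1)
  have hq0 : dotPoly q x = 0 := Polynomial.eq_zero_of_infinite_isRoot _ (hinf.mono fun s hs => by
    change (dotPoly q x).eval s = 0
    rw [eval_dotPoly]; exact (hcof s hs.1 hs.2).2)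
  rw [mem_perp, ← eval_dotPoly, ← eval_dotPoly, hp0, hq0]
  simp

/-- If the spaces of the family do not all lie in a hyperplane, some point of some space is in no
essentially different space, and is a simple point there. -/
theorem exists_point (h : IsRuling p q m n) {T : Set ℂ} (hT : T.Finite)
    (hTtop : ∀ t ∉ T, ¬ Par (coeffVec (wedge p q) (m + n)) (evalVec (wedge p q) t))
    (hTsat : ∀ t ∉ T, ∀ s, Par (evalVec (wedge p q) s) (evalVec (wedge p q) t) → s ∉ T)
    (hTram : ∀ t ∉ T, ¬ Par (evalVec (derivVec (wedge p q)) t) (evalVec (wedge p q) t))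
    (hnot : ¬ ∃ a ≠ 0, (∀ t, ∀ x ∈ perp (evalVec p t) (evalVec q t), x ⬝ᵥ a = 0) ∧
      ∀ x ∈ perp (coeffVec p m) (coeffVec q n), x ⬝ᵥ a = 0) :
    ∃ t₀ ∉ T, ∃ x ∈ perp (evalVec p t₀) (evalVec q t₀), x ∉ perp (coeffVec p m) (coeffVec q n) ∧
      (∀ s, Par (evalVec (wedge p q) s) (evalVec (wedge p q) t₀) →
        x ∉ perp (evalVec (derivVec p) s) (evalVec (derivVec q) s)) ∧
      ∀ s, x ∈ perp (evalVec p s) (evalVec q s) →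
        Par (evalVec (wedge p q) s) (evalVec (wedge p q) t₀) := by
  -- Otherwise `p'` and `q'` lie in the span of `p` and `q` at `t`, so the derivative of the minors
  -- is a multiple of the minors and `t` is ramified.
  have hderiv : ∀ t ∉ T, ∃ x ∈ perp (evalVec p t) (evalVec q t),
      x ∉ perp (evalVec (derivVec p) t) (evalVec (derivVec q) t) := by
    intro t ht
    by_contra! h1
    obtain ⟨α, β, h2⟩ := exists_eq_add_smul_of_perp (h.wedge_ne t) fun x hx => (h1 x hx).1
    obtain ⟨γ, δ, h3⟩ := exists_eq_add_smul_of_perp (h.wedge_ne t) fun x hx => (h1 x hx).2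
    refine hTram t ht (Par.of_smul (x := α + δ) ?_)
    rw [evalVec_derivVec_wedge, evalVec_wedge, h2, h3]
    ext a
    simp only [wedge, Pi.add_apply, Pi.smul_apply, smul_eq_mul]
    ring
  have htop : ∀ t ∉ T, ∃ x ∈ perp (evalVec p t) (evalVec q t),
      x ∉ perp (coeffVec p m) (coeffVec q n) := by
    intro t ht
    refine exists_mem_perp_notMem_perp (h.wedge_ne t) ?_
    rw [← evalVec_wedge, ← h.coeffVec_wedge]
    exact hTtop t ht
  -- Finitely many linear forms, none zero on the space of `t`. A point where none vanishes avoids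
  -- the space at infinity and is a simple point at each parameter of the fibre.
  let Ω : ℂ → Set (Fin d → ℂ) := fun t =>
    {w | w ∈ ({coeffVec p m, coeffVec q n} : Set (Fin d → ℂ)) ∪
      evalVec (derivVec p) '' {s | Par (evalVec (wedge p q) s) (evalVec (wedge p q) t)} ∪
      evalVec (derivVec q) '' {s | Par (evalVec (wedge p q) s) (evalVec (wedge p q) t)} ∧
      ∃ x ∈ perp (evalVec p t) (evalVec q t), x ⬝ᵥ w ≠ 0}
  have hΩfin : ∀ t, (Ω t).Finite := fun t => by
    have hf := h.curve.finite_fiber (h.curve.evalVec_ne t)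
    exact (((Set.toFinite _).union (hf.image _)).union (hf.image _)).subset fun w hw => hw.1
  have hΩ : ∀ t ∉ T, ∀ x, (∀ w ∈ Ω t, x ⬝ᵥ w ≠ 0) → x ∉ perp (coeffVec p m) (coeffVec q n) ∧
      ∀ s, Par (evalVec (wedge p q) s) (evalVec (wedge p q) t) →
        x ∉ perp (evalVec (derivVec p) s) (evalVec (derivVec q) s) := by
    intro t ht x hx
    constructor
    · intro hxtop
      obtain ⟨y, hy, hytop⟩ := htop t ht
      by_cases h1 : y ⬝ᵥ coeffVec p m = 0
      · exact hx _ ⟨Or.inl (Or.inl (Or.inr rfl)), y, hy, fun h2 => hytop ⟨h1, h2⟩⟩ hxtop.2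
      · exact hx _ ⟨Or.inl (Or.inl (Or.inl rfl)), y, hy, h1⟩ hxtop.1
    · intro s hs hxs
      obtain ⟨y, hy, hys⟩ := hderiv s (hTsat t ht s hs)
      have hy' := h.perp_le hs hy
      by_cases h1 : y ⬝ᵥ evalVec (derivVec p) s = 0
      · exact hx _ ⟨Or.inr ⟨s, hs, rfl⟩, y, hy', fun h2 => hys ⟨h1, h2⟩⟩ hxs.2
      · exact hx _ ⟨Or.inl (Or.inr ⟨s, hs, rfl⟩), y, hy', h1⟩ hxs.1
  -- Whether some two of the dual lines are disjoint. If so, `p(s)` and `q(s)` stay independent on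
  -- the space of `t`, and a general point there avoids all other spaces.
  by_cases hI : ∃ t ∉ T, ∃ s, ∀ u, (∃ α β : ℂ, u = α • evalVec p s + β • evalVec q s) →
      (∃ α β : ℂ, u = α • evalVec p t + β • evalVec q t) → u = 0
  · obtain ⟨t, ht, s, hts⟩ := hI
    obtain ⟨x, hxL, hxΩ, hxZ⟩ := exists_mem_forall_notMem_perp p q
      (perp (evalVec p t) (evalVec q t))
      {s | ¬ Par (evalVec (wedge p q) s) (evalVec (wedge p q) t)} s (by
        intro α β hαβ
        refine exists_mem_perp_of_not_span (h.wedge_ne t) fun hu => ?_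
        have h0 := hts _ ⟨α, β, rfl⟩ hu
        have h1 := eq_zero_of_add_smul_eq_zero (h.wedge_ne s) (α := α) (β := β)
          fun j => congrFun h0 j
        rcases hαβ with h2 | h2
        exacts [h2 h1.1, h2 h1.2]) (fun r hr => h.exists_notMem_perp hr) (hΩfin t)
        (fun w hw => hw.2)
    obtain ⟨h1, h2⟩ := hΩ t ht x hxΩ
    refine ⟨t, ht, x, hxL, h1, h2, fun s hs => ?_⟩
    by_contra hst
    exact hxZ s hst hs
  · push Not at hI
    have hmeet : ∀ t ∉ T, ∀ s, ∃ u ≠ 0, (∃ α β : ℂ, u = α • evalVec p s + β • evalVec q s) ∧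
        ∃ α β : ℂ, u = α • evalVec p t + β • evalVec q t := by
      intro t ht s
      obtain ⟨u, h1, h2, h3⟩ := hI t ht s
      exact ⟨u, h3, h1, h2⟩
    have hnot' : ∀ a ≠ 0, ∀ T : Set ℂ, T.Finite →
        ∃ t ∉ T, ¬ ∃ α β : ℂ, a = α • evalVec p t + β • evalVec q t := by
      intro a ha T' hT'
      by_contra h1
      push Not at h1
      exact hnot ⟨a, ha, h.dotProduct_eq_zero_of_mem_span hT' h1⟩
    obtain ⟨t, ht⟩ := hT.exists_notMem
    obtain ⟨r, hr⟩ := (h.curve.finite_fiber (h.curve.evalVec_ne t)).exists_notMem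
    have htr : ¬ Par (evalVec (wedge p q) r) (evalVec (wedge p q) t) := hr
    -- All spaces contain the intersection of those of `t` and `r`, which has codimension one in the
    -- space of `t`. If `x` outside it also lies in the space of `s`, that space contains the whole
    -- space of `t`.
    have hinf := h.perp_inf_perp_le hT ht htr hmeet hnot'
    obtain ⟨y, hyt, hyr⟩ := h.exists_notMem_perp htr
    obtain ⟨w, hw, hw0⟩ : ∃ w, (w = evalVec p r ∨ w = evalVec q r) ∧ y ⬝ᵥ w ≠ 0 := by
      by_contra! h1
      exact hyr ⟨h1 _ (Or.inl rfl), h1 _ (Or.inr rfl)⟩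
    obtain ⟨x, hxL, hx⟩ := exists_dotProduct_ne_zero (perp (evalVec p t) (evalVec q t))
      ((hΩfin t).insert w) (by
        rintro w' (rfl | hw')
        exacts [⟨y, hyt, hw0⟩, hw'.2])
    have hxr : x ∉ perp (evalVec p r) (evalVec q r) := by
      intro h1
      refine hx w (Set.mem_insert _ _) ?_
      rcases hw with rfl | rfl
      exacts [h1.1, h1.2]
    obtain ⟨h1, h2⟩ := hΩ t ht x fun w' hw' => hx w' (Set.mem_insert_of_mem _ hw')
    refine ⟨t, ht, x, hxL, h1, h2, fun s hs => ?_⟩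
    by_contra hst
    obtain ⟨z, hzt, hzs⟩ := h.exists_notMem_perp hst
    obtain ⟨u, hu0, ⟨α, β, hur⟩, ⟨γ, δ, hut⟩⟩ := hmeet t ht r
    have hαβ : α ≠ 0 ∨ β ≠ 0 := by
      by_contra! h3
      apply hu0
      rw [hur, h3.1, h3.2]; simp
    have hrel : ∀ x ∈ perp (evalVec p t) (evalVec q t),
        α * (x ⬝ᵥ evalVec p r) + β * (x ⬝ᵥ evalVec q r) = 0 := by
      intro x hx
      have h3 : x ⬝ᵥ u = 0 := by
        rw [hut, dotProduct_add, dotProduct_smul, dotProduct_smul, hx.1, hx.2]; simp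
      rw [hur, dotProduct_add, dotProduct_smul, dotProduct_smul] at h3
      exact h3
    -- On the space of `t` the forms `p(r)` and `q(r)` are dependent by `hrel` and not both zero at
    -- `x`, so subtracting a multiple of `x` kills both at once.
    obtain ⟨c, hc⟩ : ∃ c : ℂ, z - c • x ∈ perp (evalVec p r) (evalVec q r) := by
      have hrx := hrel x hxL
      have hrz := hrel z hzt
      have hdet : (x ⬝ᵥ evalVec p r) * (z ⬝ᵥ evalVec q r) =
          (x ⬝ᵥ evalVec q r) * (z ⬝ᵥ evalVec p r) := by
        rcases hαβ with h3 | h3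
        · apply mul_left_cancel₀ h3
          linear_combination (z ⬝ᵥ evalVec q r) * hrx - (x ⬝ᵥ evalVec q r) * hrz
        · apply mul_left_cancel₀ h3
          linear_combination (x ⬝ᵥ evalVec p r) * hrz - (z ⬝ᵥ evalVec p r) * hrx
      by_cases h3 : x ⬝ᵥ evalVec p r = 0
      · have h4 : x ⬝ᵥ evalVec q r ≠ 0 := fun h4 => hxr ⟨h3, h4⟩
        refine ⟨(z ⬝ᵥ evalVec q r) / (x ⬝ᵥ evalVec q r), ?_, ?_⟩
        · change (_ - _) ⬝ᵥ _ = 0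
          rw [sub_dotProduct, smul_dotProduct, smul_eq_mul]
          field_simp
          linear_combination -hdet
        · change (_ - _) ⬝ᵥ _ = 0
          rw [sub_dotProduct, smul_dotProduct, smul_eq_mul]
          field_simp
          ring
      · refine ⟨(z ⬝ᵥ evalVec p r) / (x ⬝ᵥ evalVec p r), ?_, ?_⟩
        · change (_ - _) ⬝ᵥ _ = 0
          rw [sub_dotProduct, smul_dotProduct, smul_eq_mul]
          field_simp
          ring
        · change (_ - _) ⬝ᵥ _ = 0
          rw [sub_dotProduct, smul_dotProduct, smul_eq_mul]
          field_simp
          linear_combination hdet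
    have h3 := hinf s ⟨sub_mem hzt (Submodule.smul_mem _ c hxL), hc⟩
    have h4 := add_mem h3 (Submodule.smul_mem _ c hs)
    rw [sub_add_cancel] at h4
    exact hzs h4

end IsRuling

/-! ### Restriction of a form to a line -/

theorem Polynomial.coeff_prod_sum_of_natDegree_le {ι R : Type*} [CommRing R] {s : Finset ι}
    {f : ι → R[X]} {n : ι → ℕ} (h : ∀ i ∈ s, (f i).natDegree ≤ n i) :
    (∏ i ∈ s, f i).coeff (∑ i ∈ s, n i) = ∏ i ∈ s, (f i).coeff (n i) := by
  classical
  induction s using Finset.induction_on with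
  | empty => simp
  | insert i s hi ih =>
    have h' : ∀ j ∈ s, (f j).natDegree ≤ n j := fun j hj => h j (Finset.mem_insert_of_mem hj)
    rw [Finset.prod_insert hi, Finset.sum_insert hi, Finset.prod_insert hi,
      Polynomial.coeff_mul_add_eq_of_natDegree_le (h i (Finset.mem_insert_self _ _))
        ((Polynomial.natDegree_prod_le _ _).trans (Finset.sum_le_sum h')), ih h']

/-- The restriction of `F` to the line through `a` in the direction `b`. -/
noncomputable def linePoly {ι K R : Type*} [CommRing K] [CommRing R] [Algebra K R] (a b : ι → R)
    (F : MvPolynomial ι K) : R[X] :=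
  MvPolynomial.aeval (fun i => Polynomial.C (a i) + Polynomial.X * Polynomial.C (b i)) F

section linePoly

variable {ι K R S : Type*} [CommRing K] [CommRing R] [Algebra K R] [CommRing S] [Algebra K S]
  (a b : ι → R) (F : MvPolynomial ι K)

theorem aeval_linePoly [Algebra R S] [IsScalarTower K R S] (s : S) :
    Polynomial.aeval s (linePoly a b F) =
      MvPolynomial.aeval (fun i => algebraMap R S (a i) + s * algebraMap R S (b i)) F := by
  have : Polynomial.aeval s (linePoly a b F) =
      ((Polynomial.aeval s : R[X] →ₐ[R] S).restrictScalars K) (linePoly a b F) := rfl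
  rw [this, linePoly, ← AlgHom.comp_apply, MvPolynomial.comp_aeval]
  congr 2
  funext i
  simp only [AlgHom.restrictScalars_apply, map_add, map_mul, Polynomial.aeval_C, Polynomial.aeval_X]

theorem eval_linePoly (s : R) : (linePoly a b F).eval s = MvPolynomial.aeval (a + s • b) F := by
  have := aeval_linePoly (S := R) a b F s
  rw [Polynomial.coe_aeval_eq_eval] at this
  exact this

theorem map_linePoly (ρ : R →ₐ[K] S) :
    (linePoly a b F).map ρ.toRingHom = linePoly (ρ ∘ a) (ρ ∘ b) F := by
  have h : (linePoly a b F).map ρ.toRingHom = Polynomial.mapAlgHom ρ (linePoly a b F) := rfl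
  rw [h, linePoly, ← AlgHom.comp_apply, MvPolynomial.comp_aeval]
  simp [linePoly]

/-- The coefficient of formal degree `e` is the value at the point at infinity of the line. Where it
is an invertible constant, the restricted form becomes monic after scaling. -/
theorem natDegree_linePoly_le_and_coeff {e : ℕ} (hF : F.IsHomogeneous e) :
    (linePoly a b F).natDegree ≤ e ∧ (linePoly a b F).coeff e = MvPolynomial.aeval b F := by
  have key : ∀ m ∈ F.support, (m.prod fun i k => (Polynomial.C (a i) + Polynomial.X *
      Polynomial.C (b i)) ^ k).natDegree ≤ e ∧ (m.prod fun i k => (Polynomial.C (a i) +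
        Polynomial.X * Polynomial.C (b i)) ^ k).coeff e = m.prod fun i k => b i ^ k := by
    intro m hm
    have hdeg := hF.degree_eq hm
    rw [Finsupp.degree_apply] at hdeg
    have h1 : ∀ i, (Polynomial.C (a i) + Polynomial.X * Polynomial.C (b i)).natDegree ≤ 1 :=
      fun i => by compute_degree
    have h2 : ∀ i ∈ m.support,
        ((Polynomial.C (a i) + Polynomial.X * Polynomial.C (b i)) ^ m i).natDegree ≤ m i :=
      fun i _ => by simpa using Polynomial.natDegree_pow_le_of_le (m i) (h1 i)
    constructor
    · rw [← hdeg]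
      exact (Polynomial.natDegree_prod_le _ _).trans (Finset.sum_le_sum h2)
    · rw [← hdeg, Finsupp.prod, Polynomial.coeff_prod_sum_of_natDegree_le h2]
      refine Finset.prod_congr rfl fun i _ => ?_
      have := Polynomial.coeff_pow_of_natDegree_le (m := m i) (h1 i)
      rw [mul_one] at this
      rw [this]
      simp
  have hsum : linePoly a b F = ∑ m ∈ F.support, Polynomial.C (algebraMap K R (F.coeff m)) *
      m.prod fun i k => (Polynomial.C (a i) + Polynomial.X * Polynomial.C (b i)) ^ k := by
    conv_lhs => rw [linePoly, F.as_sum]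
    simp only [map_sum, MvPolynomial.aeval_monomial]
    rfl
  constructor
  · rw [hsum]
    exact Polynomial.natDegree_sum_le_of_forall_le _ _ fun m hm =>
      (Polynomial.natDegree_C_mul_le _ _).trans (key m hm).1
  · conv_rhs => rw [F.as_sum]
    rw [hsum, Polynomial.finsetSum_coeff, map_sum]
    refine Finset.sum_congr rfl fun m hm => ?_
    rw [Polynomial.coeff_C_mul, (key m hm).2, MvPolynomial.aeval_monomial]

end linePoly

/-- If `F₀` is a prime factor of a form `F`, if `F` does not vanish at `y`, and if `F₀` does not
divide `Q`, then a general line through `y` contains no common zero of `F₀` and `Q`. -/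
theorem exists_line_through_avoiding {ι : Type*} [Fintype ι] {F F₀ Q : MvPolynomial ι ℂ} {e : ℕ}
    (hF : F.IsHomogeneous e) (hF₀ : Prime F₀) (hdvd : F₀ ∣ F) (hQ : ¬ F₀ ∣ Q) {y : ι → ℂ}
    (hy : y ≠ 0) (hFy : MvPolynomial.eval y F ≠ 0) :
    ∃ r : MvPolynomial ι ℂ, r ≠ 0 ∧ ∀ x, MvPolynomial.eval x r ≠ 0 → ∀ z : ℂ,
      MvPolynomial.eval (x + z • y) F₀ = 0 → MvPolynomial.eval (x + z • y) Q ≠ 0 := by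
  classical
  obtain ⟨c, hc⟩ : ∃ c : ι → ℂ, c ⬝ᵥ y = 1 := by
    obtain ⟨c, hc⟩ := exists_single_dotProduct_ne_zero hy
    exact ⟨(c ⬝ᵥ y)⁻¹ • c, by rw [smul_dotProduct, smul_eq_mul, inv_mul_cancel₀ hc]⟩
  -- `ρ` is pullback along the projection from `y` onto the hyperplane `c · x = 0`, with `ℓ` as the
  -- coordinate along the direction `y`.
  let ℓ : MvPolynomial ι ℂ := ∑ i, MvPolynomial.C (c i) * MvPolynomial.X i
  let ρ : MvPolynomial ι ℂ →ₐ[ℂ] MvPolynomial ι ℂ :=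
    MvPolynomial.aeval fun i => MvPolynomial.X i - ℓ * MvPolynomial.C (y i)
  let I : Ideal (MvPolynomial ι ℂ) := Ideal.span {F₀}
  have hI : I.IsPrime := (Ideal.span_singleton_prime hF₀.ne_zero).2 hF₀
  let π : MvPolynomial ι ℂ →ₐ[ℂ] MvPolynomial ι ℂ ⧸ I := Ideal.Quotient.mkₐ ℂ I
  have hπ : ∀ g, π g = 0 ↔ F₀ ∣ g := fun g => by
    rw [← Ideal.mem_span_singleton]; exact Ideal.Quotient.eq_zero_iff_mem
  let A : Subalgebra ℂ (MvPolynomial ι ℂ ⧸ I) := (π.comp ρ).range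
  have hX : ∀ i, π (MvPolynomial.X i) = π (ρ (MvPolynomial.X i)) +
      π ℓ * algebraMap ℂ _ (y i) := by
    intro i
    simp only [ρ, MvPolynomial.aeval_X, map_sub, map_mul]
    have : π (MvPolynomial.C (y i)) = algebraMap ℂ _ (y i) := π.commutes _
    rw [this]; ring
  -- `F` vanishes modulo `F₀`, and as a polynomial in `ℓ` over the projected coordinates it has
  -- leading coefficient `F(y) ≠ 0`. So the coordinate ring of `F₀ = 0` is integral over the image
  -- `A` of the projection.
  have hℓ : IsIntegral A (π ℓ) := by
    let a : ι → A := fun i => ⟨π (ρ (MvPolynomial.X i)), ⟨MvPolynomial.X i, rfl⟩⟩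
    let b : ι → A := fun i => algebraMap ℂ A (y i)
    obtain ⟨h1, h2⟩ := natDegree_linePoly_le_and_coeff a b F hF
    have h3 : MvPolynomial.aeval b F = algebraMap ℂ A (MvPolynomial.eval y F) :=
      (MvPolynomial.aeval_algebraMap_apply A y F).trans (by simp [MvPolynomial.aeval_eq_eval])
    refine ⟨Polynomial.C (algebraMap ℂ A (MvPolynomial.eval y F)⁻¹) * linePoly a b F, ?_, ?_⟩
    · refine Polynomial.monic_of_natDegree_le_of_coeff_eq_one e
        ((Polynomial.natDegree_C_mul_le _ _).trans h1) ?_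
      rw [Polynomial.coeff_C_mul, h2, h3, ← map_mul, inv_mul_cancel₀ hFy, map_one]
    · rw [← Polynomial.aeval_def, map_mul, aeval_linePoly]
      have h4 : MvPolynomial.aeval (fun i => algebraMap A (MvPolynomial ι ℂ ⧸ I) (a i) +
          π ℓ * algebraMap A (MvPolynomial ι ℂ ⧸ I) (b i)) F = π F := by
        have : (fun i => algebraMap A (MvPolynomial ι ℂ ⧸ I) (a i) +
          π ℓ * algebraMap A (MvPolynomial ι ℂ ⧸ I) (b i)) = fun i => π (MvPolynomial.X i) :=
          funext fun i => (hX i).symm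
        rw [this, ← MvPolynomial.comp_aeval_apply, MvPolynomial.aeval_X_left_apply]
      rw [h4, (hπ F).2 hdvd, mul_zero]
  have hint : ∀ g, IsIntegral A (π g) := by
    intro g
    induction g using MvPolynomial.induction_on with
    | C z =>
      have h1 : π (MvPolynomial.C z) = algebraMap A _ (algebraMap ℂ A z) := π.commutes z
      rw [h1]
      exact isIntegral_algebraMap
    | add f g hf hg => rw [map_add]; exact hf.add hg
    | mul_X f i hf =>
      rw [map_mul, hX]
      refine hf.mul (IsIntegral.add ?_ (hℓ.mul ?_))
      · exact isIntegral_algebraMap (R := A) (x := ⟨_, ⟨MvPolynomial.X i, rfl⟩⟩)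
      · exact isIntegral_algebraMap (R := A) (x := algebraMap ℂ A (y i))
  -- A nonzero integral element of a domain has a nonzero multiple in the base ring. This gives a
  -- function of the projection alone, nonzero modulo `F₀`, that vanishes on the common zeros of
  -- `F₀` and `Q`.
  have hne := Ideal.comap_ne_bot_of_integral_mem (R := A) (I := Ideal.span {π Q})
    (fun h => hQ ((hπ Q).1 h)) (Ideal.mem_span_singleton_self _) (hint Q)
  obtain ⟨⟨_, r, rfl⟩, hr, hr0⟩ := (Submodule.ne_bot_iff _).1 hne
  have hr1 : π Q ∣ π (ρ r) := Ideal.mem_span_singleton.1 (Ideal.mem_comap.1 hr)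
  have hr2 : π (ρ r) ≠ 0 := fun h => hr0 (Subtype.ext h)
  obtain ⟨g', hg⟩ := hr1
  obtain ⟨g, rfl⟩ := Ideal.Quotient.mk_surjective g'
  have hg : F₀ ∣ ρ r - Q * g := by
    rw [← hπ, map_sub, map_mul, hg]; exact sub_self _
  obtain ⟨h, hh⟩ := hg
  have heval : ∀ x, MvPolynomial.eval x (ρ r) = MvPolynomial.eval (x - (c ⬝ᵥ x) • y) r := by
    intro x
    have h1 : MvPolynomial.eval x (ρ r) = MvPolynomial.aeval x (ρ r) := by
      rw [MvPolynomial.aeval_eq_eval]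
    have h2 : MvPolynomial.eval (x - (c ⬝ᵥ x) • y) r =
        MvPolynomial.aeval (x - (c ⬝ᵥ x) • y) r := by
      rw [MvPolynomial.aeval_eq_eval]
    rw [h1, h2, ← AlgHom.comp_apply, MvPolynomial.comp_aeval]
    congr 2
    ext i
    simp [MvPolynomial.aeval_eq_eval, ℓ, dotProduct]
  refine ⟨ρ r, fun h => hr2 (by rw [h, map_zero]), fun x hx z h0 hz => hx ?_⟩
  -- A function of the projection is constant along lines in the direction `y`.
  have hinv : MvPolynomial.eval (x + z • y) (ρ r) = MvPolynomial.eval x (ρ r) := by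
    rw [heval, heval]
    congr 2
    rw [dotProduct_add, dotProduct_smul, hc]
    module
  rw [← hinv, sub_eq_iff_eq_add.1 hh, map_add, map_mul, map_mul, h0, hz]
  ring

/-! ### Linear forms with polynomial coefficients -/

/-- The polynomial `p · X` over the polynomial ring in the coordinates `X`. -/
noncomputable def dotForm {K ι : Type*} [Field K] [Fintype ι] (p : ι → K[X]) :
    (MvPolynomial ι K)[X] :=
  ∑ i, Polynomial.C (MvPolynomial.X i) * (p i).map MvPolynomial.C

section dotForm

variable {K ι : Type*} [Field K] [Fintype ι] (p : ι → K[X])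

theorem map_dotForm (x : ι → K) : (dotForm p).map (MvPolynomial.eval x) = dotPoly p x := by
  simp only [dotForm, Polynomial.map_sum, Polynomial.map_mul, Polynomial.map_C,
    MvPolynomial.eval_X, Polynomial.map_map, dotPoly]
  refine Finset.sum_congr rfl fun i _ => ?_
  congr 1
  convert Polynomial.map_id
  ext z
  simp

theorem isHomogeneous_coeff_dotForm (j : ℕ) : ((dotForm p).coeff j).IsHomogeneous 1 := by
  simp only [dotForm, Polynomial.finsetSum_coeff, Polynomial.coeff_C_mul, Polynomial.coeff_map]
  exact MvPolynomial.IsHomogeneous.sum _ _ _ fun i _ =>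
    (MvPolynomial.isHomogeneous_X _ _).mul (MvPolynomial.isHomogeneous_C _ _)

theorem natDegree_dotForm_le {m : ℕ} (hp : ∀ i, (p i).natDegree ≤ m) :
    (dotForm p).natDegree ≤ m :=
  Polynomial.natDegree_sum_le_of_forall_le _ _ fun i _ =>
    (Polynomial.natDegree_C_mul_le _ _).trans (Polynomial.natDegree_map_le.trans (hp i))

end dotForm

/-! ### Parametrization of the union of a family of codimension two spaces -/

/-- A parametrization of the spaces orthogonal to `p(t)` and `q(t)`; the variable `none` stands
for `t`. -/
noncomputable def perpPoly {K : Type*} [Field K] {d : ℕ} (p q : Fin d → K[X]) (i j : Fin d) :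
    Fin d → MvPolynomial (Option (Fin d)) K :=
  perpProj (fun l => Polynomial.aeval (MvPolynomial.X none) (p l))
    (fun l => Polynomial.aeval (MvPolynomial.X none) (q l)) i j fun l => MvPolynomial.X (some l)

theorem map_perpProj {R S : Type*} [CommRing R] [CommRing S] {d : ℕ} (φ : R →+* S)
    (p q w : Fin d → R) (i j l : Fin d) :
    φ (perpProj p q i j w l) = perpProj (φ ∘ p) (φ ∘ q) i j (φ ∘ w) l := by
  simp only [perpProj, Pi.add_apply, Pi.sub_apply, Pi.smul_apply, Pi.single_apply, map_add, map_sub,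
    smul_eq_mul, map_mul, dotProduct, Function.comp]
  split_ifs <;> simp

theorem aeval_aeval_perpPoly {K L : Type*} [Field K] [Field L] [Algebra K L] {d : ℕ}
    (p q : Fin d → K[X]) (i j : Fin d) (t : L) (w : Fin d → L) (g : MvPolynomial (Fin d) K) :
    MvPolynomial.aeval (fun o : Option (Fin d) => o.elim t w)
      (MvPolynomial.aeval (perpPoly p q i j) g) =
      MvPolynomial.aeval (perpProj (fun l => Polynomial.aeval t (p l))
        (fun l => Polynomial.aeval t (q l)) i j w) g := by
  rw [MvPolynomial.comp_aeval_apply]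
  congr 2
  ext l
  have := map_perpProj (MvPolynomial.aeval (fun o : Option (Fin d) => o.elim t w) :
    MvPolynomial (Option (Fin d)) K →ₐ[K] L).toRingHom
    (fun l => Polynomial.aeval (MvPolynomial.X none) (p l))
    (fun l => Polynomial.aeval (MvPolynomial.X none) (q l)) (fun l => MvPolynomial.X (some l)) i j l
  refine this.trans ?_
  congr 1
  · ext l
    simp [Function.comp, ← Polynomial.aeval_algHom_apply]
  · ext l
    simp [Function.comp, ← Polynomial.aeval_algHom_apply]
  · ext l
    simp

/-! ### The hypersurface swept out by a family of codimension two spaces -/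

theorem aeval_complex_eq_eval {ι : Type*} (x : ι → ℂ) (F : MvPolynomial ι ℂ) :
    MvPolynomial.aeval x F = MvPolynomial.eval x F := by
  rw [MvPolynomial.aeval_eq_eval]

/-- The implicit equation: the resultant of the linear forms `p · X` and `q · X`. -/
noncomputable def rulingForm {d : ℕ} (p q : Fin d → ℂ[X]) (m n : ℕ) : MvPolynomial (Fin d) ℂ :=
  Polynomial.resultant (dotForm p) (dotForm q) m n

/-- The ideal of polynomials that vanish on the spaces orthogonal to `p(t)` and `q(t)`. -/
noncomputable def rulingIdeal {d : ℕ} (p q : Fin d → ℂ[X]) : Ideal (MvPolynomial (Fin d) ℂ) :=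
  ⨅ t : ℂ, ⨅ x : perp (evalVec p t) (evalVec q t), RingHom.ker (MvPolynomial.eval x.1)

theorem mem_rulingIdeal {d : ℕ} {p q : Fin d → ℂ[X]} {g : MvPolynomial (Fin d) ℂ} :
    g ∈ rulingIdeal p q ↔
      ∀ t, ∀ x ∈ perp (evalVec p t) (evalVec q t), MvPolynomial.eval x g = 0 := by
  simp [rulingIdeal, Submodule.mem_iInf, RingHom.mem_ker]

/-- The equation in `t` that says that the line through `x` and `y` meets the space orthogonal to
`p(t)` and `q(t)`. -/
noncomputable def meetPoly {d : ℕ} (p q : Fin d → ℂ[X]) (x y : Fin d → ℂ) : ℂ[X] :=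
  dotPoly p x * dotPoly q y - dotPoly q x * dotPoly p y

namespace IsRuling

variable {d : ℕ} {p q : Fin d → ℂ[X]} {m n : ℕ}

theorem isHomogeneous_rulingForm : (rulingForm p q m n).IsHomogeneous (m + n) :=
  MvPolynomial.isHomogeneous_resultant (isHomogeneous_coeff_dotForm p)
    (isHomogeneous_coeff_dotForm q) m n

/-- The resultant detects a common root of `p(t) · x` and `q(t) · x`; the first alternative is the
root at infinity. -/
theorem eval_rulingForm_eq_zero_iff (h : IsRuling p q m n) (x : Fin d → ℂ) :
    MvPolynomial.eval x (rulingForm p q m n) = 0 ↔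
      x ∈ perp (coeffVec p m) (coeffVec q n) ∨ ∃ t, x ∈ perp (evalVec p t) (evalVec q t) := by
  rw [rulingForm, ← Polynomial.resultant_map_map, map_dotForm, map_dotForm,
    Polynomial.resultant_eq_zero_iff_common_root (natDegree_dotPoly_le p x h.natDegree_left)
      (natDegree_dotPoly_le q x h.natDegree_right) (by
        have := h.curve.degree_ne_zero; omega)]
  simp only [coeff_dotPoly, eval_dotPoly, mem_perp]

/-- A one-parameter family of codimension two spaces does not fill the ambient space. A nonzero top
coefficient vector `w` keeps the chosen point off the space at infinity. -/
theorem exists_eval_rulingForm_ne_zero (h : IsRuling p q m n) :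
    ∃ x, MvPolynomial.eval x (rulingForm p q m n) ≠ 0 := by
  obtain ⟨w, hw, hw0⟩ : ∃ w, (w = coeffVec p m ∨ w = coeffVec q n) ∧ w ≠ 0 := by
    by_contra! h1
    apply h.wedge_top_ne
    ext a
    simp [wedge, h1 _ (Or.inl rfl)]
  have hex : ∀ {w : Fin d → ℂ}, w ≠ 0 → ∃ x ∈ (⊤ : Submodule ℂ (Fin d → ℂ)), x ⬝ᵥ w ≠ 0 :=
    fun hw => let ⟨c, hc⟩ := exists_single_dotProduct_ne_zero hw; ⟨c, trivial, hc⟩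
  have hspan : ∀ t (α β : ℂ), α ≠ 0 ∨ β ≠ 0 → α • evalVec p t + β • evalVec q t ≠ 0 := by
    intro t α β hαβ h0
    have h1 := eq_zero_of_add_smul_eq_zero (h.wedge_ne t) (α := α) (β := β) fun j => congrFun h0 j
    rcases hαβ with h2 | h2
    exacts [h2 h1.1, h2 h1.2]
  obtain ⟨x, -, hx, hxt⟩ := exists_mem_forall_notMem_perp p q ⊤ Set.univ 0
    (fun α β hαβ => hex (hspan 0 α β hαβ)) (fun t _ => by
      obtain ⟨x, hx, h1⟩ := hex (hspan t 1 0 (by simp))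
      refine ⟨x, hx, fun h2 => h1 ?_⟩
      rw [one_smul, zero_smul, add_zero]
      exact h2.1) (Set.finite_singleton w) (by rintro _ rfl; exact hex hw0)
  refine ⟨x, fun h0 => ?_⟩
  rcases (h.eval_rulingForm_eq_zero_iff x).1 h0 with h1 | ⟨t, h1⟩
  · rcases hw with rfl | rfl
    exacts [hx _ rfl h1.1, hx _ rfl h1.2]
  · exact hxt t trivial h1

theorem aeval_perpProj_eq_zero {g : MvPolynomial (Fin d) ℂ} (hg : g ∈ rulingIdeal p q) (i j : Fin d) :
    MvPolynomial.aeval (perpPoly p q i j) g = 0 := by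
  refine MvPolynomial.funext fun z => ?_
  have hz : z = fun o : Option (Fin d) => o.elim (z none) (fun l => z (some l)) := by
    ext o; cases o <;> rfl
  rw [← aeval_complex_eq_eval, hz, aeval_aeval_perpPoly, map_zero, aeval_complex_eq_eval]
  exact mem_rulingIdeal.1 hg (z none) _ (perpProj_mem_perp i j _)

/-- Where the minor `[i, j]` is nonzero, the parametrization reaches every `x` of the space: it
sends `x` divided by the minor to `x`. -/
theorem eval_eq_zero_of_aeval_perpPoly {g : MvPolynomial (Fin d) ℂ} {i j : Fin d}
    (hg : MvPolynomial.aeval (perpPoly p q i j) g = 0) {t : ℂ}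
    (ht : (p i).eval t * (q j).eval t - (p j).eval t * (q i).eval t ≠ 0) {x : Fin d → ℂ}
    (hx : x ∈ perp (evalVec p t) (evalVec q t)) : MvPolynomial.eval x g = 0 := by
  have h1 := aeval_aeval_perpPoly p q i j t
    (((p i).eval t * (q j).eval t - (p j).eval t * (q i).eval t)⁻¹ • x) g
  rw [hg, map_zero] at h1
  rw [h1, aeval_complex_eq_eval]
  congr 2
  have h2 := perpProj_of_mem_perp i j (Submodule.smul_mem _
    ((p i).eval t * (q j).eval t - (p j).eval t * (q i).eval t)⁻¹ hx)
  simp only [Polynomial.coe_aeval_eq_eval]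
  refine Eq.trans ?_ h2.symm
  rw [smul_smul]
  simp only [evalVec]
  rw [mul_inv_cancel₀ ht, one_smul]

/-- The hypersurface is irreducible. -/
theorem isPrime_rulingIdeal (h : IsRuling p q m n) : (rulingIdeal p q).IsPrime := by
  have hminor : ∀ t, ∃ i j, (p i).eval t * (q j).eval t - (p j).eval t * (q i).eval t ≠ 0 :=
    fun t => exists_minor_ne_zero (h.wedge_ne t)
  -- The ideal is the kernel of pullback along a single chart with nonzero minor, and the pullback
  -- has values in a domain; this makes it prime.
  have key : ∀ {i j : Fin d} {g : MvPolynomial (Fin d) ℂ}, p i * q j - p j * q i ≠ 0 →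
      MvPolynomial.aeval (perpPoly p q i j) g = 0 → g ∈ rulingIdeal p q := by
    intro i j g hij hg
    rw [mem_rulingIdeal]
    intro t x hx
    obtain ⟨i', j', ht⟩ := hminor t
    refine eval_eq_zero_of_aeval_perpPoly (i := i') (j := j') ?_ ht hx
    -- Change of chart: multiplied by the minor `[i, j]`, the pullback in the other chart vanishes
    -- at every point, and the minor is not the zero polynomial.
    have hprod : Polynomial.aeval (MvPolynomial.X none) (p i * q j - p j * q i) *
        MvPolynomial.aeval (perpPoly p q i' j') g = (0 : MvPolynomial (Option (Fin d)) ℂ) := by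
      refine MvPolynomial.funext fun z => ?_
      have hz : z = fun o : Option (Fin d) => o.elim (z none) (fun l => z (some l)) := by
        ext o; cases o <;> rfl
      rw [map_mul, map_zero]
      by_cases h0 : (p i).eval (z none) * (q j).eval (z none) -
          (p j).eval (z none) * (q i).eval (z none) = 0
      · have : MvPolynomial.eval z (Polynomial.aeval (MvPolynomial.X none)
            (p i * q j - p j * q i)) = 0 := by
          rw [← aeval_complex_eq_eval, ← Polynomial.aeval_algHom_apply]
          simpa [Polynomial.coe_aeval_eq_eval] using h0
        rw [this, zero_mul]
      · have : MvPolynomial.eval z (MvPolynomial.aeval (perpPoly p q i' j') g) = 0 := by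
          rw [← aeval_complex_eq_eval, hz, aeval_aeval_perpPoly, aeval_complex_eq_eval]
          exact eval_eq_zero_of_aeval_perpPoly hg h0 (perpProj_mem_perp i' j' _)
        rw [this, mul_zero]
    refine (mul_eq_zero.1 hprod).resolve_left fun h0 => hij ?_
    have hinj : Function.Injective (Polynomial.aeval (MvPolynomial.X none) :
        ℂ[X] →ₐ[ℂ] MvPolynomial (Option (Fin d)) ℂ) := by
      intro f g hfg
      have := congrArg (MvPolynomial.aeval fun _ : Option (Fin d) => (Polynomial.X : ℂ[X])) hfg
      simpa [← Polynomial.aeval_algHom_apply] using this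
    exact hinj (by rw [h0, map_zero])
  obtain ⟨i, j, hij⟩ := hminor 0
  have hij : p i * q j - p j * q i ≠ 0 := by
    intro h0
    have := congrArg (Polynomial.eval 0) h0
    simp only [Polynomial.eval_sub, Polynomial.eval_mul, Polynomial.eval_zero] at this
    exact hij this
  refine ⟨fun htop => ?_, fun {f g} hfg => ?_⟩
  · have h1 : (1 : MvPolynomial (Fin d) ℂ) ∈ rulingIdeal p q := by rw [htop]; trivial
    have := mem_rulingIdeal.1 h1 0 0 (zero_mem _)
    simp at this
  · have h1 := aeval_perpProj_eq_zero hfg i j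
    rw [map_mul] at h1
    rcases mul_eq_zero.1 h1 with h2 | h2
    exacts [Or.inl (key hij h2), Or.inr (key hij h2)]

/-- The reduced equation of the hypersurface. -/
theorem exists_prime_factor (h : IsRuling p q m n) :
    ∃ F₀, Prime F₀ ∧ F₀ ∣ rulingForm p q m n ∧ F₀ ∈ rulingIdeal p q := by
  have hF0 : rulingForm p q m n ≠ 0 := by
    obtain ⟨x, hx⟩ := h.exists_eval_rulingForm_ne_zero
    rintro h0; simp [h0] at hx
  have hprime := h.isPrime_rulingIdeal
  have hmem : rulingForm p q m n ∈ rulingIdeal p q := mem_rulingIdeal.2 fun t x hx =>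
    (h.eval_rulingForm_eq_zero_iff x).2 (Or.inr ⟨t, hx⟩)
  have hassoc := UniqueFactorizationMonoid.factors_prod hF0
  have hprod : (UniqueFactorizationMonoid.factors (rulingForm p q m n)).prod ∈ rulingIdeal p q :=
    (Ideal.mem_iff_of_associated hassoc).2 hmem
  obtain ⟨F₀, hF₀, h1⟩ := (hprime.multiset_prod_mem_iff_exists_mem _).1 hprod
  exact ⟨F₀, UniqueFactorizationMonoid.prime_of_factor _ hF₀,
    UniqueFactorizationMonoid.dvd_of_mem_factors hF₀, h1⟩

/-- If some point lies in exactly `k` spaces, generic points do. -/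
theorem exists_form_of_point (h : IsRuling p q m n) {T : Set ℂ} {k : ℕ}
    (hTk : ∀ t ∉ T, {s | Par (evalVec (wedge p q) s) (evalVec (wedge p q) t)}.ncard = k)
    {t₀ : ℂ} (ht₀ : t₀ ∉ T) {x₀ : Fin d → ℂ}
    (hx₀top : x₀ ∉ perp (coeffVec p m) (coeffVec q n))
    (hx₀' : ∀ s, Par (evalVec (wedge p q) s) (evalVec (wedge p q) t₀) →
      x₀ ∉ perp (evalVec (derivVec p) s) (evalVec (derivVec q) s))
    (hx₀s : ∀ s, x₀ ∈ perp (evalVec p s) (evalVec q s) →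
      Par (evalVec (wedge p q) s) (evalVec (wedge p q) t₀)) :
    ∃ Q : MvPolynomial (Fin d) ℂ, MvPolynomial.eval x₀ Q ≠ 0 ∧
      ∀ x, MvPolynomial.eval x Q ≠ 0 → ∀ s ∉ T, ∀ t, x ∈ perp (evalVec p s) (evalVec q s) →
        x ∈ perp (evalVec p t) (evalVec q t) →
        Par (evalVec (wedge p q) t) (evalVec (wedge p q) s) := by
  classical
  have hfin := fun t => h.curve.finite_fiber (h.curve.evalVec_ne t)
  let ρ : (Fin d → ℂ) → MvPolynomial (Fin d) ℂ →ₐ[ℂ] ℂ := fun x => MvPolynomial.aeval x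
  have hρ : ∀ x, (ρ x).toRingHom = MvPolynomial.eval x := fun x => by
    ext g <;> simp [ρ]
  have hcard : (hfin t₀).toFinset.card = k := by
    rw [← Set.ncard_eq_toFinset_card _ (hfin t₀), hTk t₀ ht₀]
  -- The fibre of `s` already provides `k` spaces through `x`, so a bound by `k` leaves room for no
  -- other parameter.
  suffices ∃ Q : MvPolynomial (Fin d) ℂ, ρ x₀ Q ≠ 0 ∧ ∀ x, ρ x Q ≠ 0 → ∀ S : Finset ℂ,
      (∀ s ∈ S, x ∈ perp (evalVec p s) (evalVec q s)) → S.card ≤ k by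
    obtain ⟨Q, hQ₀, hQ⟩ := this
    refine ⟨Q, by simpa [ρ, aeval_complex_eq_eval] using hQ₀, fun x hx s hs t hxs hxt => ?_⟩
    by_contra hst
    have h1 := hQ x (by simpa [ρ, aeval_complex_eq_eval] using hx)
      (insert t (hfin s).toFinset) (by
        intro r hr
        rcases Finset.mem_insert.1 hr with rfl | hr
        · exact hxt
        · have hr : Par (evalVec (wedge p q) r) (evalVec (wedge p q) s) := by simpa using hr
          exact h.perp_le hr.symm hxs)
    rw [Finset.card_insert_of_notMem (by simpa using hst),
      ← Set.ncard_eq_toFinset_card _ (hfin s), hTk s hs] at h1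
    omega
  have hmap : ∀ (r : Fin d → ℂ[X]) x, (dotForm r).map (ρ x).toRingHom = dotPoly r x :=
    fun r x => by rw [hρ, map_dotForm]
  have hroots : ∀ t, (dotPoly p x₀).eval t = 0 → (dotPoly q x₀).eval t = 0 →
      t ∈ (hfin t₀).toFinset ∧ ((dotPoly p x₀).derivative.eval t ≠ 0 ∨
        (dotPoly q x₀).derivative.eval t ≠ 0) := by
    intro t h1 h2
    rw [eval_dotPoly] at h1 h2
    have h3 := hx₀s t ⟨h1, h2⟩
    refine ⟨by simpa using h3, ?_⟩
    rw [derivative_dotPoly, derivative_dotPoly, eval_dotPoly, eval_dotPoly, ← not_and_or]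
    exact fun h4 => hx₀' t h3 h4
  have hcoeff : ∀ (r : Fin d → ℂ[X]) (l : ℕ), ρ x₀ ((dotForm r).coeff l) = x₀ ⬝ᵥ coeffVec r l := by
    intro r l
    rw [← coeff_dotPoly, ← hmap, Polynomial.coeff_map]
    rfl
  -- The openness lemma wants one polynomial of exact formal degree; which of the two it is depends
  -- on `x₀`.
  by_cases hq : x₀ ⬝ᵥ coeffVec q n = 0
  · have hp : x₀ ⬝ᵥ coeffVec p m ≠ 0 := fun hp => hx₀top ⟨hp, hq⟩
    obtain ⟨Q, hQ₀, hQ⟩ := Polynomial.exists_open_card_common_roots_le (dotForm q) (dotForm p) n m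
      (natDegree_dotForm_le q h.natDegree_right) (natDegree_dotForm_le p h.natDegree_left) (ρ x₀)
      (by rwa [hcoeff]) (hfin t₀).toFinset (by
        rw [hmap, hmap]
        exact fun t h1 h2 => ⟨(hroots t h2 h1).1, (hroots t h2 h1).2.symm⟩)
    refine ⟨Q, hQ₀, fun x hx S hS => (hQ (ρ x) hx S fun s hs => ?_).trans hcard.le⟩
    rw [hmap, hmap, eval_dotPoly, eval_dotPoly]
    exact (hS s hs).symm
  · obtain ⟨Q, hQ₀, hQ⟩ := Polynomial.exists_open_card_common_roots_le (dotForm p) (dotForm q) m n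
      (natDegree_dotForm_le p h.natDegree_left) (natDegree_dotForm_le q h.natDegree_right) (ρ x₀)
      (by rwa [hcoeff]) (hfin t₀).toFinset (by
        rw [hmap, hmap]
        exact hroots)
    refine ⟨Q, hQ₀, fun x hx S hS => (hQ (ρ x) hx S fun s hs => ?_).trans hcard.le⟩
    rw [hmap, hmap, eval_dotPoly, eval_dotPoly]
    exact hS s hs

end IsRuling

/-! ### Counting the points on a general line -/

/-- The line through `x` and `y` is in general position with respect to the hypersurface: it meets
`m + n` of the spaces, away from the exceptional parameters `T` and the zeros of `Q`. -/
structure IsGeneralLine {d : ℕ} (p q : Fin d → ℂ[X]) (m n : ℕ) (T : Set ℂ)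
    (Q : MvPolynomial (Fin d) ℂ) (x y : Fin d → ℂ) : Prop where
  simple : IsSimpleAway (meetPoly p q x y) (m + n) T
  eval_ne : MvPolynomial.eval y (rulingForm p q m n) ≠ 0
  avoid : ∀ z : ℂ, MvPolynomial.eval (x + z • y) (rulingForm p q m n) = 0 →
    MvPolynomial.eval (x + z • y) Q ≠ 0

namespace IsRuling

variable {d : ℕ} {p q : Fin d → ℂ[X]} {m n : ℕ}

theorem eval_meetPoly (x y : Fin d → ℂ) (t : ℂ) : (meetPoly p q x y).eval t =
    (x ⬝ᵥ evalVec p t) * (y ⬝ᵥ evalVec q t) - (x ⬝ᵥ evalVec q t) * (y ⬝ᵥ evalVec p t) := by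
  simp [meetPoly, eval_dotPoly]

theorem coeff_meetPoly (h : IsRuling p q m n) (x y : Fin d → ℂ) :
    (meetPoly p q x y).coeff (m + n) = (x ⬝ᵥ coeffVec p m) * (y ⬝ᵥ coeffVec q n) -
      (x ⬝ᵥ coeffVec q n) * (y ⬝ᵥ coeffVec p m) := by
  have h1 := fun x => natDegree_dotPoly_le p x h.natDegree_left
  have h2 := fun x => natDegree_dotPoly_le q x h.natDegree_right
  rw [meetPoly, Polynomial.coeff_sub, Polynomial.coeff_mul_add_eq_of_natDegree_le (h1 _) (h2 _),
    mul_comm (dotPoly q x), Polynomial.coeff_mul_add_eq_of_natDegree_le (h1 _) (h2 _)]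
  simp only [coeff_dotPoly]
  ring

/-- The number of points in which a line in general position meets the hypersurface. -/
theorem card_mul_encard (h : IsRuling p q m n) {T : Set ℂ} {k : ℕ}
    (hTk : ∀ t ∉ T, {s | Par (evalVec (wedge p q) s) (evalVec (wedge p q) t)}.ncard = k)
    {Q : MvPolynomial (Fin d) ℂ}
    (hQ : ∀ x ≠ 0, MvPolynomial.eval x Q ≠ 0 → ∀ s ∉ T, ∀ t, x ∈ perp (evalVec p s) (evalVec q s) →
        x ∈ perp (evalVec p t) (evalVec q t) →
        Par (evalVec (wedge p q) t) (evalVec (wedge p q) s))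
    {x y : Fin d → ℂ} (hxy : IsGeneralLine p q m n T Q x y) :
    ∃ D : ℕ, k * D = m + n ∧ {z : ℙ ℂ (Fin d → ℂ) | (∃ a b : ℂ, z.rep = a • x + b • y) ∧
      ∃ t, z.rep ∈ perp (evalVec p t) (evalVec q t)}.encard = D := by
  set f := meetPoly p q x y with hf
  have hyt : ∀ t, y ∉ perp (evalVec p t) (evalVec q t) := fun t hy =>
    hxy.eval_ne ((h.eval_rulingForm_eq_zero_iff y).2 (Or.inr ⟨t, hy⟩))
  have hzero : ∀ z : ℂ, x + z • y ≠ 0 := by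
    intro z hz
    apply hxy.simple.ne_zero
    have hx : x = -z • y := by rw [neg_smul]; exact eq_neg_of_add_eq_zero_left hz
    apply Polynomial.funext
    intro t
    rw [eval_meetPoly, hx, smul_dotProduct, smul_dotProduct]
    simp only [smul_eq_mul, Polynomial.eval_zero]
    ring
  have hroot : ∀ t z : ℂ, x + z • y ∈ perp (evalVec p t) (evalVec q t) → f.eval t = 0 := by
    intro t z hz
    obtain ⟨h1, h2⟩ := mem_perp.1 hz
    rw [add_dotProduct, smul_dotProduct, smul_eq_mul] at h1 h2
    rw [hf, eval_meetPoly]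
    linear_combination (y ⬝ᵥ evalVec q t) * h1 - (y ⬝ᵥ evalVec p t) * h2
  -- `f` is the determinant of the two linear conditions on `x + z y`. Since `y` is in none of the
  -- spaces, its vanishing allows solving for `z`.
  have hexists : ∀ t, f.eval t = 0 → ∃ z : ℂ, x + z • y ∈ perp (evalVec p t) (evalVec q t) := by
    intro t ht
    rw [hf, eval_meetPoly] at ht
    by_cases h1 : y ⬝ᵥ evalVec p t = 0
    · have h2 : y ⬝ᵥ evalVec q t ≠ 0 := fun h2 => hyt t ⟨h1, h2⟩
      refine ⟨-(x ⬝ᵥ evalVec q t) / (y ⬝ᵥ evalVec q t), mem_perp.2 ⟨?_, ?_⟩⟩ <;>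
        rw [add_dotProduct, smul_dotProduct, smul_eq_mul] <;> field_simp
      · linear_combination ht
      · ring
    · refine ⟨-(x ⬝ᵥ evalVec p t) / (y ⬝ᵥ evalVec p t), mem_perp.2 ⟨?_, ?_⟩⟩ <;>
        rw [add_dotProduct, smul_dotProduct, smul_eq_mul] <;> field_simp
      · ring
      · linear_combination -ht
  have hunique : ∀ t (z z' : ℂ), x + z • y ∈ perp (evalVec p t) (evalVec q t) →
      x + z' • y ∈ perp (evalVec p t) (evalVec q t) → z = z' := by
    intro t z z' hz hz'
    by_contra hne
    have h1 := sub_mem hz hz'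
    rw [add_sub_add_left_eq_sub, ← sub_smul] at h1
    exact hyt t ((Submodule.smul_mem_iff _ (sub_ne_zero.2 hne)).1 h1)
  choose! Λ hΛ using hexists
  -- Parameters with the same intersection point are exactly those of one fibre, by the choice of
  -- `Q`; the roots avoid `T`, so each fibre has `k` elements.
  obtain ⟨D, hD, hcard⟩ := hxy.simple.mul_card_image Λ k (by
    intro t ht
    rw [← hTk t (hxy.simple.notMem t ht)]
    congr 1
    ext s
    constructor
    · rintro ⟨hs, hst⟩
      have h1 := hΛ t ht
      have h2 := hΛ s hs
      rw [hst] at h2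
      exact hQ _ (hzero _) (hxy.avoid _ ((h.eval_rulingForm_eq_zero_iff _).2 (Or.inr ⟨t, h1⟩))) t
        (hxy.simple.notMem t ht) s h1 h2
    · intro hst
      have h1 := h.perp_le (Par.symm hst) (hΛ t ht)
      have h2 := hroot s _ h1
      exact ⟨h2, hunique s _ _ (hΛ s h2) h1⟩)
  refine ⟨D, hD, ?_⟩
  let Φ : ℂ → ℙ ℂ (Fin d → ℂ) := fun z => Projectivization.mk ℂ _ (hzero z)
  have hΦ : Function.Injective Φ := by
    intro z z' hzz
    rw [Par.mk_eq_mk_iff] at hzz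
    by_contra hne
    obtain ⟨c, hc⟩ := hzz.exists_smul (hzero z')
    have h1 : (1 - c) • x + (z - c * z') • y = 0 := by
      have : x + z • y - c • (x + z' • y) = 0 := by rw [hc, sub_self]
      rw [← this]; module
    by_cases hc1 : c = 1
    · rw [hc1, sub_self, zero_smul, zero_add, one_mul] at h1
      have hy0 := (smul_eq_zero.1 h1).resolve_left (sub_ne_zero.2 hne)
      exact hyt 0 (by rw [hy0]; exact zero_mem _)
    · apply hzero ((1 - c)⁻¹ * (z - c * z'))
      have h2 : (1 - c)⁻¹ • ((1 - c) • x + (z - c * z') • y) = 0 := by rw [h1, smul_zero]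
      rwa [smul_add, smul_smul, smul_smul, inv_mul_cancel₀ (sub_ne_zero.2 (Ne.symm hc1)),
        one_smul] at h2
  rw [← hcard, ← hΦ.encard_image]
  congr 1
  ext z
  constructor
  · rintro ⟨⟨a, b, hab⟩, t, ht⟩
    have ha : a ≠ 0 := by
      rintro rfl
      rw [zero_smul, zero_add] at hab
      have hb : b ≠ 0 := by
        rintro rfl
        rw [zero_smul] at hab
        exact z.rep_nonzero hab
      rw [hab] at ht
      exact hyt t ((Submodule.smul_mem_iff _ hb).1 ht)
    have h1 : z.rep = a • (x + (a⁻¹ * b) • y) := by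
      rw [hab, smul_add, smul_smul, mul_inv_cancel_left₀ ha]
    have h2 : x + (a⁻¹ * b) • y ∈ perp (evalVec p t) (evalVec q t) := by
      rw [h1] at ht
      exact (Submodule.smul_mem_iff _ ha).1 ht
    have h3 := hroot t _ h2
    refine ⟨a⁻¹ * b, ⟨t, h3, hunique t _ _ (hΛ t h3) h2⟩, ?_⟩
    conv_rhs => rw [← z.mk_rep]
    rw [Par.mk_eq_mk_iff]
    exact (Par.of_smul h1).symm
  · rintro ⟨_, ⟨t, ht, rfl⟩, rfl⟩
    obtain ⟨a, ha⟩ := Projectivization.exists_smul_eq_mk_rep ℂ _ (hzero (Λ t))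
    have ha : (Φ (Λ t)).rep = (a : ℂ) • (x + Λ t • y) := ha.symm
    refine ⟨⟨a, a * Λ t, ?_⟩, t, ?_⟩
    · rw [ha, smul_add, smul_smul]
    · rw [ha]
      exact Submodule.smul_mem _ _ (hΛ t ht)

end IsRuling

/-! ### General lines -/

theorem MvPolynomial.exists_eval_ne_zero {ι : Type*} {G : MvPolynomial ι ℂ} (hG : G ≠ 0) :
    ∃ x, MvPolynomial.eval x G ≠ 0 := by
  by_contra! h
  exact hG (MvPolynomial.funext fun x => by rw [h x, map_zero])

/-- The matrix whose rows indexed by the first summand are free, and whose other rows are those of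
`N`. -/
def completedMatrix {ι κ σ K R : Type*} [CommRing K] [CommRing R] [Algebra K R]
    (ε : κ ⊕ σ ≃ ι) (N : Matrix ι ι K) (c : κ → ι → R) : Matrix ι ι R :=
  Matrix.of fun i l => Sum.elim (fun j => c j l) (fun s => algebraMap K R (N (ε (Sum.inr s)) l))
    (ε.symm i)

/-- Multiples of columns of the adjugate of the completed matrix, which are orthogonal to the free
rows. -/
noncomputable def adjugateColumn {ι κ σ K R : Type*} [Field K] [CommRing R] [Algebra K R] [Fintype ι]
    [DecidableEq ι] (ε : κ ⊕ σ ≃ ι) (N : Matrix ι ι K) (c : κ → ι → R) (s : σ) : ι → R :=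
  fun l => algebraMap K R (Ring.inverse N.det) *
    (completedMatrix ε N c).adjugate l (ε (Sum.inr s))

/-- Sections of codimension `d - 2` are lines: a condition on pairs of spanning vectors becomes a
condition on linear equations. -/
theorem exists_linear_equations {d : ℕ} (hd : 2 ≤ d) {x y : Fin d → ℂ}
    (hxy : LinearIndependent ℂ ![x, y]) {G : MvPolynomial (Fin d ⊕ Fin d) ℂ}
    (hG : MvPolynomial.eval (Sum.elim x y) G ≠ 0) :
    ∃ G' : MvPolynomial (Fin (d - 2) × Fin d) ℂ, G' ≠ 0 ∧ ∀ c : Fin (d - 2) → Fin d → ℂ,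
      MvPolynomial.eval (fun a => c a.1 a.2) G' ≠ 0 →
      ∃ x' y' : Fin d → ℂ, MvPolynomial.eval (Sum.elim x' y') G ≠ 0 ∧
        ∀ z, (∀ j, c j ⬝ᵥ z = 0) ↔ ∃ a b : ℂ, z = a • x' + b • y' := by
  classical
  obtain ⟨ε⟩ : Nonempty (Fin (d - 2) ⊕ Fin 2 ≃ Fin d) :=
    Fintype.card_eq.1 (by simp; omega)
  obtain ⟨b, hbx, hby⟩ : ∃ b : Module.Basis (Fin d) ℂ (Fin d → ℂ),
      b (ε (Sum.inr 0)) = x ∧ b (ε (Sum.inr 1)) = y := by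
    let b₀ := Module.Basis.sumExtend hxy
    have : Fintype (Fin 2 ⊕ Module.Basis.sumExtendIndex hxy) :=
      FiniteDimensional.fintypeBasisIndex b₀
    have : Fintype (Module.Basis.sumExtendIndex hxy) :=
      Fintype.ofInjective (Sum.inr : _ → Fin 2 ⊕ Module.Basis.sumExtendIndex hxy)
        Sum.inr_injective
    have hcard := Module.finrank_eq_nat_card_basis b₀
    obtain ⟨ε'⟩ : Nonempty (Module.Basis.sumExtendIndex hxy ≃ Fin (d - 2)) :=
      Fintype.card_eq.1 (by
        rw [Nat.card_sum] at hcard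
        simp at hcard ⊢; omega)
    refine ⟨b₀.reindex ((Equiv.sumComm _ _).trans ((Equiv.sumCongr ε' (Equiv.refl _)).trans ε)),
      ?_, ?_⟩
    · simp [b₀, Module.Basis.sumExtend]; rfl
    · simp [b₀, Module.Basis.sumExtend]; rfl
  -- The columns of `P` are a basis that contains `x` and `y`, so the rows of its inverse supply
  -- linear equations for their span.
  let P : Matrix (Fin d) (Fin d) ℂ := Matrix.of fun i j => b j i
  have hP : IsUnit P.det := by
    have : P = (Pi.basisFun ℂ (Fin d)).toMatrix b := by
      ext i j; simp [P, Module.Basis.toMatrix_apply]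
    rw [this]
    exact (Matrix.isUnit_iff_isUnit_det _).1
      (@isUnit_of_invertible _ _ _ ((Pi.basisFun ℂ (Fin d)).invertibleToMatrix b))
  let N₀ := P⁻¹
  have hN₀ : IsUnit N₀.det := Matrix.isUnit_nonsing_inv_det _ hP
  let X : Fin (d - 2) → Fin d → MvPolynomial (Fin (d - 2) × Fin d) ℂ :=
    fun j l => MvPolynomial.X (j, l)
  have hmat : ∀ c : Fin (d - 2) → Fin d → ℂ,
      (MvPolynomial.eval fun a => c a.1 a.2).mapMatrix (completedMatrix ε N₀ X) = completedMatrix ε N₀ c := by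
    intro c
    ext i l
    rcases hi : ε.symm i with j | s <;> simp [completedMatrix, X, hi, MvPolynomial.algebraMap_eq]
  have hadj : ∀ (c : Fin (d - 2) → Fin d → ℂ) s l,
      MvPolynomial.eval (fun a => c a.1 a.2) (adjugateColumn ε N₀ X s l) = adjugateColumn ε N₀ c s l := by
    intro c s l
    simp only [adjugateColumn, map_mul]
    rw [← hmat, ← RingHom.map_adjugate]
    simp [MvPolynomial.algebraMap_eq]
  have hev : ∀ c : Fin (d - 2) → Fin d → ℂ, MvPolynomial.eval (fun a => c a.1 a.2)
      ((completedMatrix ε N₀ X).det * MvPolynomial.aeval (Sum.elim (adjugateColumn ε N₀ X 0) (adjugateColumn ε N₀ X 1)) G) =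
      (completedMatrix ε N₀ c).det * MvPolynomial.eval (Sum.elim (adjugateColumn ε N₀ c 0) (adjugateColumn ε N₀ c 1)) G := by
    intro c
    rw [map_mul, RingHom.map_det, hmat, ← aeval_complex_eq_eval, MvPolynomial.comp_aeval_apply,
      aeval_complex_eq_eval]
    congr 2
    ext g
    · simp
    · rcases g with l | l <;> simp [hadj]
  -- The determinant factor ensures that the two columns span all solutions of the free equations.
  refine ⟨(completedMatrix ε N₀ X).det *
    MvPolynomial.aeval (Sum.elim (adjugateColumn ε N₀ X 0) (adjugateColumn ε N₀ X 1)) G, ?_, fun c hc => ?_⟩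
  · intro h0
    let c₀ : Fin (d - 2) → Fin d → ℂ := fun j => N₀ (ε (Sum.inl j))
    have hc₀ : completedMatrix ε N₀ c₀ = N₀ := by
      ext i l
      rcases hi : ε.symm i with j | s <;> simp [completedMatrix, c₀, hi, ← (ε.symm_apply_eq.1 hi)]
    -- The scalar in `adjugateColumn` is normalized so that at the base point the columns are
    -- exactly `x` and `y`.
    have hadj₀ : ∀ s, adjugateColumn ε N₀ c₀ s = b (ε (Sum.inr s)) := by
      intro s
      ext l
      simp only [adjugateColumn, hc₀]
      have : N₀⁻¹ = P := Matrix.nonsing_inv_nonsing_inv _ hP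
      have h1 := congrFun (congrFun this l) (ε (Sum.inr s))
      rw [Matrix.inv_def] at h1
      exact h1
    have := hev c₀
    rw [h0, map_zero, hc₀, hadj₀, hadj₀, hbx, hby] at this
    exact mul_ne_zero hN₀.ne_zero hG this.symm
  · rw [hev] at hc
    refine ⟨adjugateColumn ε N₀ c 0, adjugateColumn ε N₀ c 1, right_ne_zero_of_mul hc, fun z => ?_⟩
    have hdet := left_ne_zero_of_mul hc
    have hN₀' : Ring.inverse N₀.det ≠ 0 := by
      rw [Ring.inverse_eq_inv]; exact inv_ne_zero hN₀.ne_zero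
    constructor
    · intro hz
      have h1 : (completedMatrix ε N₀ c).adjugate.mulVec ((completedMatrix ε N₀ c).mulVec z) = (completedMatrix ε N₀ c).det • z := by
        rw [Matrix.mulVec_mulVec, Matrix.adjugate_mul, Matrix.smul_mulVec, Matrix.one_mulVec]
      have h2 : ∀ j, (completedMatrix ε N₀ c).mulVec z (ε (Sum.inl j)) = 0 := by
        intro j
        rw [← hz j]
        simp [Matrix.mulVec, completedMatrix, dotProduct]
      have h3 : ∀ l, (completedMatrix ε N₀ c).det * z l =
          (completedMatrix ε N₀ c).adjugate l (ε (Sum.inr 0)) * (completedMatrix ε N₀ c).mulVec z (ε (Sum.inr 0)) +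
          (completedMatrix ε N₀ c).adjugate l (ε (Sum.inr 1)) * (completedMatrix ε N₀ c).mulVec z (ε (Sum.inr 1)) := by
        intro l
        have h4 := congrFun h1 l
        rw [Pi.smul_apply, smul_eq_mul] at h4
        rw [← h4, Matrix.mulVec, dotProduct, ← ε.sum_comp, Fintype.sum_sum_type, Fin.sum_univ_two]
        simp [h2]
      refine ⟨(completedMatrix ε N₀ c).mulVec z (ε (Sum.inr 0)) / ((completedMatrix ε N₀ c).det * Ring.inverse N₀.det),
        (completedMatrix ε N₀ c).mulVec z (ε (Sum.inr 1)) / ((completedMatrix ε N₀ c).det * Ring.inverse N₀.det), ?_⟩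
      ext l
      simp only [adjugateColumn, Pi.add_apply, Pi.smul_apply, smul_eq_mul, Algebra.algebraMap_self,
        RingHom.id_apply]
      field_simp
      linear_combination h3 l
    · rintro ⟨α, β, rfl⟩ j
      have h1 : ∀ s, c j ⬝ᵥ adjugateColumn ε N₀ c s = 0 := by
        intro s
        have h2 := congrFun (congrFun (Matrix.mul_adjugate (completedMatrix ε N₀ c)) (ε (Sum.inl j))) (ε (Sum.inr s))
        rw [Matrix.smul_apply, Matrix.one_apply_ne (by simp), smul_zero, Matrix.mul_apply] at h2
        have h3 : c j ⬝ᵥ adjugateColumn ε N₀ c s = Ring.inverse N₀.det *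
            ∑ l, completedMatrix ε N₀ c (ε (Sum.inl j)) l * (completedMatrix ε N₀ c).adjugate l (ε (Sum.inr s)) := by
          rw [dotProduct, Finset.mul_sum]
          refine Finset.sum_congr rfl fun l _ => ?_
          simp [adjugateColumn, completedMatrix]
          ring
        rw [h3, h2, mul_zero]
      rw [dotProduct_add, dotProduct_smul, dotProduct_smul, h1, h1, smul_zero, smul_zero, add_zero]

namespace IsRuling

variable {d : ℕ} {p q : Fin d → ℂ[X]} {m n : ℕ}

/-- Being in general position is an open condition on lines. -/
theorem exists_open_meetPoly (h : IsRuling p q m n) {T : Set ℂ} (hT : T.Finite)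
    {x₀ y₀ : Fin d → ℂ} (h₀ : IsSimpleAway (meetPoly p q x₀ y₀) (m + n) T) :
    ∃ G : MvPolynomial (Fin d ⊕ Fin d) ℂ, MvPolynomial.eval (Sum.elim x₀ y₀) G ≠ 0 ∧
      ∀ x y, MvPolynomial.eval (Sum.elim x y) G ≠ 0 →
        IsSimpleAway (meetPoly p q x y) (m + n) T := by
  let ρ : (Fin d → ℂ) → (Fin d → ℂ) → MvPolynomial (Fin d ⊕ Fin d) ℂ →ₐ[ℂ] ℂ :=
    fun x y => MvPolynomial.aeval (Sum.elim x y)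
  let l : (Fin d → ℂ[X]) → (MvPolynomial (Fin d ⊕ Fin d) ℂ)[X] := fun r =>
    (dotForm r).map (MvPolynomial.rename Sum.inl : _ →ₐ[ℂ] _).toRingHom
  let l' : (Fin d → ℂ[X]) → (MvPolynomial (Fin d ⊕ Fin d) ℂ)[X] := fun r =>
    (dotForm r).map (MvPolynomial.rename Sum.inr : _ →ₐ[ℂ] _).toRingHom
  have hl : ∀ x y r, (l r).map (ρ x y).toRingHom = dotPoly r x := by
    intro x y r
    rw [Polynomial.map_map, ← map_dotForm]
    congr 1
    ext i <;> simp [ρ]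
  have hl' : ∀ x y r, (l' r).map (ρ x y).toRingHom = dotPoly r y := by
    intro x y r
    rw [Polynomial.map_map, ← map_dotForm]
    congr 1
    ext i <;> simp [ρ]
  let f := l p * l' q - l q * l' p
  have hf : ∀ x y, f.map (ρ x y).toRingHom = meetPoly p q x y := by
    intro x y
    rw [Polynomial.map_sub, Polynomial.map_mul, Polynomial.map_mul, hl, hl, hl', hl']
    rfl
  have hp := natDegree_dotForm_le p h.natDegree_left
  have hq := natDegree_dotForm_le q h.natDegree_right
  have hdeg : f.natDegree ≤ m + n := by
    refine (Polynomial.natDegree_sub_le_of_le (m := m + n) (n := m + n) ?_ ?_).trans (max_self _).le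
    · exact Polynomial.natDegree_mul_le_of_le (Polynomial.natDegree_map_le.trans hp)
        (Polynomial.natDegree_map_le.trans hq)
    · rw [mul_comm]
      exact Polynomial.natDegree_mul_le_of_le (Polynomial.natDegree_map_le.trans hp)
        (Polynomial.natDegree_map_le.trans hq)
  obtain ⟨G, hG₀, hG⟩ := IsSimpleAway.exists_open f hdeg hT (ρ x₀ y₀) (by rwa [hf])
  refine ⟨G, by simpa only [ρ, aeval_complex_eq_eval] using hG₀, fun x y hxy => ?_⟩
  rw [← hf]
  exact hG _ (by simpa only [ρ, aeval_complex_eq_eval] using hxy)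

/-- Being in general position is an open condition on lines. -/
theorem exists_open_isGeneralLine (h : IsRuling p q m n) {T : Set ℂ} (hT : T.Finite)
    {Q : MvPolynomial (Fin d) ℂ} {x₀ y₀ : Fin d → ℂ} (h₀ : IsGeneralLine p q m n T Q x₀ y₀) :
    ∃ G : MvPolynomial (Fin d ⊕ Fin d) ℂ, MvPolynomial.eval (Sum.elim x₀ y₀) G ≠ 0 ∧
      ∀ x y, MvPolynomial.eval (Sum.elim x y) G ≠ 0 → IsGeneralLine p q m n T Q x y := by
  obtain ⟨G, hG₀, hG⟩ := h.exists_open_meetPoly hT h₀.simple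
  let ρ : (Fin d → ℂ) → (Fin d → ℂ) → MvPolynomial (Fin d ⊕ Fin d) ℂ →ₐ[ℂ] ℂ :=
    fun x y => MvPolynomial.aeval (Sum.elim x y)
  let L : MvPolynomial (Fin d) ℂ → (MvPolynomial (Fin d ⊕ Fin d) ℂ)[X] :=
    linePoly (fun i => MvPolynomial.X (Sum.inl i)) (fun i => MvPolynomial.X (Sum.inr i))
  set F := rulingForm p q m n with hF
  have hL : ∀ x y F, (L F).map (ρ x y).toRingHom = linePoly x y F := by
    intro x y F
    rw [map_linePoly]
    congr 1 <;> ext i <;> simp [ρ]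
  have hdeg := fun x y : Fin d → ℂ =>
    natDegree_linePoly_le_and_coeff x y F (isHomogeneous_rulingForm (p := p) (q := q))
  -- The restrictions of `F` and `Q` to the line have no common root when their resultant is
  -- nonzero; `F(y) ≠ 0` rules out a common zero at infinity.
  have key : ∀ x y, MvPolynomial.eval y F ≠ 0 →
      (MvPolynomial.eval (Sum.elim x y) (Polynomial.resultant (L F) (L Q) (m + n) (L Q).natDegree)
        ≠ 0 ↔ ∀ z : ℂ, MvPolynomial.eval (x + z • y) F = 0 →
          MvPolynomial.eval (x + z • y) Q ≠ 0) := by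
    intro x y hy
    have h1 : MvPolynomial.eval (Sum.elim x y)
        (Polynomial.resultant (L F) (L Q) (m + n) (L Q).natDegree) =
        Polynomial.resultant (linePoly x y F) (linePoly x y Q) (m + n) (L Q).natDegree := by
      rw [← hL, ← hL, Polynomial.resultant_map_map, ← aeval_complex_eq_eval]
      rfl
    rw [h1, Ne, Polynomial.resultant_eq_zero_iff_common_root (hdeg x y).1
      (by rw [← hL]; exact Polynomial.natDegree_map_le)
      (Or.inl h.curve.degree_ne_zero), (hdeg x y).2, aeval_complex_eq_eval]
    simp only [hy, false_and, false_or, eval_linePoly, aeval_complex_eq_eval, not_exists, not_and]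
  have hren : ∀ x y : Fin d → ℂ, MvPolynomial.eval (Sum.elim x y) (MvPolynomial.rename Sum.inr F) =
      MvPolynomial.eval y F := fun x y => by
    rw [MvPolynomial.eval_rename]; rfl
  refine ⟨G * MvPolynomial.rename Sum.inr F *
    Polynomial.resultant (L F) (L Q) (m + n) (L Q).natDegree, ?_, fun x y hxy => ?_⟩
  · rw [map_mul, map_mul, hren]
    exact mul_ne_zero (mul_ne_zero hG₀ h₀.eval_ne) ((key _ _ h₀.eval_ne).2 h₀.avoid)
  · rw [map_mul, map_mul, hren] at hxy
    have h1 := right_ne_zero_of_mul (left_ne_zero_of_mul hxy)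
    exact ⟨hG _ _ (left_ne_zero_of_mul (left_ne_zero_of_mul hxy)), h1,
      (key _ _ h1).1 (right_ne_zero_of_mul hxy)⟩

/-- For a fixed `x` off the hypersurface, `meetPoly` is a linear system in `y` given by `(x · p) q -
(x · q) p`. This vector vanishes nowhere, not even at infinity, so Bertini applies. -/
theorem exists_isSimpleAway_meetPoly (h : IsRuling p q m n) {T : Set ℂ} (hT : T.Finite) :
    ∃ x y, IsSimpleAway (meetPoly p q x y) (m + n) T := by
  obtain ⟨x, hx⟩ := h.exists_eval_rulingForm_ne_zero
  rw [Ne, h.eval_rulingForm_eq_zero_iff, not_or, not_exists] at hx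
  have hmeet : ∀ y, dotPoly (fun i => dotPoly p x * q i - dotPoly q x * p i) y =
      meetPoly p q x y := by
    intro y
    simp only [dotPoly, meetPoly, Finset.mul_sum]
    rw [← Finset.sum_sub_distrib]
    exact Finset.sum_congr rfl fun i _ => by ring
  have hspan : ∀ (t : ℂ), x ∉ perp (evalVec p t) (evalVec q t) →
      (x ⬝ᵥ evalVec p t) • evalVec q t + (-(x ⬝ᵥ evalVec q t)) • evalVec p t ≠ 0 := by
    intro t ht h0
    have h1 := eq_zero_of_add_smul_eq_zero (h.wedge_ne t) (α := -(x ⬝ᵥ evalVec q t))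
      (β := x ⬝ᵥ evalVec p t) fun j => by
        have := congrFun h0 j
        rw [add_comm] at this
        exact this
    exact ht ⟨h1.2, neg_eq_zero.1 h1.1⟩
  have hspan' : (x ⬝ᵥ coeffVec p m) • coeffVec q n + (-(x ⬝ᵥ coeffVec q n)) • coeffVec p m ≠ 0 := by
    intro h0
    have h1 := eq_zero_of_add_smul_eq_zero h.wedge_top_ne (α := -(x ⬝ᵥ coeffVec q n))
      (β := x ⬝ᵥ coeffVec p m) fun j => by
        have := congrFun h0 j
        rw [add_comm] at this
        exact this
    exact hx.1 ⟨h1.2, neg_eq_zero.1 h1.1⟩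
  have hp := natDegree_dotPoly_le p x h.natDegree_left
  have hq := natDegree_dotPoly_le q x h.natDegree_right
  suffices h1 : (∀ i, (dotPoly p x * q i - dotPoly q x * p i).natDegree ≤ m + n) ∧
      coeffVec (fun i => dotPoly p x * q i - dotPoly q x * p i) (m + n) ≠ 0 ∧
      ∀ t, evalVec (fun i => dotPoly p x * q i - dotPoly q x * p i) t ≠ 0 by
    obtain ⟨y, hy⟩ := exists_isSimpleAway_dotPoly _ (m + n) h1.1 h1.2.1 h1.2.2 hT
    exact ⟨x, y, by rwa [hmeet] at hy⟩
  refine ⟨fun i => ?_, ?_, fun t => ?_⟩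
  · refine (Polynomial.natDegree_sub_le_of_le (m := m + n) (n := m + n) ?_ ?_).trans (max_self _).le
    · exact Polynomial.natDegree_mul_le_of_le hp (h.natDegree_right i)
    · rw [mul_comm]
      exact Polynomial.natDegree_mul_le_of_le (h.natDegree_left i) hq
  · intro h0
    apply hspan'
    rw [← h0]
    ext i
    simp only [coeffVec, Polynomial.coeff_sub]
    rw [Polynomial.coeff_mul_add_eq_of_natDegree_le hp (h.natDegree_right i), mul_comm (dotPoly q x),
      Polynomial.coeff_mul_add_eq_of_natDegree_le (h.natDegree_left i) hq]
    simp only [coeff_dotPoly, Pi.add_apply, Pi.smul_apply, smul_eq_mul, coeffVec]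
    ring
  · intro h0
    apply hspan t (hx.2 t)
    rw [← h0]
    ext i
    simp [evalVec, eval_dotPoly]
    ring

/-- The top coefficient of `meetPoly` is the determinant of the conditions imposed on the line by
the space at infinity. -/
theorem notMem_perp_top (h : IsRuling p q m n) {x y : Fin d → ℂ} {T : Set ℂ}
    (hxy : IsSimpleAway (meetPoly p q x y) (m + n) T) {a b : ℂ} (hab : a • x + b • y ≠ 0) :
    a • x + b • y ∉ perp (coeffVec p m) (coeffVec q n) := by
  intro h1
  have h2 := hxy.coeff_ne
  rw [h.coeff_meetPoly] at h2
  obtain ⟨h3, h4⟩ := mem_perp.1 h1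
  rw [add_dotProduct, smul_dotProduct, smul_dotProduct, smul_eq_mul, smul_eq_mul] at h3 h4
  have ha : a = 0 := (mul_eq_zero.1 (show a * _ = 0 by
    linear_combination (y ⬝ᵥ coeffVec q n) * h3 - (y ⬝ᵥ coeffVec p m) * h4)).resolve_right h2
  have hb : b = 0 := (mul_eq_zero.1 (show b * _ = 0 by
    linear_combination (x ⬝ᵥ coeffVec p m) * h4 - (x ⬝ᵥ coeffVec q n) * h3)).resolve_right h2
  exact hab (by rw [ha, hb, zero_smul, zero_smul, add_zero])

theorem linearIndependent_of_isSimpleAway {x y : Fin d → ℂ} {T : Set ℂ}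
    (hxy : IsSimpleAway (meetPoly p q x y) (m + n) T) : LinearIndependent ℂ ![x, y] := by
  rw [LinearIndependent.pair_iff]
  intro a b hab
  have h1 : ∀ t, a * (meetPoly p q x y).eval t = 0 ∧ b * (meetPoly p q x y).eval t = 0 := by
    intro t
    have h2 := congrArg (· ⬝ᵥ evalVec p t) hab
    have h3 := congrArg (· ⬝ᵥ evalVec q t) hab
    simp only [add_dotProduct, smul_dotProduct, smul_eq_mul, zero_dotProduct] at h2 h3
    rw [eval_meetPoly]
    constructor
    · linear_combination (y ⬝ᵥ evalVec q t) * h2 - (y ⬝ᵥ evalVec p t) * h3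
    · linear_combination (x ⬝ᵥ evalVec p t) * h3 - (x ⬝ᵥ evalVec q t) * h2
  obtain ⟨t, ht⟩ : ∃ t, (meetPoly p q x y).eval t ≠ 0 := by
    by_contra! h2
    exact hxy.ne_zero (Polynomial.funext fun t => by rw [h2 t, Polynomial.eval_zero])
  exact ⟨(mul_eq_zero.1 (h1 t).1).resolve_right ht, (mul_eq_zero.1 (h1 t).2).resolve_right ht⟩

/-- The direction `y` is fixed first, off the hypersurface, and then `x` is moved so that the line
misses the common zeros of `F₀` and `Q`. On such a line every zero of the resultant lies in a space
of finite parameter, so `F₀` vanishes there as well. -/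
theorem exists_isGeneralLine (h : IsRuling p q m n) {T : Set ℂ} (hT : T.Finite)
    {Q : MvPolynomial (Fin d) ℂ}
    (hQ : ∃ t, ∃ x ∈ perp (evalVec p t) (evalVec q t), MvPolynomial.eval x Q ≠ 0) :
    ∃ x y, IsGeneralLine p q m n T Q x y := by
  obtain ⟨x₀, y₀, h₀⟩ := h.exists_isSimpleAway_meetPoly hT
  obtain ⟨G, hG₀, hG⟩ := h.exists_open_meetPoly hT h₀
  have hG0 : G ≠ 0 := by rintro rfl; simp at hG₀
  set F := rulingForm p q m n with hF
  have hF0 : F ≠ 0 := by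
    obtain ⟨x, hx⟩ := h.exists_eval_rulingForm_ne_zero
    rintro h0; rw [← hF, h0] at hx; simp at hx
  have hren : Function.Injective (MvPolynomial.rename (R := ℂ) (Sum.inr : Fin d → Fin d ⊕ Fin d)) :=
    MvPolynomial.rename_injective _ Sum.inr_injective
  obtain ⟨w, hw⟩ := MvPolynomial.exists_eval_ne_zero
    (mul_ne_zero hG0 ((map_ne_zero_iff _ hren).2 hF0))
  obtain ⟨x₁, y, rfl⟩ : ∃ x y : Fin d → ℂ, w = Sum.elim x y :=
    ⟨w ∘ Sum.inl, w ∘ Sum.inr, (Sum.elim_comp_inl_inr w).symm⟩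
  rw [map_mul, MvPolynomial.eval_rename] at hw
  have hFy : MvPolynomial.eval y F ≠ 0 := right_ne_zero_of_mul hw
  have hGx := left_ne_zero_of_mul hw
  have hy0 : y ≠ 0 := by
    rintro rfl
    have := LinearIndependent.ne_zero 1 (linearIndependent_of_isSimpleAway (hG _ _ hGx))
    exact this rfl
  obtain ⟨F₀, hF₀, hdvd, hmem⟩ := h.exists_prime_factor
  have hnd : ¬ F₀ ∣ Q := by
    intro hd
    obtain ⟨t, x, hx, hxQ⟩ := hQ
    exact hxQ (mem_rulingIdeal.1 ((rulingIdeal p q).mem_of_dvd hd hmem) t x hx)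
  obtain ⟨r, hr0, hr⟩ := exists_line_through_avoiding isHomogeneous_rulingForm hF₀ hdvd hnd hy0 hFy
  let Gy : MvPolynomial (Fin d) ℂ :=
    MvPolynomial.aeval (Sum.elim MvPolynomial.X fun i => MvPolynomial.C (y i)) G
  have hGy : ∀ x, MvPolynomial.eval x Gy = MvPolynomial.eval (Sum.elim x y) G := by
    intro x
    rw [← aeval_complex_eq_eval, MvPolynomial.comp_aeval_apply, ← aeval_complex_eq_eval]
    congr 2
    ext s
    rcases s with s | s <;> simp
  have hGy0 : Gy ≠ 0 := by
    intro h0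
    rw [← hGy, h0, map_zero] at hGx
    exact hGx rfl
  obtain ⟨x, hx⟩ := MvPolynomial.exists_eval_ne_zero (mul_ne_zero hGy0 hr0)
  rw [map_mul, hGy] at hx
  have hs := hG _ _ (left_ne_zero_of_mul hx)
  refine ⟨x, y, hs, hFy, fun z hz => hr x (right_ne_zero_of_mul hx) z ?_⟩
  rcases (h.eval_rulingForm_eq_zero_iff _).1 hz with h1 | ⟨t, h1⟩
  · exfalso
    have h2 : x + z • y = (1 : ℂ) • x + z • y := by rw [one_smul]
    rw [h2] at h1
    refine h.notMem_perp_top hs (fun h3 => ?_) h1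
    have := LinearIndependent.pair_iff.1 (linearIndependent_of_isSimpleAway hs) 1 z h3
    exact one_ne_zero this.1
  · exact mem_rulingIdeal.1 hmem t _ h1

/-- The degree of the hypersurface. -/
theorem exists_degree (h : IsRuling p q m n) (hd : 2 ≤ d) {T : Set ℂ} (hT : T.Finite) {k : ℕ}
    (hk : 0 < k)
    (hTk : ∀ t ∉ T, {s | Par (evalVec (wedge p q) s) (evalVec (wedge p q) t)}.ncard = k)
    {Q : MvPolynomial (Fin d) ℂ}
    (hQ₀ : ∃ t, ∃ x ∈ perp (evalVec p t) (evalVec q t), MvPolynomial.eval x Q ≠ 0)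
    (hQ : ∀ x ≠ 0, MvPolynomial.eval x Q ≠ 0 → ∀ s ∉ T, ∀ t, x ∈ perp (evalVec p s) (evalVec q s) →
        x ∈ perp (evalVec p t) (evalVec q t) →
        Par (evalVec (wedge p q) t) (evalVec (wedge p q) s)) :
    ∃ D : ℕ, k * D = m + n ∧ ∃ G : MvPolynomial (Fin (d - 2) × Fin d) ℂ, G ≠ 0 ∧
      ∀ c : Fin (d - 2) → Fin d → ℂ, MvPolynomial.eval (fun a => c a.1 a.2) G ≠ 0 →
      ∀ X : Set (ℙ ℂ (Fin d → ℂ)),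
        (∀ z : ℙ ℂ (Fin d → ℂ), (∃ t, z.rep ∈ perp (evalVec p t) (evalVec q t)) → z ∈ X) →
        (∀ z ∈ X, MvPolynomial.eval z.rep (rulingForm p q m n) = 0) →
        {z ∈ X | ∀ j, c j ⬝ᵥ z.rep = 0}.encard = D := by
  obtain ⟨x₀, y₀, h₀⟩ := h.exists_isGeneralLine hT hQ₀
  obtain ⟨G, hG₀, hG⟩ := h.exists_open_isGeneralLine hT h₀
  obtain ⟨G', hG'0, hG'⟩ := exists_linear_equations hd
    (linearIndependent_of_isSimpleAway h₀.simple) hG₀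
  obtain ⟨D, hD, -⟩ := h.card_mul_encard hTk hQ h₀
  -- `X` lies between the union of the spaces of finite parameter and the zero set of the resultant.
  -- The two agree on a general line, which misses the space at infinity.
  refine ⟨D, hD, G', hG'0, fun c hc X hX hX' => ?_⟩
  obtain ⟨x, y, hxy, hspan⟩ := hG' c hc
  have hgen := hG x y hxy
  obtain ⟨D', hD', hcard⟩ := h.card_mul_encard hTk hQ hgen
  have : D = D' := Nat.eq_of_mul_eq_mul_left hk (hD.trans hD'.symm)
  rw [this, ← hcard]
  congr 1
  ext z
  constructor
  · rintro ⟨hz, hcz⟩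
    obtain ⟨a, b, hab⟩ := (hspan z.rep).1 hcz
    refine ⟨⟨a, b, hab⟩, ?_⟩
    rcases (h.eval_rulingForm_eq_zero_iff _).1 (hX' z hz) with h1 | h1
    · have h2 := z.rep_nonzero
      rw [hab] at h1 h2
      exact absurd h1 (h.notMem_perp_top hgen.simple h2)
    · exact h1
  · rintro ⟨hab, ht⟩
    exact ⟨hX z ht, (hspan z.rep).2 hab⟩

end IsRuling

/-! ### Bases of minimal degree -/

section vecDegree

variable {ι : Type} [Fintype ι] {C : ι → ℝ[X]}

theorem natDegree_le_vecDegree (C : ι → ℝ[X]) (i : ι) : (C i).natDegree ≤ vecDegree C :=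
  Finset.le_sup (f := fun i => (C i).natDegree) (Finset.mem_univ i)

theorem vecDegree_le_iff {n : ℕ} : vecDegree C ≤ n ↔ ∀ i, (C i).natDegree ≤ n := by
  simp [vecDegree, Finset.sup_le_iff]

theorem coeffVec_vecDegree_ne_zero (hC : C ≠ 0) : coeffVec C (vecDegree C) ≠ 0 := by
  obtain ⟨i₀, hi₀⟩ := Function.ne_iff.1 hC
  obtain ⟨i, -, hi⟩ := Finset.exists_mem_eq_sup Finset.univ ⟨i₀, Finset.mem_univ i₀⟩
    fun i => (C i).natDegree
  have hi : vecDegree C = (C i).natDegree := hi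
  intro h0
  have h1 := congrFun h0 i
  rw [coeffVec, hi, Polynomial.coeff_natDegree, Pi.zero_apply, Polynomial.leadingCoeff_eq_zero] at h1
  rw [h1, Polynomial.natDegree_zero] at hi
  have h2 := congrFun h0 i₀
  rw [coeffVec, hi] at h2
  apply hi₀
  rw [Polynomial.eq_C_of_natDegree_le_zero ((natDegree_le_vecDegree C i₀).trans hi.le)]
  simpa using h2

theorem vecDegree_lt {n : ℕ} (hC : C ≠ 0) (h : ∀ i, (C i).natDegree ≤ n)
    (h' : coeffVec C n = 0) : vecDegree C < n :=
  lt_of_le_of_ne (vecDegree_le_iff.2 h) fun hn => coeffVec_vecDegree_ne_zero hC (by rwa [hn])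

theorem vecDegree_eq {n : ℕ} (h : ∀ i, (C i).natDegree ≤ n) (h' : coeffVec C n ≠ 0) :
    vecDegree C = n := by
  refine le_antisymm (vecDegree_le_iff.2 h) ?_
  obtain ⟨i, hi⟩ := Function.ne_iff.1 h'
  exact (Polynomial.le_natDegree_of_ne_zero hi).trans (natDegree_le_vecDegree C i)

end vecDegree

section wedge

variable {R : Type*} [CommRing R] {d : ℕ}

theorem wedge_swap (u v : Fin d → R) : wedge v u = -wedge u v := by
  ext a; simp only [wedge, Pi.neg_apply]; ring

theorem wedge_add_smul (u v : Fin d → R) (a b : R) : wedge u (a • u + b • v) = b • wedge u v := by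
  ext c; simp only [wedge, Pi.add_apply, Pi.smul_apply, smul_eq_mul]; ring

theorem wedge_smul (u v : Fin d → R) (b : R) : wedge u (b • v) = b • wedge u v := by
  ext c; simp only [wedge, Pi.smul_apply, smul_eq_mul]; ring

end wedge

section quasiSpan

variable {d : ℕ} {A B : Fin d → ℝ[X]}

theorem left_mem_quasiSpan : A ∈ quasiSpan A B := ⟨1, 0, fun i => by simp⟩

theorem right_mem_quasiSpan : B ∈ quasiSpan A B := ⟨0, 1, fun i => by simp⟩

/-- Saturation of the module, which allows common polynomial factors to be divided out. -/
theorem mem_quasiSpan_of_smul_mem {π : ℝ[X]} (hπ : π ≠ 0) {C : Fin d → ℝ[X]}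
    (h : π • C ∈ quasiSpan A B) : C ∈ quasiSpan A B := by
  obtain ⟨a, b, hab⟩ := h
  have hπ' : algebraMap ℝ[X] (RatFunc ℝ) π ≠ 0 := by simpa using hπ
  refine ⟨a / algebraMap ℝ[X] (RatFunc ℝ) π, b / algebraMap ℝ[X] (RatFunc ℝ) π, fun i => ?_⟩
  have h1 := hab i
  rw [Pi.smul_apply, smul_eq_mul, map_mul] at h1
  field_simp
  linear_combination h1

theorem wedge_ne_zero_of_linearIndependent (h : LinearIndependent ℝ[X] ![A, B]) :
    wedge A B ≠ 0 := by
  intro h0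
  have hA : A ≠ 0 := h.ne_zero 0
  obtain ⟨i, hi⟩ := Function.ne_iff.1 hA
  have h1 := LinearIndependent.pair_iff.1 h (B i) (-A i) (by
    ext1 j
    have := minor_eq_smul_of_wedge (c := 0) (p' := A) (q' := B) (by rw [h0, zero_smul]) i j
    simp only [Pi.add_apply, Pi.smul_apply, smul_eq_mul, Pi.zero_apply]
    linear_combination -this)
  exact hi (neg_eq_zero.1 h1.2)

theorem par_wedge_of_mem_quasiSpan {u v : Fin d → ℝ[X]} (hu : u ∈ quasiSpan A B)
    (hv : v ∈ quasiSpan A B) : Par (wedge u v) (wedge A B) := by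
  obtain ⟨a, b, hab⟩ := hu
  obtain ⟨a', b', hab'⟩ := hv
  intro i j
  apply IsFractionRing.injective ℝ[X] (RatFunc ℝ)
  simp only [wedge, map_mul, map_sub, hab, hab']
  ring

theorem triple_minor_of_mem_quasiSpan {u v w : Fin d → ℝ[X]} (hu : u ∈ quasiSpan A B)
    (hv : v ∈ quasiSpan A B) (hw : w ∈ quasiSpan A B) (i j l : Fin d) :
    w i * (u j * v l - u l * v j) - w j * (u i * v l - u l * v i) +
      w l * (u i * v j - u j * v i) = 0 := by
  obtain ⟨a, b, hab⟩ := hu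
  obtain ⟨a', b', hab'⟩ := hv
  obtain ⟨a'', b'', hab''⟩ := hw
  apply IsFractionRing.injective ℝ[X] (RatFunc ℝ)
  simp only [map_add, map_mul, map_sub, map_zero, hab, hab', hab'']
  ring

end quasiSpan

/-- A pair of independent elements of `M` whose degrees have the smallest possible sum. -/
structure IsMinimalPair {d : ℕ} (M : Submodule ℝ[X] (Fin d → ℝ[X])) (u v : Fin d → ℝ[X]) : Prop where
  mem_left : u ∈ M
  mem_right : v ∈ M
  wedge_ne : wedge u v ≠ 0
  minimal : ∀ u' ∈ M, ∀ v' ∈ M, wedge u' v' ≠ 0 →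
    vecDegree u + vecDegree v ≤ vecDegree u' + vecDegree v'

namespace IsMinimalPair

variable {d : ℕ} {M : Submodule ℝ[X] (Fin d → ℝ[X])} {u v : Fin d → ℝ[X]}

theorem swap (h : IsMinimalPair M u v) : IsMinimalPair M v u where
  mem_left := h.mem_right
  mem_right := h.mem_left
  wedge_ne := by rw [wedge_swap]; exact neg_ne_zero.2 h.wedge_ne
  minimal := fun u' hu' v' hv' hw => by
    rw [add_comm]; exact h.minimal u' hu' v' hv' hw

theorem vecDegree_right_le (h : IsMinimalPair M u v) {w : Fin d → ℝ[X]} (hw : w ∈ M)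
    (hne : wedge u w ≠ 0) : vecDegree v ≤ vecDegree w := by
  have := h.minimal u h.mem_left w hw hne
  omega

theorem left_ne_zero (h : IsMinimalPair M u v) : u ≠ 0 := by
  rintro rfl
  exact h.wedge_ne (by ext a; simp [wedge])

/-- If the top coefficient vectors were parallel, subtracting a suitable `c X ^ r u` from `v` would
lower the degree of `v` without changing `u ∧ v`. -/
theorem wedge_top_ne_of_le (h : IsMinimalPair M u v) (hle : vecDegree u ≤ vecDegree v) :
    wedge (coeffVec u (vecDegree u)) (coeffVec v (vecDegree v)) ≠ 0 := by
  intro h0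
  have hpar : Par (coeffVec v (vecDegree v)) (coeffVec u (vecDegree u)) := by
    intro i j
    have := minor_eq_smul_of_wedge (p := coeffVec u (vecDegree u)) (c := (0 : ℝ))
      (p' := (0 : Fin d → ℝ)) (q' := (0 : Fin d → ℝ)) (h0.trans (zero_smul _ _).symm) i j
    linear_combination -this
  obtain ⟨c, hc⟩ := hpar.exists_smul (coeffVec_vecDegree_ne_zero h.left_ne_zero)
  let s : ℝ[X] := Polynomial.C (-c) * Polynomial.X ^ (vecDegree v - vecDegree u)
  let w : Fin d → ℝ[X] := s • u + (1 : ℝ[X]) • v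
  have hwi : ∀ i, w i = s * u i + v i := fun i => by
    simp only [w, Pi.add_apply, Pi.smul_apply, smul_eq_mul, one_mul]
  have hw : w ∈ M := add_mem (M.smul_mem _ h.mem_left) (M.smul_mem _ h.mem_right)
  have hne : wedge u w ≠ 0 := by rw [wedge_add_smul, one_smul]; exact h.wedge_ne
  refine (h.vecDegree_right_le hw hne).not_gt (vecDegree_lt ?_ (fun i => ?_) ?_)
  · rintro h1
    rw [h1] at hne
    exact hne (by ext a; simp [wedge])
  · rw [hwi]
    refine (Polynomial.natDegree_add_le_of_le (m := vecDegree v) (n := vecDegree v) ?_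
      (natDegree_le_vecDegree v i)).trans (max_self _).le
    refine Polynomial.natDegree_mul_le.trans ?_
    have h1 : s.natDegree ≤ _ := Polynomial.natDegree_C_mul_X_pow_le (-c) (vecDegree v - vecDegree u)
    have h2 := natDegree_le_vecDegree u i
    omega
  · ext i
    have h1 := congrFun hc i
    simp only [coeffVec, Pi.smul_apply, smul_eq_mul, Pi.zero_apply] at h1 ⊢
    rw [hwi, Polynomial.coeff_add, mul_assoc, Polynomial.coeff_C_mul]
    have h2 : (Polynomial.X ^ (vecDegree v - vecDegree u) * u i).coeff (vecDegree v) =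
        (u i).coeff (vecDegree u) := by
      conv_lhs => rw [show vecDegree v = vecDegree u + (vecDegree v - vecDegree u) by omega]
      rw [Nat.add_sub_cancel_left, Polynomial.coeff_X_pow_mul]
    rw [h2, h1]
    ring

theorem wedge_top_ne (h : IsMinimalPair M u v) :
    wedge (coeffVec u (vecDegree u)) (coeffVec v (vecDegree v)) ≠ 0 := by
  rcases le_total (vecDegree u) (vecDegree v) with hle | hle
  · exact h.wedge_top_ne_of_le hle
  · rw [wedge_swap]
    exact neg_ne_zero.2 (h.swap.wedge_top_ne_of_le hle)

/-- If `π` divided all minors, `u` and `v` would be dependent modulo `π`. Dividing a dependent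
combination with coefficients of degree below `deg π` by `π` gives an element of `M` that can
replace `v` and has smaller degree; if `π` divides `u` itself, `u` is replaced instead. -/
theorem not_dvd_wedge_of_le (h : IsMinimalPair M u v)
    (hM : ∀ π : ℝ[X], π ≠ 0 → ∀ w, π • w ∈ M → w ∈ M) {π : ℝ[X]} (hπ : Prime π)
    (hle : vecDegree u ≤ vecDegree v) : ¬ ∀ a, π ∣ wedge u v a := by
  intro hdvd
  have hπ0 := hπ.ne_zero
  have hπpos : 0 < π.natDegree := Polynomial.natDegree_pos_iff_degree_pos.2
    (Polynomial.degree_pos_of_ne_zero_of_nonunit hπ0 hπ.not_isUnit)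
  have hdeg : ∀ w : Fin d → ℝ[X], w ≠ 0 → ∀ n, (∀ i, (π * w i).natDegree < π.natDegree + n) →
      vecDegree w < n := by
    intro w hw n hn
    obtain ⟨i₀, hi₀⟩ := Function.ne_iff.1 hw
    have h1 : ∀ i, w i ≠ 0 → (w i).natDegree < n := by
      intro i hi
      have := hn i
      rw [Polynomial.natDegree_mul hπ0 hi] at this
      omega
    have hn0 : 0 < n := (Nat.zero_le _).trans_lt (h1 i₀ hi₀)
    rw [vecDegree, Finset.sup_lt_iff hn0]
    intro i _
    by_cases hi : w i = 0
    · rwa [hi, Polynomial.natDegree_zero]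
    · exact h1 i hi
  by_cases hu : ∀ i, π ∣ u i
  · choose w hw using hu
    have hwu : u = π • w := funext hw
    have hwM : w ∈ M := hM π hπ0 w (hwu ▸ h.mem_left)
    have hne : wedge v w ≠ 0 := by
      intro h0
      apply h.swap.wedge_ne
      rw [hwu, wedge_smul, h0, smul_zero]
    have hw0 : w ≠ 0 := by
      rintro rfl
      exact h.left_ne_zero (by rw [hwu, smul_zero])
    refine (h.swap.vecDegree_right_le hwM hne).not_gt (hdeg w hw0 _ fun i => ?_)
    rw [← hw]
    have := natDegree_le_vecDegree u i
    omega
  · obtain ⟨i, hi⟩ := not_forall.1 hu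
    -- Modulo `π` the combination is `v_i u - u_i v`, whose entries are minors up to sign.
    let α := v i % π
    let β := -(u i % π)
    have hβ : β ≠ 0 := by
      rw [neg_ne_zero, Ne, EuclideanDomain.mod_eq_zero]
      exact hi
    have hdvd' : ∀ j, π ∣ α * u j + β * v j := by
      intro j
      obtain ⟨c, hc⟩ : π ∣ u i * v j - u j * v i := by
        rcases lt_trichotomy i j with hij | rfl | hij
        · exact hdvd ⟨(i, j), hij⟩
        · simp
        · rw [show u i * v j - u j * v i = -(u j * v i - u i * v j) by ring]
          exact (dvd_neg).2 (hdvd ⟨(j, i), hij⟩)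
      refine ⟨-c - v i / π * u j + u i / π * v j, ?_⟩
      have h1 := EuclideanDomain.div_add_mod (v i) π
      have h2 := EuclideanDomain.div_add_mod (u i) π
      simp only [α, β]
      linear_combination (u j) * h1 - (v j) * h2 - hc
    choose w hw using hdvd'
    have hwM : π • w ∈ M := by
      have : π • w = α • u + β • v := funext fun j => (hw j).symm
      rw [this]
      exact add_mem (M.smul_mem _ h.mem_left) (M.smul_mem _ h.mem_right)
    have hne : wedge u w ≠ 0 := by
      intro h0
      have h1 : wedge u (π • w) = β • wedge u v := by
        rw [← wedge_add_smul u v α β]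
        congr 1
        exact funext fun j => (hw j).symm
      rw [wedge_smul, h0, smul_zero] at h1
      exact (smul_ne_zero hβ h.wedge_ne) h1.symm
    have hw0 : w ≠ 0 := by
      rintro rfl
      exact hne (by ext a; simp [wedge])
    refine (h.vecDegree_right_le (hM π hπ0 w hwM) hne).not_gt (hdeg w hw0 _ fun j => ?_)
    rw [← hw]
    have hmod : ∀ f : ℝ[X], (f % π).natDegree < π.natDegree := fun f =>
      Polynomial.natDegree_mod_lt f hπpos.ne'
    have h1 := natDegree_le_vecDegree u j
    have h2 := natDegree_le_vecDegree v j
    have h3 := hmod (v i)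
    have h4 := hmod (u i)
    refine (Polynomial.natDegree_add_le _ _).trans_lt (max_lt ?_ ?_)
    · refine Polynomial.natDegree_mul_le.trans_lt ?_
      simp only [α]
      omega
    · refine Polynomial.natDegree_mul_le.trans_lt ?_
      simp only [β, Polynomial.natDegree_neg]
      omega

theorem not_dvd_wedge (h : IsMinimalPair M u v)
    (hM : ∀ π : ℝ[X], π ≠ 0 → ∀ w, π • w ∈ M → w ∈ M) {π : ℝ[X]} (hπ : Prime π) :
    ¬ ∀ a, π ∣ wedge u v a := by
  rcases le_total (vecDegree u) (vecDegree v) with hle | hle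
  · exact h.not_dvd_wedge_of_le hM hπ hle
  · have := h.swap.not_dvd_wedge_of_le hM hπ hle
    rw [wedge_swap] at this
    simpa using this

theorem exists_bezout (h : IsMinimalPair M u v)
    (hM : ∀ π : ℝ[X], π ≠ 0 → ∀ w, π • w ∈ M → w ∈ M) :
    ∃ c : PairIndex d → ℝ[X], ∑ a, c a * wedge u v a = 1 := by
  by_contra hno
  have hI : Ideal.span (Set.range (wedge u v)) ≠ ⊤ := by
    rw [Ne, Ideal.eq_top_iff_one, Ideal.mem_span_range_iff_exists_fun]
    exact hno
  obtain ⟨J, hJ, hle⟩ := Ideal.exists_le_maximal _ hI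
  have hJ0 : J ≠ ⊥ := by
    rintro rfl
    apply h.wedge_ne
    ext1 a
    exact hle (Ideal.subset_span ⟨a, rfl⟩)
  refine h.not_dvd_wedge hM (Submodule.IsPrincipal.prime_generator_of_isPrime J hJ0) fun a => ?_
  rw [← Submodule.IsPrincipal.mem_iff_generator_dvd]
  exact hle (Ideal.subset_span ⟨a, rfl⟩)

end IsMinimalPair

/-- A basis of `M` in degrees `vecDegree u` and `vecDegree v` whose minors have no common zero, not
even at infinity. -/
structure IsReducedBasis {d : ℕ} (M : Submodule ℝ[X] (Fin d → ℝ[X])) (u v : Fin d → ℝ[X]) :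
    Prop where
  mem_left : u ∈ M
  mem_right : v ∈ M
  wedge_top_ne : wedge (coeffVec u (vecDegree u)) (coeffVec v (vecDegree v)) ≠ 0
  bezout : ∃ c : PairIndex d → ℝ[X], ∑ a, c a * wedge u v a = 1
  triple_minor : ∀ w ∈ M, ∀ i j l, w i * (u j * v l - u l * v j) -
    w j * (u i * v l - u l * v i) + w l * (u i * v j - u j * v i) = 0

/-- `A ∧ B` and `u ∧ v` are parallel over the rational functions. Bézout coefficients for `u ∧ v`,
applied to `A ∧ B`, make the factor `g` a polynomial. -/
theorem IsQuasiGenerators.exists_isReducedBasis {d : ℕ} {M : Submodule ℝ[X] (Fin d → ℝ[X])}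
    {A B : Fin d → ℝ[X]} (hAB : IsQuasiGenerators M A B) :
    ∃ u v, IsReducedBasis M u v ∧ ∃ g : ℝ[X], g ≠ 0 ∧ pluckerVec A B = g • wedge u v := by
  obtain ⟨hind, rfl⟩ := hAB
  have hwedge := wedge_ne_zero_of_linearIndependent hind
  obtain ⟨u, v, h⟩ : ∃ u v, IsMinimalPair (quasiSpan A B) u v := by
    classical
    have hex : ∃ n, ∃ u ∈ quasiSpan A B, ∃ v ∈ quasiSpan A B, wedge u v ≠ 0 ∧
        vecDegree u + vecDegree v = n :=
      ⟨_, A, left_mem_quasiSpan, B, right_mem_quasiSpan, hwedge, rfl⟩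
    obtain ⟨u, hu, v, hv, hne, hdeg⟩ := Nat.find_spec hex
    refine ⟨u, v, hu, hv, hne, fun u' hu' v' hv' hne' => ?_⟩
    rw [hdeg]
    exact Nat.find_min' hex ⟨u', hu', v', hv', hne', rfl⟩
  obtain ⟨c, hc⟩ := h.exists_bezout fun π hπ w => mem_quasiSpan_of_smul_mem hπ
  have hmul : pluckerVec A B = (∑ a, c a * wedge A B a) • wedge u v := by
    ext1 b
    have hpar := par_wedge_of_mem_quasiSpan h.mem_left h.mem_right
    calc pluckerVec A B b = (∑ a, c a * wedge u v a) * wedge A B b := by rw [hc, one_mul]; rfl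
      _ = (∑ a, c a * wedge A B a) * wedge u v b := by
        rw [Finset.sum_mul, Finset.sum_mul]
        refine Finset.sum_congr rfl fun a _ => ?_
        linear_combination c a * hpar a b
  refine ⟨u, v, ⟨h.mem_left, h.mem_right, h.wedge_top_ne, ⟨c, hc⟩,
    fun w hw => triple_minor_of_mem_quasiSpan h.mem_left h.mem_right hw⟩, _, ?_, hmul⟩
  intro h0
  rw [h0, zero_smul] at hmul
  exact hwedge hmul

/-! ### Points of the projective line and values of homogenized vectors -/

/-- The point `(t : 1)`. -/
def finitePoint {K : Type} [Field K] (t : K) : ℙ K (Fin 2 → K) :=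
  Projectivization.mk K ![t, 1] fun h => one_ne_zero (congrFun h 1)

/-- The point `(1 : 0)`. -/
def infinitePoint (K : Type) [Field K] : ℙ K (Fin 2 → K) :=
  Projectivization.mk K ![1, 0] fun h => one_ne_zero (congrFun h 0)

/-- The scalar extension of a real polynomial vector. -/
noncomputable def mapVec (K : Type) [Field K] [Algebra ℝ K] {ι : Type} (C : ι → ℝ[X]) : ι → K[X] :=
  fun i => (C i).map (algebraMap ℝ K)

section points

variable {K : Type} [Field K]

theorem exists_rep_finitePoint (t : K) : ∃ c : K, c ≠ 0 ∧ (finitePoint t).rep = ![c * t, c] := by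
  obtain ⟨a, ha⟩ := Projectivization.exists_smul_eq_mk_rep K ![t, 1]
    fun h => one_ne_zero (congrFun h 1)
  refine ⟨a, a.ne_zero, ?_⟩
  rw [finitePoint, ← ha]
  ext i
  fin_cases i <;> simp [Units.smul_def]

theorem exists_rep_infinitePoint : ∃ c : K, c ≠ 0 ∧ (infinitePoint K).rep = ![c, 0] := by
  obtain ⟨a, ha⟩ := Projectivization.exists_smul_eq_mk_rep K (![1, 0] : Fin 2 → K)
    fun h => one_ne_zero (congrFun h 0)
  refine ⟨a, a.ne_zero, ?_⟩
  rw [infinitePoint, ← ha]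
  ext i
  fin_cases i <;> simp [Units.smul_def]

theorem eq_infinitePoint_or (τ : ℙ K (Fin 2 → K)) : τ = infinitePoint K ∨ ∃ t, τ = finitePoint t := by
  by_cases h : τ.rep 1 = 0
  · left
    rw [infinitePoint, ← τ.mk_rep, Par.mk_eq_mk_iff]
    apply Par.of_smul (x := τ.rep 0)
    ext i
    fin_cases i <;> simp [h]
  · right
    refine ⟨τ.rep 0 / τ.rep 1, ?_⟩
    rw [finitePoint]
    conv_lhs => rw [← τ.mk_rep]
    rw [Par.mk_eq_mk_iff]
    apply Par.of_smul (x := τ.rep 1)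
    ext i
    fin_cases i <;> simp [h, mul_div_cancel₀]

theorem finitePoint_injective : Function.Injective (finitePoint (K := K)) := by
  intro s t h
  rw [finitePoint, finitePoint, Par.mk_eq_mk_iff] at h
  simpa using h 0 1

end points

section homEval

variable {K : Type} [Field K] [Algebra ℝ K] {ι : Type} [Fintype ι] (C : ι → ℝ[X])

theorem homEval_finite (c t : K) :
    homEval K C ![c * t, c] = c ^ vecDegree C • evalVec (mapVec K C) t := by
  ext i
  have hdeg : ((C i).map (algebraMap ℝ K)).natDegree < vecDegree C + 1 :=
    Nat.lt_succ_of_le (Polynomial.natDegree_map_le.trans (natDegree_le_vecDegree C i))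
  simp only [homEval, evalVec, mapVec, Pi.smul_apply, smul_eq_mul]
  rw [Polynomial.eval_eq_sum_range' hdeg, Finset.mul_sum]
  refine Finset.sum_congr rfl fun j hj => ?_
  have hj : j ≤ vecDegree C := Nat.lt_succ_iff.1 (Finset.mem_range.1 hj)
  have hpow : c ^ vecDegree C = c ^ j * c ^ (vecDegree C - j) := by
    rw [← pow_add, Nat.add_sub_cancel' hj]
  simp only [Matrix.cons_val_zero, Matrix.cons_val_one, Polynomial.coeff_map, hpow, mul_pow]
  ring

theorem homEval_infinite (c : K) :
    homEval K C ![c, 0] = c ^ vecDegree C • coeffVec (mapVec K C) (vecDegree C) := by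
  ext i
  simp only [homEval, coeffVec, mapVec, Pi.smul_apply, smul_eq_mul, Polynomial.coeff_map]
  rw [Finset.sum_range_succ, Finset.sum_eq_zero]
  · simp [mul_comm]
  · intro j hj
    have : vecDegree C - j ≠ 0 := by have := Finset.mem_range.1 hj; omega
    simp [this]

theorem exists_homEval_finitePoint (t : K) : ∃ c : K, c ≠ 0 ∧
    homEval K C (finitePoint t).rep = c • evalVec (mapVec K C) t := by
  obtain ⟨c, hc, h⟩ := exists_rep_finitePoint t
  exact ⟨c ^ vecDegree C, pow_ne_zero _ hc, by rw [h, homEval_finite C]⟩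

theorem exists_homEval_infinitePoint : ∃ c : K, c ≠ 0 ∧
    homEval K C (infinitePoint K).rep = c • coeffVec (mapVec K C) (vecDegree C) := by
  obtain ⟨c, hc, h⟩ := exists_rep_infinitePoint (K := K)
  exact ⟨c ^ vecDegree C, pow_ne_zero _ hc, by rw [h, homEval_infinite C]⟩

omit [Fintype ι] in
theorem evalVec_mapVec_ofReal (t : ℝ) :
    evalVec (mapVec ℂ C) (t : ℂ) = fun i => ((evalVec C t i : ℝ) : ℂ) := by
  ext i
  simp only [evalVec, mapVec]
  exact Polynomial.eval_map_apply (algebraMap ℝ ℂ) t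

omit [Fintype ι] in
theorem coeffVec_mapVec (e : ℕ) :
    coeffVec (mapVec ℂ C) e = fun i => ((coeffVec C e i : ℝ) : ℂ) := by
  ext i
  simp [coeffVec, mapVec]

omit [Fintype ι] in
theorem mapVec_real : mapVec ℝ C = C := by
  ext1 i
  simp [mapVec]

end homEval

theorem mapVec_wedge (K : Type) [Field K] [Algebra ℝ K] {d : ℕ} (u v : Fin d → ℝ[X]) :
    mapVec K (wedge u v) = wedge (mapVec K u) (mapVec K v) := by
  ext1 a; simp [mapVec, wedge]

theorem dotProduct_ofReal {ι : Type*} [Fintype ι] (x y : ι → ℝ) :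
    (fun i => (x i : ℂ)) ⬝ᵥ (fun i => (y i : ℂ)) = ((x ⬝ᵥ y : ℝ) : ℂ) := by
  simp [dotProduct]

/-! ### The degree of a rational curve -/

/-- A general hyperplane meets the curve in `e` simple parameters with fibres of size `k`. Its
nonzero top coefficient means that it misses the point at infinity, so it does not matter whether
`X` contains that point. -/
theorem IsRationalCurve.exists_degree {ι : Type} [Fintype ι] {v : ι → ℂ[X]} {e : ℕ}
    (hv : IsRationalCurve v e) {T : Set ℂ} (hT : T.Finite) {k : ℕ} (hk : 0 < k)
    (hTk : ∀ t ∉ T, {s | Par (evalVec v s) (evalVec v t)}.ncard = k) :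
    ∃ D : ℕ, k * D = e ∧ ∃ G : MvPolynomial (Fin 1 × ι) ℂ, G ≠ 0 ∧
      ∀ c : Fin 1 → ι → ℂ, MvPolynomial.eval (fun a => c a.1 a.2) G ≠ 0 →
      ∀ X : Set (ℙ ℂ (ι → ℂ)), (∀ t, Projectivization.mk ℂ _ (hv.evalVec_ne t) ∈ X) →
        (∀ y ∈ X, Par (coeffVec v e) y.rep ∨ ∃ t, Par (evalVec v t) y.rep) →
        {y ∈ X | ∀ j, c j ⬝ᵥ y.rep = 0}.encard = D := by
  obtain ⟨c₀, h₀⟩ := exists_isSimpleAway_dotPoly v e hv.natDegree_le hv.coeffVec_ne hv.evalVec_ne hT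
  let ρ : (ι → ℂ) → MvPolynomial ι ℂ →ₐ[ℂ] ℂ := fun x => MvPolynomial.aeval x
  have hρ : ∀ x, (dotForm v).map (ρ x).toRingHom = dotPoly v x := fun x => by
    rw [← map_dotForm]
    congr 1
  obtain ⟨δ, hδ₀, hδ⟩ := IsSimpleAway.exists_open (dotForm v)
    (natDegree_dotForm_le v hv.natDegree_le) hT (ρ c₀) (by rwa [hρ])
  let Ψ : ℂ → ℙ ℂ (ι → ℂ) := fun t => Projectivization.mk ℂ _ (hv.evalVec_ne t)
  have key : ∀ c, IsSimpleAway (dotPoly v c) e T →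
      ∃ D : ℕ, k * D = e ∧ (Ψ '' {t | (dotPoly v c).eval t = 0}).encard = D := by
    intro c hc
    refine hc.mul_card_image Ψ k fun t ht => ?_
    rw [← hTk t (hc.notMem t ht)]
    congr 1
    ext s
    simp only [Ψ, Par.mk_eq_mk_iff, Set.mem_ofPred_eq, and_iff_right_iff_imp]
    intro hs
    rw [eval_dotPoly] at ht ⊢
    exact hs.dotProduct_eq_zero (hv.evalVec_ne t) ht
  obtain ⟨D, hD, -⟩ := key c₀ h₀
  refine ⟨D, hD, MvPolynomial.rename (fun i => (0, i)) δ, ?_, fun c hc X hX hX' => ?_⟩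
  · intro h0
    have : Function.Injective fun i : ι => ((0 : Fin 1), i) := fun i j hij => (Prod.mk.inj hij).2
    rw [map_eq_zero_iff _ (MvPolynomial.rename_injective _ this)] at h0
    rw [h0, map_zero] at hδ₀
    exact hδ₀ rfl
  · rw [MvPolynomial.eval_rename, ← aeval_complex_eq_eval] at hc
    have hs := hδ (ρ (c 0)) hc
    rw [hρ] at hs
    obtain ⟨D', hD', hcard⟩ := key _ hs
    have : D = D' := Nat.eq_of_mul_eq_mul_left hk (hD.trans hD'.symm)
    rw [this, ← hcard]
    congr 1
    ext y
    constructor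
    · rintro ⟨hy, hcy⟩
      rcases hX' y hy with h1 | ⟨t, h1⟩
      · have h2 := h1.dotProduct_eq_zero y.rep_nonzero (hcy 0)
        rw [← coeff_dotPoly] at h2
        exact absurd h2 hs.coeff_ne
      · refine ⟨t, ?_, ?_⟩
        · change (dotPoly v (c 0)).eval t = 0
          rw [eval_dotPoly]
          exact h1.dotProduct_eq_zero y.rep_nonzero (hcy 0)
        · conv_rhs => rw [← y.mk_rep]
          rwa [Par.mk_eq_mk_iff]
    · rintro ⟨t, ht, rfl⟩
      refine ⟨hX t, fun j => ?_⟩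
      have ht : (dotPoly v (c 0)).eval t = 0 := ht
      rw [eval_dotPoly] at ht
      obtain ⟨a, ha⟩ := Projectivization.exists_smul_eq_mk_rep ℂ _ (hv.evalVec_ne t)
      rw [Fin.fin_one_eq_zero j, ← ha, Units.smul_def, dotProduct_smul, ht, smul_zero]

/-- The degree of the hypersurface. -/
theorem IsRuling.exists_degree_of_nondegenerate {d : ℕ} {p q : Fin d → ℂ[X]} {m n : ℕ}
    (h : IsRuling p q m n) (hd : 2 ≤ d) {T : Set ℂ} (hT : T.Finite) {k : ℕ} (hk : 0 < k)
    (hTk : ∀ t ∉ T, {s | Par (evalVec (wedge p q) s) (evalVec (wedge p q) t)}.ncard = k ∧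
      (∀ s, Par (evalVec (wedge p q) s) (evalVec (wedge p q) t) → s ∉ T) ∧
      ¬ Par (coeffVec (wedge p q) (m + n)) (evalVec (wedge p q) t) ∧
      ¬ Par (evalVec (derivVec (wedge p q)) t) (evalVec (wedge p q) t))
    (hnot : d = 3 ∨ ¬ ∃ a ≠ 0, (∀ t, ∀ x ∈ perp (evalVec p t) (evalVec q t), x ⬝ᵥ a = 0) ∧
      ∀ x ∈ perp (coeffVec p m) (coeffVec q n), x ⬝ᵥ a = 0) :
    ∃ D : ℕ, k * D = m + n ∧ ∃ G : MvPolynomial (Fin (d - 2) × Fin d) ℂ, G ≠ 0 ∧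
      ∀ c : Fin (d - 2) → Fin d → ℂ, MvPolynomial.eval (fun a => c a.1 a.2) G ≠ 0 →
      ∀ X : Set (ℙ ℂ (Fin d → ℂ)),
        (∀ z : ℙ ℂ (Fin d → ℂ), (∃ t, z.rep ∈ perp (evalVec p t) (evalVec q t)) → z ∈ X) →
        (∀ z ∈ X, MvPolynomial.eval z.rep (rulingForm p q m n) = 0) →
        {z ∈ X | ∀ j, c j ⬝ᵥ z.rep = 0}.encard = D := by
  have hcard := fun t ht => (hTk t ht).1
  rcases hnot with rfl | hnot
  · refine h.exists_degree hd hT hk hcard (Q := 1) ⟨0, 0, zero_mem _, by simp⟩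
      fun x hx _ s _ t hs ht => ?_
    rw [evalVec_wedge, evalVec_wedge]
    exact par_wedge_of_mem_perp hx ht hs
  · obtain ⟨t₀, ht₀, x₀, hx₀, hx₀top, hx₀', hx₀s⟩ := h.exists_point hT
      (fun t ht => (hTk t ht).2.2.1) (fun t ht => (hTk t ht).2.1) (fun t ht => (hTk t ht).2.2.2) hnot
    obtain ⟨Q, hQ₀, hQ⟩ := h.exists_form_of_point hcard ht₀ hx₀top hx₀' hx₀s
    exact h.exists_degree hd hT hk hcard ⟨t₀, x₀, hx₀, hQ₀⟩ fun x _ => hQ x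

/-! ### The Plücker curve and the hypersurface of a module -/

theorem MvPolynomial.IsHomogeneous.aeval_smul {ι : Type*} {f : MvPolynomial ι ℝ} {n : ℕ}
    (hf : f.IsHomogeneous n) (c : ℂ) (x : ι → ℂ) :
    MvPolynomial.aeval (c • x) f = c ^ n * MvPolynomial.aeval x f := by
  have h : ∀ y : ι → ℂ, MvPolynomial.aeval y f =
      MvPolynomial.eval y (MvPolynomial.map (algebraMap ℝ ℂ) f) := fun y => by
    rw [MvPolynomial.eval_map, MvPolynomial.aeval_def]
  rw [h, h, (hf.map _).eval_smul]

namespace IsReducedBasis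

variable {d : ℕ} {M : Submodule ℝ[X] (Fin d → ℝ[X])} {u v : Fin d → ℝ[X]}

theorem natDegree_wedge_le (u v : Fin d → ℝ[X]) (a : PairIndex d) :
    (wedge u v a).natDegree ≤ vecDegree u + vecDegree v := by
  have h1 := natDegree_le_vecDegree u
  have h2 := natDegree_le_vecDegree v
  refine (Polynomial.natDegree_sub_le_of_le (m := vecDegree u + vecDegree v)
    (n := vecDegree u + vecDegree v) ?_ ?_).trans (max_self _).le
  all_goals exact Polynomial.natDegree_mul_le_of_le (h1 _) (h2 _)

theorem coeffVec_wedge (u v : Fin d → ℝ[X]) :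
    coeffVec (wedge u v) (vecDegree u + vecDegree v) =
      wedge (coeffVec u (vecDegree u)) (coeffVec v (vecDegree v)) :=
  _root_.coeffVec_wedge (natDegree_le_vecDegree u) (natDegree_le_vecDegree v)

/-- The Bézout identity survives extension of scalars, so there are no complex base points either.
-/
theorem evalVec_mapVec_ne_zero (h : IsReducedBasis M u v) {K : Type} [Field K] [Algebra ℝ K] (t : K) :
    evalVec (mapVec K (wedge u v)) t ≠ 0 := by
  obtain ⟨c, hc⟩ := h.bezout
  intro h0
  have h1 := congrArg (fun f : ℝ[X] => (f.map (algebraMap ℝ K)).eval t) hc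
  have h2 : ∀ a, ((wedge u v a).map (algebraMap ℝ K)).eval t = 0 := fun a => congrFun h0 a
  simp only [Polynomial.map_sum, Polynomial.map_mul, Polynomial.eval_finsetSum, Polynomial.eval_mul,
    h2, mul_zero, Finset.sum_const_zero, Polynomial.map_one, Polynomial.eval_one] at h1
  exact zero_ne_one h1

theorem coeffVec_mapVec_ne_zero (h : IsReducedBasis M u v) (K : Type) [Field K] [Algebra ℝ K] :
    coeffVec (mapVec K (wedge u v)) (vecDegree u + vecDegree v) ≠ 0 := by
  intro h0
  apply h.wedge_top_ne
  rw [← coeffVec_wedge]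
  ext a
  have h1 := congrFun h0 a
  simpa [coeffVec, mapVec] using h1

/-- The top coefficient vectors multiply without cancellation. This identifies `deg (A ∧ B) - deg q`
with the sum of the two degrees. -/
theorem vecDegree_smul (h : IsReducedBasis M u v) {g : ℝ[X]} (hg : g ≠ 0) :
    vecDegree (g • wedge u v) = g.natDegree + (vecDegree u + vecDegree v) := by
  have hle := natDegree_wedge_le u v
  apply vecDegree_eq
  · exact fun a => Polynomial.natDegree_mul_le_of_le le_rfl (hle a)
  · have : coeffVec (g • wedge u v) (g.natDegree + (vecDegree u + vecDegree v)) =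
        g.leadingCoeff • coeffVec (wedge u v) (vecDegree u + vecDegree v) := by
      ext a
      simp only [coeffVec, Pi.smul_apply, smul_eq_mul]
      rw [Polynomial.coeff_mul_add_eq_of_natDegree_le le_rfl (hle a)]
      rfl
    rw [this, coeffVec_wedge]
    exact smul_ne_zero (Polynomial.leadingCoeff_ne_zero.2 hg) h.wedge_top_ne

section image

variable {A B : Fin d → ℝ[X]} {g : ℝ[X]} {K : Type} [Field K] [Algebra ℝ K]

/-- The factor `g` only removes its roots from the domain of the rational map. -/
theorem pluckerMapsTo_finitePoint_iff (h : IsReducedBasis M u v)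
    (hAB : pluckerVec A B = g • wedge u v) (t : K) (y : ℙ K (PairIndex d → K)) :
    PluckerMapsTo K A B (finitePoint t) y ↔ (g.map (algebraMap ℝ K)).eval t ≠ 0 ∧
      y = Projectivization.mk K _ (h.evalVec_mapVec_ne_zero t) := by
  obtain ⟨c, hc, hcC⟩ := exists_homEval_finitePoint (pluckerVec A B) t
  have h1 : homEval K (pluckerVec A B) (finitePoint t).rep =
      (c * (g.map (algebraMap ℝ K)).eval t) • evalVec (mapVec K (wedge u v)) t := by
    rw [hcC, hAB, mul_smul]
    congr 1
    ext a
    simp [evalVec, mapVec]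
  have hne := h.evalVec_mapVec_ne_zero t
  have h2 : homEval K (pluckerVec A B) (finitePoint t).rep ≠ 0 ↔
      (g.map (algebraMap ℝ K)).eval t ≠ 0 := by
    rw [h1, smul_ne_zero_iff, mul_ne_zero_iff]
    simp [hc, hne]
  constructor
  · rintro ⟨h3, rfl⟩
    exact ⟨h2.1 h3, (Par.mk_eq_mk_iff _ _).2 (Par.of_smul h1)⟩
  · rintro ⟨h3, rfl⟩
    exact ⟨h2.2 h3, ((Par.mk_eq_mk_iff _ _).2 (Par.of_smul h1)).symm⟩

theorem pluckerMapsTo_infinitePoint_iff (h : IsReducedBasis M u v) (hg : g ≠ 0)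
    (hAB : pluckerVec A B = g • wedge u v) (y : ℙ K (PairIndex d → K)) :
    PluckerMapsTo K A B (infinitePoint K) y ↔
      y = Projectivization.mk K _ (h.coeffVec_mapVec_ne_zero K) := by
  obtain ⟨c, hc, hcC⟩ := exists_homEval_infinitePoint (K := K) (pluckerVec A B)
  have h1 : homEval K (pluckerVec A B) (infinitePoint K).rep =
      (c * algebraMap ℝ K g.leadingCoeff) •
        coeffVec (mapVec K (wedge u v)) (vecDegree u + vecDegree v) := by
    rw [hcC, hAB, mul_smul, h.vecDegree_smul hg]
    congr 1
    ext a
    simp only [coeffVec, mapVec, Pi.smul_apply, smul_eq_mul, Polynomial.coeff_map]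
    rw [Polynomial.coeff_mul_add_eq_of_natDegree_le le_rfl (natDegree_wedge_le u v a), map_mul]
    rfl
  have hne := h.coeffVec_mapVec_ne_zero K
  have h2 : homEval K (pluckerVec A B) (infinitePoint K).rep ≠ 0 := by
    rw [h1, smul_ne_zero_iff, mul_ne_zero_iff]
    simp [hc, hne, hg]
  constructor
  · rintro ⟨h3, rfl⟩
    exact (Par.mk_eq_mk_iff _ _).2 (Par.of_smul h1)
  · rintro rfl
    exact ⟨h2, ((Par.mk_eq_mk_iff _ _).2 (Par.of_smul h1)).symm⟩

theorem mem_pluckerImage_iff (h : IsReducedBasis M u v) (hg : g ≠ 0)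
    (hAB : pluckerVec A B = g • wedge u v) (y : ℙ K (PairIndex d → K)) :
    y ∈ pluckerImage K A B ↔ y = Projectivization.mk K _ (h.coeffVec_mapVec_ne_zero K) ∨
      ∃ t, (g.map (algebraMap ℝ K)).eval t ≠ 0 ∧
        y = Projectivization.mk K _ (h.evalVec_mapVec_ne_zero t) := by
  constructor
  · rintro ⟨τ, hτ⟩
    rcases eq_infinitePoint_or τ with rfl | ⟨t, rfl⟩
    · exact Or.inl ((h.pluckerMapsTo_infinitePoint_iff hg hAB y).1 hτ)
    · exact Or.inr ⟨t, (h.pluckerMapsTo_finitePoint_iff hAB t y).1 hτ⟩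
  · rintro (hy | ⟨t, hy⟩)
    · exact ⟨_, (h.pluckerMapsTo_infinitePoint_iff hg hAB y).2 hy⟩
    · exact ⟨_, (h.pluckerMapsTo_finitePoint_iff hAB t y).2 hy⟩

/-- The complexification of a reduced basis, if the Plücker curve is not a point. -/
theorem isRuling (h : IsReducedBasis M u v) (hg : g ≠ 0) (hAB : pluckerVec A B = g • wedge u v)
    (hcurve : (pluckerImage ℝ A B).Nontrivial) :
    IsRuling (mapVec ℂ u) (mapVec ℂ v) (vecDegree u) (vecDegree v) where
  natDegree_left i := Polynomial.natDegree_map_le.trans (natDegree_le_vecDegree u i)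
  natDegree_right i := Polynomial.natDegree_map_le.trans (natDegree_le_vecDegree v i)
  curve := by
    rw [← mapVec_wedge]
    refine ⟨fun a => Polynomial.natDegree_map_le.trans (natDegree_wedge_le u v a),
      h.coeffVec_mapVec_ne_zero ℂ, h.evalVec_mapVec_ne_zero, ?_⟩
    by_contra! hpar
    have hreal : ∀ s t : ℝ, Par (evalVec (wedge u v) s) (evalVec (wedge u v) t) := by
      intro s t i j
      have h1 := hpar s t i j
      rw [evalVec_mapVec_ofReal, evalVec_mapVec_ofReal] at h1
      beta_reduce at h1
      exact_mod_cast h1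
    have htop : ∀ t : ℝ, Par (coeffVec (wedge u v) (vecDegree u + vecDegree v))
        (evalVec (wedge u v) t) := by
      intro t i j
      -- Constancy at the real finite parameters is a polynomial identity in `s`; comparing top
      -- coefficients extends it to infinity.
      have h1 : wedge u v i * Polynomial.C ((wedge u v j).eval t) =
          wedge u v j * Polynomial.C ((wedge u v i).eval t) :=
        Polynomial.funext fun s => by
          simpa [evalVec] using hreal s t i j
      have h2 := congrArg (fun f : ℝ[X] => f.coeff (vecDegree u + vecDegree v)) h1
      simpa [coeffVec, evalVec] using h2
    obtain ⟨y, hy, z, hz, hyz⟩ := hcurve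
    refine hyz ?_
    have key : ∀ y ∈ pluckerImage ℝ A B, y = Projectivization.mk ℝ _ (h.evalVec_mapVec_ne_zero 0) := by
      intro y hy
      rcases (h.mem_pluckerImage_iff hg hAB y).1 hy with rfl | ⟨t, -, rfl⟩
      · rw [Par.mk_eq_mk_iff, mapVec_real]
        exact htop 0
      · rw [Par.mk_eq_mk_iff, mapVec_real]
        exact hreal t 0
    rw [key y hy, key z hz]

end image

/-! #### Real points -/

/-- Every element of `M` has vanishing 3-minors with `u` and `v`, which are independent at `t`, so
it imposes no further condition. -/
theorem mem_moduleSpace_finitePoint (h : IsReducedBasis M u v) (t : ℝ) (x : Fin d → ℝ) :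
    x ∈ moduleSpace M (finitePoint t) ↔ x ∈ perp (evalVec u t) (evalVec v t) := by
  have key : ∀ C : Fin d → ℝ[X], homEval ℝ C (finitePoint t).rep ⬝ᵥ x = 0 ↔
      x ⬝ᵥ evalVec C t = 0 := by
    intro C
    obtain ⟨c, hc, h1⟩ := exists_homEval_finitePoint C t
    rw [h1, mapVec_real, smul_dotProduct, smul_eq_mul, mul_eq_zero, or_iff_right hc, dotProduct_comm]
  have hne := h.evalVec_mapVec_ne_zero t
  rw [mapVec_real, evalVec_wedge] at hne
  constructor
  · exact fun hx => ⟨(key u).1 (hx u h.mem_left), (key v).1 (hx v h.mem_right)⟩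
  · intro hx C hC
    refine (key C).2 (dotProduct_eq_zero_of_triple_minor hne (fun i j l => ?_) hx)
    have h1 := congrArg (Polynomial.eval t) (h.triple_minor C hC i j l)
    simpa [evalVec] using h1

/-- One inclusion is enough at infinity, since the finite parameters already supply the required
points of the closure. -/
theorem mem_perp_of_mem_moduleSpace_infinitePoint (h : IsReducedBasis M u v) {x : Fin d → ℝ}
    (hx : x ∈ moduleSpace M (infinitePoint ℝ)) :
    x ∈ perp (coeffVec u (vecDegree u)) (coeffVec v (vecDegree v)) := by
  have key : ∀ C ∈ M, x ⬝ᵥ coeffVec C (vecDegree C) = 0 := by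
    intro C hC
    obtain ⟨c, hc, h1⟩ := exists_homEval_infinitePoint (K := ℝ) C
    have h2 : homEval ℝ C (infinitePoint ℝ).rep ⬝ᵥ x = 0 := hx C hC
    rwa [h1, mapVec_real, smul_dotProduct, smul_eq_mul, mul_eq_zero, or_iff_right hc,
      dotProduct_comm] at h2
  exact ⟨key u h.mem_left, key v h.mem_right⟩

theorem ofReal_mem_perp_of_mem_moduleHypersurface (h : IsReducedBasis M u v)
    {x : ℙ ℝ (Fin d → ℝ)} (hx : x ∈ moduleHypersurface M) :
    (fun i => (x.rep i : ℂ)) ∈ perp (coeffVec (mapVec ℂ u) (vecDegree u))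
        (coeffVec (mapVec ℂ v) (vecDegree v)) ∨
      ∃ t, (fun i => (x.rep i : ℂ)) ∈ perp (evalVec (mapVec ℂ u) t) (evalVec (mapVec ℂ v) t) := by
  obtain ⟨τ, hτ⟩ := hx
  rcases eq_infinitePoint_or τ with rfl | ⟨t, rfl⟩
  · left
    have h1 := h.mem_perp_of_mem_moduleSpace_infinitePoint hτ
    rw [mem_perp, coeffVec_mapVec, coeffVec_mapVec, dotProduct_ofReal, dotProduct_ofReal,
      (mem_perp.1 h1).1, (mem_perp.1 h1).2]
    simp
  · right
    have h1 := (h.mem_moduleSpace_finitePoint t _).1 hτ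
    refine ⟨t, ?_⟩
    rw [mem_perp, evalVec_mapVec_ofReal, evalVec_mapVec_ofReal, dotProduct_ofReal,
      dotProduct_ofReal, (mem_perp.1 h1).1, (mem_perp.1 h1).2]
    simp

theorem inHyperplane_of_degenerate (h : IsReducedBasis M u v)
    (ha : ∃ a ≠ 0, (∀ t, ∀ x ∈ perp (evalVec (mapVec ℂ u) t) (evalVec (mapVec ℂ v) t), x ⬝ᵥ a = 0) ∧
      ∀ x ∈ perp (coeffVec (mapVec ℂ u) (vecDegree u)) (coeffVec (mapVec ℂ v) (vecDegree v)),
        x ⬝ᵥ a = 0) : InHyperplane (moduleHypersurface M) := by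
  obtain ⟨a, ha0, ha1, ha2⟩ := ha
  have key : ∀ x ∈ moduleHypersurface M, (fun i => (x.rep i : ℂ)) ⬝ᵥ a = 0 := by
    intro x hx
    rcases h.ofReal_mem_perp_of_mem_moduleHypersurface hx with h1 | ⟨t, h1⟩
    exacts [ha2 _ h1, ha1 t _ h1]
  -- Real points satisfy both the real and the imaginary part of the complex equation, and one of
  -- the two is nonzero.
  by_cases hre : (fun i => (a i).re) = 0
  · refine ⟨fun i => (a i).im, fun him => ha0 ?_, fun x hx => ?_⟩
    · ext1 i
      exact Complex.ext (congrFun hre i) (congrFun him i)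
    · have := congrArg Complex.im (key x hx)
      rw [dotProduct_comm]
      simpa [dotProduct] using this
  · refine ⟨fun i => (a i).re, hre, fun x hx => ?_⟩
    have := congrArg Complex.re (key x hx)
    rw [dotProduct_comm]
    simpa [dotProduct] using this

/-! #### Zariski closures -/

/-- A real form that vanishes on the real curve becomes, after substituting the minors, a polynomial
with infinitely many roots. It is therefore zero, also at complex parameters. -/
theorem mk_mem_complexClosure_pluckerImage (h : IsReducedBasis M u v) {A B : Fin d → ℝ[X]}
    {g : ℝ[X]} (hg : g ≠ 0) (hAB : pluckerVec A B = g • wedge u v) (t : ℂ) :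
    Projectivization.mk ℂ _ (h.evalVec_mapVec_ne_zero t) ∈ complexClosure (pluckerImage ℝ A B) := by
  intro f n hf hvan
  have h0 : MvPolynomial.aeval (wedge u v) f = 0 := by
    refine Polynomial.eq_zero_of_infinite_isRoot _
      ((Polynomial.finite_setOf_eval_eq_zero hg).infinite_compl.mono fun s hs => ?_)
    have hs : g.eval s ≠ 0 := hs
    have h1 := hvan _ ((h.mem_pluckerImage_iff hg hAB _).2
      (Or.inr ⟨s, by simpa using hs, rfl⟩))
    obtain ⟨a, ha⟩ := Projectivization.exists_smul_eq_mk_rep ℝ _ (h.evalVec_mapVec_ne_zero s)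
    rw [← ha, Units.smul_def, hf.eval_smul, mul_eq_zero,
      or_iff_right (pow_ne_zero _ a.ne_zero), mapVec_real] at h1
    change Polynomial.eval s (MvPolynomial.aeval (wedge u v) f) = 0
    rw [← Polynomial.coe_aeval_eq_eval, MvPolynomial.comp_aeval_apply]
    rw [MvPolynomial.aeval_eq_eval]
    exact h1
  obtain ⟨a, ha⟩ := Projectivization.exists_smul_eq_mk_rep ℂ _ (h.evalVec_mapVec_ne_zero t)
  rw [← ha, Units.smul_def, hf.aeval_smul]
  have h1 := congrArg (Polynomial.aeval t) h0
  rw [MvPolynomial.comp_aeval_apply, map_zero] at h1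
  have h2 : evalVec (mapVec ℂ (wedge u v)) t = fun i => Polynomial.aeval t (wedge u v i) := by
    ext i
    simp [evalVec, mapVec, Polynomial.eval_map_algebraMap]
  rw [h2, h1, mul_zero]

theorem par_of_mem_complexClosure_pluckerImage (h : IsReducedBasis M u v) {A B : Fin d → ℝ[X]}
    {g : ℝ[X]} (hg : g ≠ 0) (hAB : pluckerVec A B = g • wedge u v)
    (hv : IsRationalCurve (mapVec ℂ (wedge u v)) (vecDegree u + vecDegree v))
    {y : ℙ ℂ (PairIndex d → ℂ)} (hy : y ∈ complexClosure (pluckerImage ℝ A B)) :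
    Par (coeffVec (mapVec ℂ (wedge u v)) (vecDegree u + vecDegree v)) y.rep ∨
      ∃ t, Par (evalVec (mapVec ℂ (wedge u v)) t) y.rep := by
  by_contra! hno
  obtain ⟨F, hF, hF1, hF2, hF3⟩ := hv.exists_form y.rep_nonzero hno.1 hno.2
  refine hF3 (eval_eq_zero_of_mem_complexClosure hy hF fun x hx => ?_)
  have key : ∀ (w : PairIndex d → ℝ) (hw : w ≠ 0), x = Projectivization.mk ℝ w hw →
      MvPolynomial.eval (fun i => (w i : ℂ)) F = 0 →
      MvPolynomial.eval (fun i => (x.rep i : ℂ)) F = 0 := by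
    rintro w hw rfl h0
    obtain ⟨a, ha⟩ := Projectivization.exists_smul_eq_mk_rep ℝ w hw
    have : (fun i => ((Projectivization.mk ℝ w hw).rep i : ℂ)) = ((a : ℝ) : ℂ) • fun i => (w i : ℂ) := by
      ext i
      rw [← ha]
      simp [Units.smul_def]
    rw [this, hF.eval_smul, h0, mul_zero]
  rcases (h.mem_pluckerImage_iff hg hAB x).1 hx with h1 | ⟨t, -, h1⟩
  · refine key _ _ h1 ?_
    rw [mapVec_real, ← coeffVec_mapVec]
    exact hF2
  · refine key _ _ h1 ?_
    rw [mapVec_real, ← evalVec_mapVec_ofReal]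
    exact hF1 t

theorem exists_ne_zero_mem_perp {p q : Fin d → ℝ} (hd : 3 ≤ d) : ∃ x ≠ 0, x ∈ perp p q := by
  let L : (Fin d → ℝ) →ₗ[ℝ] (Fin 2 → ℝ) := Matrix.mulVecLin (Matrix.of ![p, q])
  obtain ⟨x, hx, hx0⟩ := (Submodule.ne_bot_iff _).1
    (LinearMap.ker_ne_bot_of_finrank_lt (f := L) (by simp; omega))
  refine ⟨x, hx0, ?_⟩
  have h1 : L x = 0 := hx
  have h2 := congrFun h1 0
  have h3 := congrFun h1 1
  simp only [L, Matrix.mulVecLin_apply, Matrix.mulVec, Matrix.of_apply, Matrix.cons_val_zero,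
    Matrix.cons_val_one, Pi.zero_apply] at h2 h3
  exact ⟨(dotProduct_comm _ _).trans h2, (dotProduct_comm _ _).trans h3⟩

/-- The form, pulled back along the real polynomial parametrization of the spaces, vanishes at all
real points and so identically. Evaluating at complex parameters reaches `z`. -/
theorem mem_complexClosure_moduleHypersurface (h : IsReducedBasis M u v) (hd : 3 ≤ d)
    {z : ℙ ℂ (Fin d → ℂ)} {t : ℂ}
    (hz : z.rep ∈ perp (evalVec (mapVec ℂ u) t) (evalVec (mapVec ℂ v) t)) :
    z ∈ complexClosure (moduleHypersurface M) := by
  intro f n hf hvan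
  have hreal : ∀ s, ∀ x ∈ perp (evalVec u s) (evalVec v s), MvPolynomial.eval x f = 0 := by
    have hne : ∀ s, ∀ x ∈ perp (evalVec u s) (evalVec v s), x ≠ 0 → MvPolynomial.eval x f = 0 := by
      intro s x hx hx0
      obtain ⟨a, ha⟩ := Projectivization.exists_smul_eq_mk_rep ℝ x hx0
      have h1 := hvan (Projectivization.mk ℝ x hx0)
        ⟨finitePoint s, (h.mem_moduleSpace_finitePoint s _).2
          (by rw [← ha]; exact Submodule.smul_mem _ _ hx)⟩
      rwa [← ha, Units.smul_def, hf.eval_smul, mul_eq_zero,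
        or_iff_right (pow_ne_zero _ a.ne_zero)] at h1
    intro s x hx
    -- The zero vector is no projective point, and a form of degree `0` need not vanish there. A
    -- nonzero vector of the same space, which exists because `d ≥ 3`, settles this.
    by_cases hx0 : x = 0
    · obtain ⟨y, hy0, hy⟩ := exists_ne_zero_mem_perp (p := evalVec u s) (q := evalVec v s) hd
      rw [hx0, ← zero_smul ℝ y, hf.eval_smul, hne s y hy hy0, mul_zero]
    · exact hne s x hx hx0
  have hpoly : ∀ i j, MvPolynomial.aeval (perpPoly u v i j) f = 0 := by
    intro i j
    refine MvPolynomial.funext fun w => ?_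
    have hw : w = fun o : Option (Fin d) => o.elim (w none) (fun l => w (some l)) := by
      ext o; cases o <;> rfl
    have haev : ∀ {ι : Type} (x : ι → ℝ) (F : MvPolynomial ι ℝ),
        MvPolynomial.eval x F = MvPolynomial.aeval x F := fun x F => by
      rw [MvPolynomial.aeval_eq_eval]
    rw [haev, hw, aeval_aeval_perpPoly, map_zero, ← haev]
    exact hreal (w none) _ (perpProj_mem_perp i j _)
  have hne := h.evalVec_mapVec_ne_zero t
  rw [mapVec_wedge, evalVec_wedge] at hne
  obtain ⟨i, j, hij⟩ := exists_minor_ne_zero hne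
  have h1 := aeval_aeval_perpPoly u v i j t z.rep f
  have haev : ∀ C : Fin d → ℝ[X], (fun l => Polynomial.aeval t (C l)) = evalVec (mapVec ℂ C) t := by
    intro C
    ext l
    simp [evalVec, mapVec, Polynomial.eval_map_algebraMap]
  rw [hpoly, map_zero, haev, haev, perpProj_of_mem_perp i j hz, hf.aeval_smul] at h1
  exact (mul_eq_zero.1 h1.symm).resolve_left (pow_ne_zero _ hij)

theorem eval_rulingForm_of_mem_complexClosure (h : IsReducedBasis M u v)
    (hR : IsRuling (mapVec ℂ u) (mapVec ℂ v) (vecDegree u) (vecDegree v))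
    {z : ℙ ℂ (Fin d → ℂ)} (hz : z ∈ complexClosure (moduleHypersurface M)) :
    MvPolynomial.eval z.rep
      (rulingForm (mapVec ℂ u) (mapVec ℂ v) (vecDegree u) (vecDegree v)) = 0 :=
  eval_eq_zero_of_mem_complexClosure hz IsRuling.isHomogeneous_rulingForm fun _ hx =>
    (hR.eval_rulingForm_eq_zero_iff _).2 (h.ofReal_mem_perp_of_mem_moduleHypersurface hx)

/-- The degree of the parametrization. -/
theorem hasParamDegree (h : IsReducedBasis M u v) {A B : Fin d → ℝ[X]} {g : ℝ[X]} (hg : g ≠ 0)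
    (hAB : pluckerVec A B = g • wedge u v)
    (hv : IsRationalCurve (mapVec ℂ (wedge u v)) (vecDegree u + vecDegree v))
    {T : Set ℂ} (hT : T.Finite) (hgT : {t | (g.map (algebraMap ℝ ℂ)).eval t = 0} ⊆ T) {k : ℕ}
    (hTk : ∀ t ∉ T, {s | Par (evalVec (mapVec ℂ (wedge u v)) s)
        (evalVec (mapVec ℂ (wedge u v)) t)}.ncard = k ∧
      (∀ s, Par (evalVec (mapVec ℂ (wedge u v)) s) (evalVec (mapVec ℂ (wedge u v)) t) → s ∉ T) ∧
      ¬ Par (coeffVec (mapVec ℂ (wedge u v)) (vecDegree u + vecDegree v))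
        (evalVec (mapVec ℂ (wedge u v)) t)) :
    HasParamDegree A B k := by
  let Ψ : ℂ → ℙ ℂ (PairIndex d → ℂ) := fun t => Projectivization.mk ℂ _ (h.evalVec_mapVec_ne_zero t)
  have hgt : ∀ t ∉ T, (g.map (algebraMap ℝ ℂ)).eval t ≠ 0 := fun t ht h0 => ht (hgT h0)
  have hmem : ∀ t ∉ T, Ψ t ∈ pluckerImage ℂ A B := fun t ht =>
    (h.mem_pluckerImage_iff hg hAB _).2 (Or.inr ⟨t, hgt t ht, rfl⟩)
  constructor
  · intro hfin
    have h1 : (Ψ ⁻¹' pluckerImage ℂ A B).Finite := by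
      refine hfin.preimage' fun b _ => (hv.finite_fiber b.rep_nonzero).subset fun s hs => ?_
      have hs : Ψ s = b := hs
      rw [← b.mk_rep] at hs
      exact (Par.mk_eq_mk_iff _ _).1 hs
    exact hT.infinite_compl (h1.subset hmem)
  · refine ((hT.image Ψ).insert
      (Projectivization.mk ℂ _ (h.coeffVec_mapVec_ne_zero ℂ))).subset ?_
    rintro y ⟨hy, hyk⟩
    rcases (h.mem_pluckerImage_iff hg hAB y).1 hy with rfl | ⟨t, -, rfl⟩
    · exact Set.mem_insert _ _
    refine Set.mem_insert_of_mem _ ⟨t, ?_, rfl⟩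
    -- For `t` outside `T`, the whole fibre avoids the roots of `g` and the point at infinity, so no
    -- parameter of the line is lost or gained.
    by_contra ht
    obtain ⟨hcard, hsat, htop⟩ := hTk t ht
    apply hyk
    rw [← hcard, (hv.finite_fiber (hv.evalVec_ne t)).cast_ncard_eq,
      ← (finitePoint_injective (K := ℂ)).encard_image]
    congr 1
    ext τ
    constructor
    · intro hτ
      rcases eq_infinitePoint_or τ with rfl | ⟨s, rfl⟩
      · have h1 := (h.pluckerMapsTo_infinitePoint_iff hg hAB _).1 hτ
        exact absurd ((Par.mk_eq_mk_iff _ _).1 h1.symm) htop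
      · have h1 := ((h.pluckerMapsTo_finitePoint_iff hAB s _).1 hτ).2
        exact ⟨s, (Par.mk_eq_mk_iff _ _).1 h1.symm, rfl⟩
    · rintro ⟨s, hs, rfl⟩
      exact (h.pluckerMapsTo_finitePoint_iff hAB s _).2
        ⟨hgt s (hsat s hs), ((Par.mk_eq_mk_iff _ _).2 hs).symm⟩

end IsReducedBasis

theorem proposition4 {d : ℕ} (M : Submodule ℝ[X] (Fin d → ℝ[X])) (A B : Fin d → ℝ[X])
    (hAB : IsQuasiGenerators M A B)
    (q : ℝ[X]) (hq : ∀ g : ℝ[X], g ∣ q ↔ ∀ p, g ∣ pluckerVec A B p)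
    (hcurve : (pluckerImage ℝ A B).Nontrivial) :
    ∃ k degP : ℕ, HasParamDegree A B k ∧ HasDimDegree (pluckerImage ℝ A B) 1 degP ∧
      k * degP + q.natDegree = vecDegree (pluckerVec A B) ∧
      (d = 3 ∨ ¬ InHyperplane (moduleHypersurface M) →
        ∃ degS : ℕ, HasDimDegree (moduleHypersurface M) (d - 2) degS ∧
          k * degS + q.natDegree = vecDegree (pluckerVec A B) ∧
          degP = degS) := by
  obtain ⟨u, v, h, g, hg, hguv⟩ := hAB.exists_isReducedBasis
  have hR := h.isRuling hg hguv hcurve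
  have hv := hR.curve
  rw [← mapVec_wedge] at hv
  -- `q` and `g` divide each other: Bézout writes `g` as a combination of the entries of `g (u ∧
  -- v)`.
  have hqg : q.natDegree = g.natDegree := by
    have h1 : g ∣ q := (hq g).2 fun p => by rw [hguv]; exact dvd_mul_right _ _
    have h2 : q ∣ g := by
      obtain ⟨c, hc⟩ := h.bezout
      have h3 : g = ∑ a, c a * (g * wedge u v a) := by
        conv_lhs => rw [← mul_one g, ← hc, Finset.mul_sum]
        exact Finset.sum_congr rfl fun a _ => by ring
      rw [h3]
      refine Finset.dvd_sum fun a _ => Dvd.dvd.mul_left ?_ _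
      have h4 := (hq q).1 dvd_rfl a
      rwa [hguv] at h4
    have hq0 : q ≠ 0 := by rintro rfl; exact hg (zero_dvd_iff.1 h2)
    exact le_antisymm (Polynomial.natDegree_le_of_dvd h2 hg) (Polynomial.natDegree_le_of_dvd h1 hq0)
  have hdeg : vecDegree (pluckerVec A B) = g.natDegree + (vecDegree u + vecDegree v) := by
    rw [hguv, h.vecDegree_smul hg]
  -- For `d ≤ 2` there is at most one Plücker coordinate, so the image has at most one point.
  have hd : 3 ≤ d := by
    by_contra hd
    obtain ⟨y, -, z, -, hyz⟩ := hcurve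
    apply hyz
    have hsub : Subsingleton (PairIndex d) := by
      refine ⟨fun a b => Subtype.ext (Prod.ext (Fin.ext ?_) (Fin.ext ?_))⟩
      all_goals
        have h1 : (a.1.1 : ℕ) < a.1.2 := a.2
        have h2 : (b.1.1 : ℕ) < b.1.2 := b.2
        have h3 := a.1.2.isLt
        have h4 := b.1.2.isLt
        omega
    rw [← y.mk_rep, ← z.mk_rep, Par.mk_eq_mk_iff]
    intro i j
    rw [Subsingleton.elim i j]
  obtain ⟨k, T, hT, hgT, hk, hTk⟩ := hv.exists_card_fiber
    (T₁ := {t | (g.map (algebraMap ℝ ℂ)).eval t = 0})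
    (Polynomial.finite_setOf_eval_eq_zero ((Polynomial.map_ne_zero_iff
      (algebraMap ℝ ℂ).injective).2 hg))
  obtain ⟨D, hD, G, hG, hcard⟩ := hv.exists_degree hT hk fun t ht => (hTk t ht).1
  have hpos := hv.degree_ne_zero
  have hDpos : 0 < D := Nat.pos_of_ne_zero (by rintro rfl; rw [mul_zero] at hD; exact hpos hD.symm)
  refine ⟨k, D, h.hasParamDegree hg hguv hv hT hgT
      fun t ht => ⟨(hTk t ht).1, (hTk t ht).2.1, (hTk t ht).2.2.1⟩,
    ⟨hDpos, G, hG, fun c hc => hcard c hc _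
      (h.mk_mem_complexClosure_pluckerImage hg hguv)
      fun y hy => h.par_of_mem_complexClosure_pluckerImage hg hguv hv hy⟩, by omega, fun hcase => ?_⟩
  obtain ⟨D', hD', G', hG', hcard'⟩ := hR.exists_degree_of_nondegenerate (by omega) hT hk
    (by rwa [← mapVec_wedge]) (hcase.imp_right fun hno ha => hno (h.inHyperplane_of_degenerate ha))
  have hDD : D = D' := Nat.eq_of_mul_eq_mul_left hk (hD.trans hD'.symm)
  refine ⟨D', ⟨hDD ▸ hDpos, G', hG', fun c hc => hcard' c hc _
    (fun z ⟨t, hz⟩ => h.mem_complexClosure_moduleHypersurface hd hz)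
    fun z hz => h.eval_rulingForm_of_mem_complexClosure hR hz⟩, by omega, hDD⟩
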